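/- Let $p$ be a prime and $i\ge 0$ an integer. For a cosimplicial commutative ring $A$ let $H^i(A)$ be the $i$-th cohomology of the cochain complex of $A$ (differential the alternating sum of the coface maps). **The operations.** Let $R=\mathbb Z_p$ or $R=\mathbb F_p$. Write $R[-i]$ also for the cosimplicial $R$-module attached to it by the Dold–Kan correspondence, with generator $\iota\in R[-i]^i$. For a free $R$-module $M$ put $S^pM=(M^{\otimes p})_{S_p}$, $\Gamma^pM=(M^{\otimes p})^{S_p}$, let $N_p:S^pM\to\Gamma^pM$ be the norm map $\sum_{\sigma\in S_p}\sigma$, and let $T_p=\mathrm{cofib}(N_p)$. Applied termwise to $R[-i]$ these give a fibre sequence $$T_p(R[-i])[-1]\xrightarrow{\ \gamma\ }S^p(R[-i])\xrightarrow{\ N_p\ }\Gamma^p(R[-i]),$$ where $T_p(R[-i])$ is represented by the cone of $N_p$, whose degree-$i$ cocycles are the pairs $(g,s)\in\Gamma^p(R[-i])^i\oplus S^p(R[-i])^{i+1}$ with $ds=0$ and $N_p s+dg=0$, and $\gamma(g,s)=s$. There is a unique class $1\in H^i(T_p(R[-i]))$ that maps to the class of $\iota^{\otimes p}$ in $\mathrm{coker}\,N_p$;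 put $P^1_R:=\gamma(1)\in H^{i+1}(S^p(R[-i]))$. For $R=\mathbb F_p$ let $P^0_{\mathbb F_p}\in H^i(S^p(\mathbb F_p[-i]))$ be the class of $\iota^p$, the image of $\iota$ under the map $\Delta:m\mapsto m^p$. A class $c\in H^j(S^p(R[-i]))$ defines an operation $H^i(A)\to H^j(A)$ for every cosimplicial commutative $R$-algebra $A$: represent $[x]\in H^i(A)$ by a map $x:R[-i]\to A$ of cosimplicial $R$-modules and send $[x]$ to the image of $c$ under $S^p(R[-i])\xrightarrow{S^px}S^pA\xrightarrow{m_A}A$, with $m_A$ the multiplication. **Statement.** 1. For every cosimplicial commutative $\mathbb Z_p$-algebra $A$, the operation $P^1_{\mathbb Z_p}:H^i(A)\to H^{i+1}(A)$ is well defined and equal to the composition $$H^i(A)\to H^i(A/p)\xrightarrow{\ \varphi_{A/p}\ }H^i(A/p)\xrightarrow{\ \mathrm{Bock}_A\ }H^{i+1}(A).$$ Here $A/p$ is the derived reduction, $\varphi_{A/p}$ its Frobenius endomorphism, and $\mathrm{Bock}_A$ the connecting homomorphism of $A\xrightarrow{p}A\to A/p$. If $A$ is termwise flat over $\mathbb Z_p$,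 then $A/p$ is the termwise quotient and $\varphi_{A/p}$ is the termwise $p$-th power map. In general they are computed by any simplicial resolution $P_\bullet\to A$ by termwise flat cosimplicial commutative $\mathbb Z_p$-algebras: $H^*(A)$ is identified with $H^*(\mathrm{Tot}\,P_\bullet)$, where $(\mathrm{Tot}\,P_\bullet)^k=\prod_{n-m=k}P_m^n$, the map $H^i(\mathrm{Tot}\,P_\bullet)\to H^i(A)$ being bijective; $A/p$ is represented by $P_\bullet/p$, $\varphi_{A/p}$ by the termwise $p$-th power map of $P_\bullet/p$, and $\mathrm{Bock}_A$ by the connecting homomorphism of $P_\bullet\xrightarrow{p}P_\bullet\to P_\bullet/p$. 2. For every cosimplicial commutative $\mathbb F_p$-algebra $A_0$, the operation $P^0_{\mathbb F_p}:H^i(A_0)\to H^i(A_0)$ is well defined and equal to the map induced by the Frobenius endomorphism $a\mapsto a^p$ of $A_0$. 3. For every cosimplicial commutative $\mathbb F_p$-algebra $A_0$, the operation $P^1_{\mathbb F_p}:H^i(A_0)\to H^{i+1}(A_0)$ is well defined and equal to the connecting homomorphism of the termwise exact sequence $0\to A_0\xrightarrow{V}W_2(A_0)\to A_0\to 0$,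 where $W_2$ (the $p$-typical Witt vectors of length two) is applied termwise, $V(a)=(0,a)$ and the second map is $(a_0,a_1)\mapsto a_0$. -/

import Mathlib

open CategoryTheory AlgebraicTopology Opposite Simplicial TensorProduct

universe v w

noncomputable section

namespace CosimplicialSteenrod

/-! ## Symmetric powers, divided powers and the norm map -/

section Powers

variable {R : Type} [CommRing R] (p : ℕ)

/-- The `p`-th tensor power of a module. -/
abbrev Ten (R : Type) [CommRing R] (p : ℕ) (M : Type v) [AddCommGroup M] [Module R M] :=
  ⨂[R] _ : Fin p, M

/-- The `p`-th symmetric power `S^p M = (M^{⊗p})_{S_p}`. -/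
abbrev Sym (R : Type) [CommRing R] (p : ℕ) (M : Type v) [AddCommGroup M] [Module R M] :=
  SymmetricPower R (Fin p) M

variable {M : Type v} [AddCommGroup M] [Module R M] {N : Type w} [AddCommGroup N] [Module R N]
variable {L : Type*} [AddCommGroup L] [Module R L]

/-- The permutation action of the symmetric group on the `p`-th tensor power. -/
def perm (e : Equiv.Perm (Fin p)) : Ten R p M →ₗ[R] Ten R p M :=
  (PiTensorProduct.reindex R (fun _ : Fin p => M) e).toLinearMap

theorem perm_tprod (e : Equiv.Perm (Fin p)) (x : Fin p → M) :
    perm p e (PiTensorProduct.tprod R x) = PiTensorProduct.tprod R (fun k => x (e.symm k)) :=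
  PiTensorProduct.reindex_tprod e x

/-- A linear map on the tensor power which is invariant under permutations of the factors
descends to the symmetric power. -/
def symLift (f : Ten R p M →ₗ[R] N)
    (hf : ∀ (e : Equiv.Perm (Fin p)) (x : Fin p → M),
      f (PiTensorProduct.tprod R (fun k => x (e k))) = f (PiTensorProduct.tprod R x)) :
    Sym R p M →ₗ[R] N where
  __ := AddCon.lift (addConGen (SymmetricPower.Rel R (Fin p) M)) f.toAddMonoidHom
    (AddCon.addConGen_le.2 fun x y h => by
      cases h with
      | perm e x => exact (hf e x).symm)
  map_smul' r x := by
    induction x using AddCon.induction_on with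
    | H x => exact f.map_smul r x

theorem symLift_mk (f : Ten R p M →ₗ[R] N) (hf) (t : Ten R p M) :
    symLift p f hf (SymmetricPower.mk R (Fin p) M t) = f t := rfl

theorem sym_ext {f g : Sym R p M →ₗ[R] N}
    (h : ∀ x : Fin p → M, f (SymmetricPower.tprod R x) = g (SymmetricPower.tprod R x)) :
    f = g :=
  LinearMap.ext_on (SymmetricPower.span_tprod_eq_top R (Fin p) M)
    (by rintro _ ⟨x, rfl⟩; exact h x)

/-- Functoriality of the symmetric power. -/
def symMap (f : M →ₗ[R] N) : Sym R p M →ₗ[R] Sym R p N :=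
  symLift p (SymmetricPower.mk R (Fin p) N ∘ₗ PiTensorProduct.map (fun _ => f)) (by
    intro e x
    simp only [LinearMap.comp_apply, PiTensorProduct.map_tprod]
    exact SymmetricPower.tprod_equiv e (fun k => f (x k)))

theorem symMap_tprod (f : M →ₗ[R] N) (x : Fin p → M) :
    symMap p f (SymmetricPower.tprod R x) = SymmetricPower.tprod R (fun k => f (x k)) := by
  change SymmetricPower.mk R (Fin p) N
    (PiTensorProduct.map (fun _ => f) (PiTensorProduct.tprod R x)) = _
  rw [PiTensorProduct.map_tprod]
  rfl

/-- The divided power `Γ^p M = (M^{⊗p})^{S_p}` of a flat module, the invariants in the tensor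
power. -/
def Div (R : Type) [CommRing R] (p : ℕ) (M : Type v) [AddCommGroup M] [Module R M] :
    Submodule R (Ten R p M) where
  carrier := {t | ∀ e : Equiv.Perm (Fin p), perm p e t = t}
  add_mem' ha hb e := by rw [map_add, ha e, hb e]
  zero_mem' e := map_zero _
  smul_mem' r t ht e := by rw [map_smul, ht e]

theorem map_perm (f : M →ₗ[R] N) (e : Equiv.Perm (Fin p)) (t : Ten R p M) :
    perm p e (PiTensorProduct.map (fun _ => f) t) =
      PiTensorProduct.map (fun _ => f) (perm p e t) := by
  have : (perm p e ∘ₗ PiTensorProduct.map (fun _ => f) : Ten R p M →ₗ[R] Ten R p N) =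
      PiTensorProduct.map (fun _ => f) ∘ₗ perm p e := by
    refine PiTensorProduct.ext (MultilinearMap.ext fun x => ?_)
    simp only [LinearMap.compMultilinearMap_apply, LinearMap.comp_apply,
      PiTensorProduct.map_tprod, perm_tprod]
  exact LinearMap.congr_fun this t

/-- Functoriality of the divided power. -/
def divMap (f : M →ₗ[R] N) : Div R p M →ₗ[R] Div R p N :=
  (PiTensorProduct.map (fun _ => f)).restrict (p := Div R p M) (q := Div R p N)
    (fun t ht e => by rw [map_perm, ht e])

/-- The norm map `N_p = ∑_{σ ∈ S_p} σ : S^p M → Γ^p M`. -/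
def normMap (R : Type) [CommRing R] (p : ℕ) (M : Type v) [AddCommGroup M] [Module R M] :
    Sym R p M →ₗ[R] Div R p M :=
  symLift p
    ((∑ e : Equiv.Perm (Fin p), perm p e).codRestrict (Div R p M) (by
      intro t e
      have hcomp : ∀ e' : Equiv.Perm (Fin p), perm p e (perm p e' t) = perm p (e * e') t := by
        intro e'
        have : (perm p e ∘ₗ perm p e' : Ten R p M →ₗ[R] Ten R p M) = perm p (e * e') := by
          refine PiTensorProduct.ext (MultilinearMap.ext fun x => ?_)
          simp only [LinearMap.compMultilinearMap_apply, LinearMap.comp_apply, perm_tprod]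
          rfl
        exact LinearMap.congr_fun this t
      simp only [LinearMap.sum_apply, map_sum, hcomp]
      exact Fintype.sum_equiv (Equiv.mulLeft e) _ _ (fun _ => rfl)))
    (by
      intro e x
      apply Subtype.ext
      change (∑ e : Equiv.Perm (Fin p), perm p e) (PiTensorProduct.tprod R (fun k => x (e k))) =
        (∑ e : Equiv.Perm (Fin p), perm p e) (PiTensorProduct.tprod R x)
      simp only [LinearMap.sum_apply, perm_tprod]
      refine Fintype.sum_equiv (Equiv.mulRight e⁻¹) _ _ (fun e' => ?_)
      rfl)

/-- The class `m^{⊗p}` in `Γ^p M`. -/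
def divPow (m : M) : Div R p M :=
  ⟨PiTensorProduct.tprod R (fun _ => m), fun e => by rw [perm_tprod]⟩

/-- The class `m^p` in `S^p M`. -/
def symPow (m : M) : Sym R p M := SymmetricPower.tprod R (fun _ => m)

/-- For a linear map `f` into a commutative algebra `B`, the composite
`S^p M → S^p B → B` of `S^p f` with the multiplication; it sends `x₁ ⋯ x_p` to
`f x₁ * ⋯ * f x_p`. -/
def symMul {B : Type w} [CommRing B] [Algebra R B] (f : M →ₗ[R] B) : Sym R p M →ₗ[R] B :=
  symLift p (PiTensorProduct.lift ((MultilinearMap.mkPiAlgebra R (Fin p) B).compLinearMap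
    (fun _ => f))) (by
    intro e x
    simp only [PiTensorProduct.lift.tprod, MultilinearMap.compLinearMap_apply,
      MultilinearMap.mkPiAlgebra_apply]
    exact Equiv.prod_comp e (fun k => f (x k)))

/-- The symmetric power as a functor on modules. -/
def symFunctor (R : Type) [CommRing R] (p : ℕ) : ModuleCat.{v} R ⥤ ModuleCat.{v} R where
  obj M := ModuleCat.of R (Sym R p M)
  map f := ModuleCat.ofHom (symMap p f.hom)
  map_id M := by
    apply ModuleCat.hom_ext
    apply sym_ext
    intro x
    simp [symMap_tprod]
  map_comp f g := by
    apply ModuleCat.hom_ext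
    apply sym_ext
    intro x
    simp [symMap_tprod]

/-- The divided power as a functor on modules. -/
def divFunctor (R : Type) [CommRing R] (p : ℕ) : ModuleCat.{v} R ⥤ ModuleCat.{v} R where
  obj M := ModuleCat.of R (Div R p M)
  map f := ModuleCat.ofHom (divMap p f.hom)
  map_id M := by
    apply ModuleCat.hom_ext
    ext t
    change PiTensorProduct.map (fun _ => LinearMap.id) t.1 = t.1
    rw [PiTensorProduct.map_id]
    rfl
  map_comp f g := by
    apply ModuleCat.hom_ext
    ext t
    change PiTensorProduct.map (fun _ => g.hom ∘ₗ f.hom) t.1 =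
      PiTensorProduct.map (fun _ => g.hom) (PiTensorProduct.map (fun _ => f.hom) t.1)
    rw [PiTensorProduct.map_comp]
    rfl

/-- The norm maps as a natural transformation. -/
def normTrans (R : Type) [CommRing R] (p : ℕ) : symFunctor.{v} R p ⟶ divFunctor.{v} R p where
  app M := ModuleCat.ofHom (normMap R p M)
  naturality M N f := by
    apply ModuleCat.hom_ext
    apply sym_ext
    intro x
    apply Subtype.ext
    change (∑ e : Equiv.Perm (Fin p), perm p e)
        (PiTensorProduct.map (fun _ => f.hom) (PiTensorProduct.tprod R x)) =
      PiTensorProduct.map (fun _ => f.hom)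
        ((∑ e : Equiv.Perm (Fin p), perm p e) (PiTensorProduct.tprod R x))
    simp only [LinearMap.sum_apply, map_sum, map_perm]

end Powers

/-! ## The cosimplicial module representing `R[-i]` -/

section DoldKan

variable (R : Type) [CommRing R] (i : ℕ)

/-- The set of order-preserving surjections `[n] → [i]`. -/
abbrev Surj (n : SimplexCategory) (i : ℕ) : Type :=
  {σ : n ⟶ SimplexCategory.mk i // Function.Surjective σ.toOrderHom}

open Classical in
/-- The map induced by `θ : [n] → [m]` on functions on surjections onto `[i]`: precomposition with
`θ`, extended by zero to the non-surjective maps. -/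
def dkMap {n m : SimplexCategory} (θ : n ⟶ m) : (Surj n i → R) →ₗ[R] (Surj m i → R) where
  toFun f σ := if h : Function.Surjective (θ ≫ σ.1).toOrderHom then f ⟨θ ≫ σ.1, h⟩ else 0
  map_add' f g := by
    ext σ
    simp only [Pi.add_apply]
    split_ifs <;> simp
  map_smul' r f := by
    ext σ
    simp only [Pi.smul_apply, RingHom.id_apply]
    split_ifs <;> simp

/-- The cosimplicial module attached to the complex `R[-i]` by the Dold-Kan correspondence: in
degree `[n]` it is the module of functions on the set of surjections `[n] → [i]`, that is, of
`R`-valued functions on the `n`-simplices of `Δ^i` vanishing on `∂Δ^i`. -/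
def dk : CosimplicialObject (ModuleCat.{0} R) :=
  { obj := fun n => ModuleCat.of R (Surj n i → R)
    map := fun θ => ModuleCat.ofHom (dkMap R i θ)
    map_id := by
      intro n
      apply ModuleCat.hom_ext
      refine LinearMap.ext fun (f : Surj n i → R) => funext fun σ => ?_
      have h : Function.Surjective (𝟙 n ≫ σ.1).toOrderHom := by
        rw [Category.id_comp]; exact σ.2
      change (if h : Function.Surjective (𝟙 n ≫ σ.1).toOrderHom then f ⟨𝟙 n ≫ σ.1, h⟩ else 0) =
        f σ
      rw [dif_pos h]
      congr 1
      exact Subtype.ext (Category.id_comp _)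
    map_comp := by
      intro n m k θ η
      apply ModuleCat.hom_ext
      refine LinearMap.ext fun (f : Surj n i → R) => funext fun σ => ?_
      change (if h : Function.Surjective ((θ ≫ η) ≫ σ.1).toOrderHom
          then f ⟨(θ ≫ η) ≫ σ.1, h⟩ else 0) =
        (if h : Function.Surjective (η ≫ σ.1).toOrderHom then
          (if h' : Function.Surjective (θ ≫ (η ≫ σ.1)).toOrderHom
            then f ⟨θ ≫ (η ≫ σ.1), h'⟩ else 0) else 0)
      by_cases h : Function.Surjective (θ ≫ (η ≫ σ.1)).toOrderHom
      · have h1 : Function.Surjective (η ≫ σ.1).toOrderHom := by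
          intro y
          obtain ⟨x, hx⟩ := h y
          exact ⟨θ.toOrderHom x, hx⟩
        have h2 : Function.Surjective ((θ ≫ η) ≫ σ.1).toOrderHom := by
          rw [Category.assoc]; exact h
        rw [dif_pos h2, dif_pos h1, dif_pos h]
        exact congrArg f (Subtype.ext (Category.assoc _ _ _))
      · have h2 : ¬ Function.Surjective ((θ ≫ η) ≫ σ.1).toOrderHom := by
          rw [Category.assoc]; exact h
        rw [dif_neg h2, dif_neg h, dite_eq_ite, ite_self] }

/-- The generator `1 ∈ R = (R[-i])^i`: the function with value `1` at the identity of `[i]`. -/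
def dkOne : (dk R i).obj (SimplexCategory.mk i) := fun _ => (1 : R)

end DoldKan

/-! ## Cosimplicial commutative rings and their cohomology -/

section Cohomology

/-- The additive group of a commutative ring, as a functor. -/
def addGrp : CommRingCat.{v} ⥤ AddCommGrpCat.{v} where
  obj S := AddCommGrpCat.of S
  map f := AddCommGrpCat.ofHom f.hom.toAddMonoidHom

/-- The cosimplicial commutative ring underlying a cosimplicial commutative algebra. -/
def ringOf {R : Type} [CommRing R] (A : CosimplicialObject (CommAlgCat.{v} R)) :
    CosimplicialObject CommRingCat.{v} :=
  ((CosimplicialObject.whiskering _ _).obj (forget₂ (CommAlgCat.{v} R) CommRingCat.{v})).obj A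

/-- The cosimplicial abelian group underlying a cosimplicial commutative ring. -/
def addOf (A : CosimplicialObject CommRingCat.{v}) : CosimplicialObject AddCommGrpCat.{v} :=
  ((CosimplicialObject.whiskering _ _).obj addGrp).obj A

/-- The cochain complex of a cosimplicial abelian group, with differential the alternating sum of
the coface maps. -/
abbrev cochains (X : CosimplicialObject AddCommGrpCat.{v}) : CochainComplex AddCommGrpCat.{v} ℕ :=
  (alternatingCofaceMapComplex AddCommGrpCat.{v}).obj X

/-- The cohomology group `H^i` of a cosimplicial abelian group. -/
abbrev H (i : ℕ) (X : CosimplicialObject AddCommGrpCat.{v}) : AddCommGrpCat.{v} :=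
  (cochains X).homology i

/-- The map induced on cohomology by a map of cosimplicial abelian groups. -/
def mapH (i : ℕ) {X Y : CosimplicialObject AddCommGrpCat.{v}} (f : X ⟶ Y) : H i X ⟶ H i Y :=
  HomologicalComplex.homologyMap ((alternatingCofaceMapComplex AddCommGrpCat.{v}).map f) i

/-- `x` is the (co)homology class of the (co)cycle `a`; in particular `a` is a (co)cycle. -/
def IsClass {κ : Type} {c : ComplexShape κ} (C : HomologicalComplex AddCommGrpCat.{v} c) {k : κ}
    (a : C.X k) (x : C.homology k) : Prop :=
  ∃ z : C.cycles k, C.iCycles k z = a ∧ C.homologyπ k z = x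

/-- Three composable maps `X → Y → Z` of abelian groups form a short exact sequence. -/
structure IsSES {X Y Z : AddCommGrpCat.{v}} (f : X ⟶ Y) (g : Y ⟶ Z) : Prop where
  inj : Function.Injective f
  exact : ∀ y : Y, g y = 0 ↔ ∃ x : X, f x = y
  surj : Function.Surjective g

theorem IsSES.comp_eq_zero {X Y Z : AddCommGrpCat.{v}} {f : X ⟶ Y} {g : Y ⟶ Z}
    (h : IsSES f g) : f ≫ g = 0 := by
  ext x
  exact (h.exact (f x)).2 ⟨x, rfl⟩

theorem IsSES.shortExact {X Y Z : AddCommGrpCat.{v}} {f : X ⟶ Y} {g : Y ⟶ Z}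
    (h : IsSES f g) : (ShortComplex.mk f g h.comp_eq_zero).ShortExact where
  exact := (ShortComplex.ab_exact_iff _).2 fun y hy => (h.exact y).1 hy
  mono_f := (AddCommGrpCat.mono_iff_injective f).2 h.inj
  epi_g := (AddCommGrpCat.epi_iff_surjective g).2 h.surj

theorem shortExact_of_isSES {κ : Type} {c : ComplexShape κ}
    (S : ShortComplex (HomologicalComplex AddCommGrpCat.{v} c))
    (h : ∀ k, IsSES (S.f.f k) (S.g.f k)) : S.ShortExact :=
  HomologicalComplex.shortExact_of_degreewise_shortExact S fun k => (h k).shortExact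

/-- The connecting homomorphism `H^i Z → H^{i+1} X` of a termwise short exact sequence
`X → Y → Z` of cosimplicial abelian groups. -/
def connecting {X Y Z : CosimplicialObject AddCommGrpCat.{v}} (f : X ⟶ Y) (g : Y ⟶ Z)
    (h : ∀ n, IsSES (f.app n) (g.app n)) (i : ℕ) : H i Z ⟶ H (i + 1) X :=
  (shortExact_of_isSES
    (ShortComplex.mk ((alternatingCofaceMapComplex AddCommGrpCat.{v}).map f)
      ((alternatingCofaceMapComplex AddCommGrpCat.{v}).map g) (by
        apply HomologicalComplex.hom_ext
        intro k
        exact (h (SimplexCategory.mk k)).comp_eq_zero))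
    (fun k => h (SimplexCategory.mk k))).δ i (i + 1) rfl

end Cohomology

/-! ## Frobenius, reduction modulo `p`, Witt vectors of length two -/

section Frobenius

variable (p : ℕ)

/-- The Frobenius endomorphism `x ↦ x^p` of a commutative ring in which `p = 0` (possibly the zero
ring). -/
def frob [hp : Fact p.Prime] (S : Type v) [CommRing S] (h : (p : S) = 0) : S →+* S where
  toFun x := x ^ p
  map_one' := one_pow p
  map_mul' x y := mul_pow x y p
  map_zero' := zero_pow hp.out.ne_zero
  map_add' x y := by
    obtain ⟨r, hr⟩ := exists_add_pow_prime_eq hp.out x y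
    rw [hr, h]
    ring

/-- The termwise Frobenius endomorphism of a diagram of commutative rings with `p = 0`. -/
def frobTrans [Fact p.Prime] {J : Type*} [Category* J] (A : J ⥤ CommRingCat.{v})
    (h : ∀ j, (p : A.obj j) = 0) : A ⟶ A where
  app j := CommRingCat.ofHom (frob p (A.obj j) (h j))
  naturality j k f := by
    ext x
    exact (map_pow (A.map f).hom x p).symm

/-- The quotient `S/p`, as a functor on commutative rings. -/
def modP : CommRingCat.{v} ⥤ CommRingCat.{v} where
  obj S := CommRingCat.of (S ⧸ Ideal.span {(p : S)})
  map {S T} f := CommRingCat.ofHom (Ideal.quotientMap (Ideal.span {(p : T)}) f.hom (by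
    rw [Ideal.span_singleton_le_iff_mem, Ideal.mem_comap, map_natCast]
    exact Ideal.mem_span_singleton_self _))
  map_id S := by
    apply CommRingCat.hom_ext
    apply Ideal.Quotient.ringHom_ext
    rfl
  map_comp f g := by
    apply CommRingCat.hom_ext
    apply Ideal.Quotient.ringHom_ext
    rfl

theorem modP_natCast (S : CommRingCat.{v}) : (p : (modP p).obj S) = 0 := by
  have : (p : S ⧸ Ideal.span {(p : S)}) = Ideal.Quotient.mk _ (p : S) := (map_natCast _ p).symm
  exact this.trans (Ideal.Quotient.eq_zero_iff_mem.2 (Ideal.mem_span_singleton_self _))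

/-- The reduction map `S → S/p`. -/
def toModP : 𝟭 CommRingCat.{v} ⟶ modP p where
  app S := CommRingCat.ofHom (Ideal.Quotient.mk _)

/-- Multiplication by `p` on additive groups of commutative rings. -/
def mulP : addGrp.{v} ⟶ addGrp.{v} where
  app S := AddCommGrpCat.ofHom (AddMonoidHom.mulLeft (p : S))
  naturality S T f := by
    apply AddCommGrpCat.hom_ext
    refine AddMonoidHom.ext fun (x : S) => ?_
    change (p : T) * f.hom x = f.hom ((p : S) * x)
    rw [map_mul, map_natCast]

theorem modP_isSES (S : CommRingCat.{v}) (h : ∀ x : S, (p : S) * x = 0 → x = 0) :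
    IsSES ((mulP p).app S) (addGrp.map ((toModP p).app S)) where
  inj := by
    have := (injective_iff_map_eq_zero (AddMonoidHom.mulLeft (p : (S : Type v)))).2 h
    exact this
  exact := fun (y : S) => by
    refine (Ideal.Quotient.eq_zero_iff_mem (I := Ideal.span {(p : S)}) (a := y)).trans ?_
    rw [Ideal.mem_span_singleton]
    exact ⟨fun ⟨x, hx⟩ => ⟨x, hx.symm⟩, fun ⟨x, hx⟩ => ⟨x, hx.symm⟩⟩
  surj := Ideal.Quotient.mk_surjective (I := Ideal.span {(p : S)})

end Frobenius

section Witt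

variable (p : ℕ) [hp : Fact p.Prime]

/-- The map `W₂(S) → W₂(T)` induced by a ring homomorphism, coordinatewise. -/
def wittFun {S T : Type v} [CommRing S] [CommRing T] (f : S →+* T)
    (x : TruncatedWittVector p 2 S) : TruncatedWittVector p 2 T :=
  TruncatedWittVector.mk p fun k => f (x.coeff k)

theorem wittFun_truncate {S T : Type v} [CommRing S] [CommRing T] (f : S →+* T)
    (x : WittVector p S) :
    wittFun p f (WittVector.truncate 2 x) = WittVector.truncate 2 (WittVector.map f x) := by
  ext k
  simp [wittFun, WittVector.map_coeff]

/-- The ring homomorphism `W₂(S) → W₂(T)` induced by a ring homomorphism. -/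
def wittMap {S T : Type v} [CommRing S] [CommRing T] (f : S →+* T) :
    TruncatedWittVector p 2 S →+* TruncatedWittVector p 2 T where
  toFun := wittFun p f
  map_one' := by
    rw [← map_one (WittVector.truncate (p := p) (R := S) 2), wittFun_truncate, map_one, map_one]
  map_zero' := by
    rw [← map_zero (WittVector.truncate (p := p) (R := S) 2), wittFun_truncate, map_zero,
      map_zero]
  map_add' x y := by
    obtain ⟨x, rfl⟩ := WittVector.truncate_surjective p 2 S x
    obtain ⟨y, rfl⟩ := WittVector.truncate_surjective p 2 S y
    rw [← map_add, wittFun_truncate, wittFun_truncate, wittFun_truncate, map_add, map_add]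
  map_mul' x y := by
    obtain ⟨x, rfl⟩ := WittVector.truncate_surjective p 2 S x
    obtain ⟨y, rfl⟩ := WittVector.truncate_surjective p 2 S y
    rw [← map_mul, wittFun_truncate, wittFun_truncate, wittFun_truncate, map_mul, map_mul]

/-- The ring `W₂` of `p`-typical Witt vectors of length two, as a functor. -/
def wittTwo : CommRingCat.{v} ⥤ CommRingCat.{v} where
  obj S := CommRingCat.of (TruncatedWittVector p 2 S)
  map f := CommRingCat.ofHom (wittMap p f.hom)
  map_id _ := rfl
  map_comp _ _ := rfl

/-- The Verschiebung `V : S → W₂(S)`, `a ↦ (0, a)`, as an additive map. -/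
def wittV (S : Type v) [CommRing S] : S →+ TruncatedWittVector p 2 S :=
  have key (x : WittVector p S) :
      TruncatedWittVector.mk p ![0, x.coeff 0] =
        WittVector.truncate 2 (WittVector.verschiebung x) := by
    ext k
    fin_cases k
    · simp
    · simp
  { toFun := fun a => TruncatedWittVector.mk p ![0, a]
    map_zero' := by
      ext k
      fin_cases k <;> simp
    map_add' := fun a b => by
      have h := key (WittVector.teichmuller p a + WittVector.teichmuller p b)
      rw [map_add, map_add, ← key, ← key, WittVector.add_coeff_zero,
        WittVector.teichmuller_coeff_zero, WittVector.teichmuller_coeff_zero] at h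
      exact h }

/-- The projection `W₂(S) → S` to the first coordinate. -/
def wittProj (S : Type v) [CommRing S] : TruncatedWittVector p 2 S →+* S :=
  have key (x : WittVector p S) : (WittVector.truncate 2 x).coeff 0 = WittVector.constantCoeff x :=
    WittVector.coeff_truncate x 0
  { toFun := fun x => x.coeff 0
    map_one' := by
      rw [← map_one (WittVector.truncate (p := p) (R := S) 2), key, map_one]
    map_zero' := by
      rw [← map_zero (WittVector.truncate (p := p) (R := S) 2), key, map_zero]
    map_add' := fun x y => by
      obtain ⟨x, rfl⟩ := WittVector.truncate_surjective p 2 S x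
      obtain ⟨y, rfl⟩ := WittVector.truncate_surjective p 2 S y
      rw [← map_add, key, key, key, map_add]
    map_mul' := fun x y => by
      obtain ⟨x, rfl⟩ := WittVector.truncate_surjective p 2 S x
      obtain ⟨y, rfl⟩ := WittVector.truncate_surjective p 2 S y
      rw [← map_mul, key, key, key, map_mul] }

/-- Verschiebung as a natural transformation of additive groups. -/
def wittVTrans : addGrp.{v} ⟶ wittTwo p ⋙ addGrp.{v} where
  app S := AddCommGrpCat.ofHom (wittV p S)
  naturality S T f := by
    apply AddCommGrpCat.hom_ext
    refine AddMonoidHom.ext fun (x : S) => ?_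
    change TruncatedWittVector.mk p ![0, f.hom x] =
      wittFun p f.hom (TruncatedWittVector.mk p ![0, x])
    ext k
    fin_cases k <;> simp [wittFun]

/-- The projection `W₂(S) → S` as a natural transformation. -/
def wittProjTrans : wittTwo p ⟶ 𝟭 CommRingCat.{v} where
  app S := CommRingCat.ofHom (wittProj p S)

theorem witt_isSES (S : CommRingCat.{v}) :
    IsSES ((wittVTrans p).app S) (addGrp.map ((wittProjTrans p).app S)) where
  inj := fun (a b : S) hab => by
    have h : TruncatedWittVector.mk p ![0, a] = TruncatedWittVector.mk p ![0, b] := hab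
    have h1 := congrArg (TruncatedWittVector.coeff 1) h
    exact h1
  exact := fun (y : TruncatedWittVector p 2 S) => by
    constructor
    · intro (hy : y.coeff 0 = 0)
      refine ⟨y.coeff 1, ?_⟩
      change TruncatedWittVector.mk p ![0, y.coeff 1] = y
      ext k
      fin_cases k
      · simpa using hy.symm
      · simp
    · rintro ⟨a, rfl⟩
      change (TruncatedWittVector.mk p ![0, (a : S)]).coeff 0 = 0
      simp
  surj := fun (a : S) => ⟨TruncatedWittVector.mk p ![a, 0], by
    change (TruncatedWittVector.mk p ![a, 0]).coeff 0 = a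
    simp⟩

end Witt

/-! ## Totalization of simplicial objects in cosimplicial abelian groups -/

section Totalization

/-- Families of elements of a first-quadrant array of abelian groups `K_m^n`, with a homological
index `m` and a cohomological index `n`. -/
abbrev Fam (K : ChainComplex (CochainComplex AddCommGrpCat.{v} ℕ) ℕ) : Type v :=
  ∀ m n : ℕ, (K.X m).X n

variable (K : ChainComplex (CochainComplex AddCommGrpCat.{v} ℕ) ℕ)

/-- The total differential, `(D a)_m^n = d (a_m^{n-1}) + (-1)^n ∂ (a_{m+1}^n)`; the first term is
absent for `n = 0`. -/
def totD : Fam K →+ Fam K where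
  toFun a m n := (K.X m).d (n - 1) n (a m (n - 1)) +
    (-1 : ℤ) ^ n • (K.d (m + 1) m).f n (a (m + 1) n)
  map_zero' := by
    funext m n
    simp
  map_add' a b := by
    funext m n
    simp only [Pi.add_apply, map_add, smul_add]
    abel

theorem totD_totD (a : Fam K) : totD K (totD K a) = 0 := by
  funext m n
  have h1 : ∀ x, (K.X m).d (n - 1) n ((K.X m).d (n - 1 - 1) (n - 1) x) = 0 := fun x => by
    rw [← ConcreteCategory.comp_apply, HomologicalComplex.d_comp_d]; rfl
  have h2 : ∀ x, (K.d (m + 1) m).f n ((K.d (m + 1 + 1) (m + 1)).f n x) = 0 := fun x => by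
    rw [← ConcreteCategory.comp_apply, ← HomologicalComplex.comp_f,
      HomologicalComplex.d_comp_d]; rfl
  have h3 : ∀ x, (K.X m).d (n - 1) n ((K.d (m + 1) m).f (n - 1) x) =
      (K.d (m + 1) m).f n ((K.X (m + 1)).d (n - 1) n x) := fun x => by
    rw [← ConcreteCategory.comp_apply, ← ConcreteCategory.comp_apply,
      HomologicalComplex.Hom.comm]
  change (K.X m).d (n - 1) n ((K.X m).d (n - 1 - 1) (n - 1) (a m (n - 1 - 1)) +
      (-1 : ℤ) ^ (n - 1) • (K.d (m + 1) m).f (n - 1) (a (m + 1) (n - 1))) +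
    (-1 : ℤ) ^ n • (K.d (m + 1) m).f n ((K.X (m + 1)).d (n - 1) n (a (m + 1) (n - 1)) +
      (-1 : ℤ) ^ n • (K.d (m + 1 + 1) (m + 1)).f n (a (m + 1 + 1) n)) = 0
  rw [map_add, map_add, map_zsmul, map_zsmul, h1, h2, h3]
  cases n with
  | zero =>
    have h4 : (K.X (m + 1)).d (0 - 1) 0 = 0 := HomologicalComplex.shape _ _ _ (by simp)
    rw [h4]
    simp
  | succ n => simp [pow_succ]

/-- Families concentrated in total degree `k`, that is with `a_m^n = 0` unless `n - m = k`; this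
is the product of the groups `K_m^n` with `n - m = k`. -/
def totX (k : ℤ) : AddSubgroup (Fam K) where
  carrier := {a | ∀ m n : ℕ, (n : ℤ) - m ≠ k → a m n = 0}
  add_mem' ha hb m n h := by rw [Pi.add_apply, Pi.add_apply, ha m n h, hb m n h, add_zero]
  zero_mem' _ _ _ := rfl
  neg_mem' ha m n h := by rw [Pi.neg_apply, Pi.neg_apply, ha m n h, neg_zero]

theorem totD_mem (k : ℤ) (a : Fam K) (ha : a ∈ totX K k) : totD K a ∈ totX K (k + 1) := by
  intro m n h
  change (K.X m).d (n - 1) n (a m (n - 1)) +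
    (-1 : ℤ) ^ n • (K.d (m + 1) m).f n (a (m + 1) n) = 0
  rw [ha (m + 1) n (by push_cast; omega), map_zero, smul_zero, add_zero]
  cases n with
  | zero =>
    have h4 : (K.X m).d (0 - 1) 0 = 0 := HomologicalComplex.shape _ _ _ (by simp)
    rw [h4]; rfl
  | succ n =>
    rw [ha m (n + 1 - 1) (by push_cast at h ⊢; simp; omega), map_zero]

/-- The product totalization: in degree `k` it is `∏_{n - m = k} K_m^n`. -/
def totObj : CochainComplex AddCommGrpCat.{v} ℤ :=
  CochainComplex.of (fun k => AddCommGrpCat.of (totX K k))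
    (fun k => AddCommGrpCat.ofHom (((totD K).comp (totX K k).subtype).codRestrict (totX K (k + 1))
      (fun a => totD_mem K k a.1 a.2)))
    (fun k => by
      apply AddCommGrpCat.hom_ext
      refine AddMonoidHom.ext fun a => ?_
      exact Subtype.ext (totD_totD K a.1))

theorem totObj_d_apply {k l : ℤ} (h : k + 1 = l) (a : totX K k) :
    ((show totX K l from (totObj K).d k l a) : Fam K) = totD K a.1 := by
  subst h
  have h1 : (totObj K).d k (k + 1) = AddCommGrpCat.ofHom
      (((totD K).comp (totX K k).subtype).codRestrict (totX K (k + 1))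
        (fun a => totD_mem K k a.1 a.2)) :=
    CochainComplex.of_d (fun k => AddCommGrpCat.of (totX K k))
      (fun k => AddCommGrpCat.ofHom (((totD K).comp (totX K k).subtype).codRestrict
        (totX K (k + 1)) (fun a => totD_mem K k a.1 a.2))) k
  have h2 := congrArg (fun f => f a) h1
  exact congrArg Subtype.val h2

variable {K} {L : ChainComplex (CochainComplex AddCommGrpCat.{v} ℕ) ℕ}

/-- Functoriality of the totalization, in each degree. -/
def totMapX (f : K ⟶ L) (k : ℤ) : totX K k →+ totX L k where
  toFun a := ⟨fun m n => (f.f m).f n (a.1 m n), fun m n h => by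
    change (f.f m).f n (a.1 m n) = 0
    rw [a.2 m n h, map_zero]⟩
  map_zero' := by
    apply Subtype.ext
    funext m n
    exact map_zero _
  map_add' a b := by
    apply Subtype.ext
    funext m n
    exact map_add _ _ _

/-- Functoriality of the totalization. -/
def totMap (f : K ⟶ L) : totObj K ⟶ totObj L :=
  CochainComplex.ofHom (fun k => AddCommGrpCat.ofHom (totMapX f k)) (fun k => by
    apply AddCommGrpCat.hom_ext
    refine AddMonoidHom.ext fun (a : totX K k) => Subtype.ext ?_
    refine (totObj_d_apply L rfl (totMapX f k a)).trans ?_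
    change _ = (totMapX f (k + 1) ((totObj K).d k (k + 1) a)).1
    funext m n
    have h1 : ∀ x, (L.X m).d (n - 1) n ((f.f m).f (n - 1) x) =
        (f.f m).f n ((K.X m).d (n - 1) n x) := fun x => by
      rw [← ConcreteCategory.comp_apply, ← ConcreteCategory.comp_apply,
        HomologicalComplex.Hom.comm]
    have h2 : ∀ x, (L.d (m + 1) m).f n ((f.f (m + 1)).f n x) =
        (f.f m).f n ((K.d (m + 1) m).f n x) := fun x => by
      rw [← ConcreteCategory.comp_apply, ← ConcreteCategory.comp_apply,
        ← HomologicalComplex.comp_f, ← HomologicalComplex.comp_f, HomologicalComplex.Hom.comm]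
    change (L.X m).d (n - 1) n ((f.f m).f (n - 1) (a.1 m (n - 1))) +
        (-1 : ℤ) ^ n • (L.d (m + 1) m).f n ((f.f (m + 1)).f n (a.1 (m + 1) n)) =
      (f.f m).f n ((show totX K (k + 1) from (totObj K).d k (k + 1) a).1 m n)
    rw [totObj_d_apply K rfl]
    change _ = (f.f m).f n ((K.X m).d (n - 1) n (a.1 m (n - 1)) +
        (-1 : ℤ) ^ n • (K.d (m + 1) m).f n (a.1 (m + 1) n))
    rw [h1, h2, map_add, map_zsmul])

theorem totMap_isSES {M : ChainComplex (CochainComplex AddCommGrpCat.{v} ℕ) ℕ} (f : K ⟶ L)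
    (g : L ⟶ M) (h : ∀ m n, IsSES ((f.f m).f n) ((g.f m).f n)) (k : ℤ) :
    IsSES ((totMap f).f k) ((totMap g).f k) where
  inj := fun (a b : totX K k) hab => by
    have hab' : (totMapX f k a).1 = (totMapX f k b).1 := congrArg Subtype.val hab
    apply Subtype.ext
    funext m n
    exact (h m n).inj (congrFun (congrFun hab' m) n)
  exact := fun (y : totX L k) => by
    classical
    constructor
    · intro hy
      have hy' : (totMapX g k y).1 = 0 := congrArg Subtype.val hy
      have hx : ∀ m n, ∃ x, (f.f m).f n x = y.1 m n := fun m n =>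
        ((h m n).exact _).1 (congrFun (congrFun hy' m) n)
      choose x hx using hx
      refine ⟨(⟨x, fun m n hmn => (h m n).inj ?_⟩ : totX K k), ?_⟩
      · rw [hx, map_zero, y.2 m n hmn]
      · apply Subtype.ext
        funext m n
        exact hx m n
    · rintro ⟨x, rfl⟩
      apply Subtype.ext
      funext m n
      exact ((h m n).exact _).2 ⟨_, rfl⟩
  surj := fun (y : totX M k) => by
    classical
    have hx : ∀ m n, ∃ x, (g.f m).f n x = y.1 m n := fun m n => (h m n).surj _
    choose x hx using hx
    refine ⟨(⟨fun m n => if (n : ℤ) - m = k then x m n else 0, fun m n hmn => if_neg hmn⟩ :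
      totX L k), ?_⟩
    apply Subtype.ext
    funext m n
    change (g.f m).f n (if (n : ℤ) - m = k then x m n else 0) = y.1 m n
    split_ifs with hmn
    · exact hx m n
    · rw [map_zero, y.2 m n hmn]

/-- The total cochain complex of a simplicial object in cosimplicial abelian groups: alternating
sums of faces and cofaces, followed by the product totalization. -/
abbrev tot (X : SimplicialObject (CosimplicialObject AddCommGrpCat.{v})) :
    CochainComplex AddCommGrpCat.{v} ℤ :=
  totObj ((alternatingFaceMapComplex (CochainComplex AddCommGrpCat.{v} ℕ)).obj
    (((SimplicialObject.whiskering _ _).obj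
      (alternatingCofaceMapComplex AddCommGrpCat.{v})).obj X))

/-- Functoriality of the total complex. -/
def totHom {X Y : SimplicialObject (CosimplicialObject AddCommGrpCat.{v})} (f : X ⟶ Y) :
    tot X ⟶ tot Y :=
  totMap ((alternatingFaceMapComplex (CochainComplex AddCommGrpCat.{v} ℕ)).map
    (((SimplicialObject.whiskering _ _).obj
      (alternatingCofaceMapComplex AddCommGrpCat.{v})).map f))

theorem totHom_isSES {X Y Z : SimplicialObject (CosimplicialObject AddCommGrpCat.{v})}
    (f : X ⟶ Y) (g : Y ⟶ Z) (h : ∀ m n, IsSES ((f.app m).app n) ((g.app m).app n)) (k : ℤ) :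
    IsSES ((totHom f).f k) ((totHom g).f k) :=
  totMap_isSES _ _ (fun m n => h (op (SimplexCategory.mk m)) (SimplexCategory.mk n)) k

/-- The connecting homomorphism on the cohomology of total complexes attached to a termwise short
exact sequence. -/
def totConnecting {X Y Z : SimplicialObject (CosimplicialObject AddCommGrpCat.{v})}
    (f : X ⟶ Y) (g : Y ⟶ Z) (h : ∀ m n, IsSES ((f.app m).app n) ((g.app m).app n)) (k : ℤ) :
    (tot Z).homology k ⟶ (tot X).homology (k + 1) :=
  (shortExact_of_isSES
    (ShortComplex.mk (totHom f) (totHom g) (by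
        apply HomologicalComplex.hom_ext
        intro k
        exact (totHom_isSES f g h k).comp_eq_zero))
    (totHom_isSES f g h)).δ k (k + 1) rfl

variable (K) in
theorem aug_totD {Y : CochainComplex AddCommGrpCat.{v} ℕ} (e : K.X 0 ⟶ Y) (he : K.d 1 0 ≫ e = 0)
    (a : Fam K) (n : ℕ) : e.f n (totD K a 0 n) = Y.d (n - 1) n (e.f (n - 1) (a 0 (n - 1))) := by
  have h1 : e.f n ((K.d 1 0).f n (a 1 n)) = 0 := by
    rw [← ConcreteCategory.comp_apply, ← HomologicalComplex.comp_f, he]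
    rfl
  have h2 : e.f n ((K.X 0).d (n - 1) n (a 0 (n - 1))) =
      Y.d (n - 1) n (e.f (n - 1) (a 0 (n - 1))) := by
    rw [← ConcreteCategory.comp_apply, ← ConcreteCategory.comp_apply,
      HomologicalComplex.Hom.comm]
  change e.f n ((K.X 0).d (n - 1) n (a 0 (n - 1)) +
    (-1 : ℤ) ^ n • (K.d (0 + 1) 0).f n (a (0 + 1) n)) = _
  rw [map_add, map_zsmul, h1, h2, smul_zero, add_zero]

theorem d_comp_aug {C : Type*} [Category* C] [Preadditive C] (S : SimplicialObject C) {Z : C}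
    (f : S.obj (op (SimplexCategory.mk 0)) ⟶ Z) (h : S.δ (0 : Fin 2) ≫ f = S.δ (1 : Fin 2) ≫ f) :
    AlternatingFaceMapComplex.objD S 0 ≫ f = 0 := by
  rw [AlternatingFaceMapComplex.objD, Fin.sum_univ_two, Preadditive.add_comp,
    Preadditive.zsmul_comp, Preadditive.zsmul_comp, h]
  simp

variable (K) in
/-- For a map `e : K₀ → Y` of cochain complexes with `e ∘ d = 0`, the cochain map from the
total complex of `K` to `Y` in degrees `≥ 0`, sending a family `a` of total degree `n` to
`e (a_0^n)`. -/
def augRestr {Y : CochainComplex AddCommGrpCat.{v} ℕ} (e : K.X 0 ⟶ Y) (he : K.d 1 0 ≫ e = 0) :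
    (totObj K).restriction ComplexShape.embeddingUpNat ⟶ Y where
  f n := AddCommGrpCat.ofHom
    { toFun := fun a : totX K (n : ℤ) => e.f n (a.1 0 n)
      map_zero' := map_zero _
      map_add' := fun a b => map_add _ _ _ }
  comm' n n' h := by
    obtain rfl : n + 1 = n' := h
    apply AddCommGrpCat.hom_ext
    refine AddMonoidHom.ext fun (a : totX K (n : ℤ)) => ?_
    have h1 := totObj_d_apply K (show (n : ℤ) + 1 = ((n + 1 : ℕ) : ℤ) by push_cast; rfl) a
    have h2 := aug_totD K e he a.1 (n + 1)
    rw [← h1] at h2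
    exact h2.symm

variable (K) in
theorem augRestr_hasLift {Y : CochainComplex AddCommGrpCat.{v} ℕ} (e : K.X 0 ⟶ Y)
    (he : K.d 1 0 ≫ e = 0) : ComplexShape.embeddingUpNat.HasLift (augRestr K e he) := by
  intro j hj k hk
  have hj0 : j = 0 := by
    by_contra hne
    obtain ⟨j, rfl⟩ := Nat.exists_eq_succ_of_ne_zero hne
    exact hj.2 j (by simp)
  subst hj0
  apply AddCommGrpCat.hom_ext
  refine AddMonoidHom.ext fun (a : totX K k) => ?_
  have h1 := totObj_d_apply K (show k + 1 = ((0 : ℕ) : ℤ) from hk) a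
  have h2 := aug_totD K e he a.1 0
  rw [← h1] at h2
  refine h2.trans ?_
  have h3 : Y.d (0 - 1) 0 = 0 := HomologicalComplex.shape _ _ _ (by simp)
  rw [h3]
  rfl

theorem aug_comp_d {X : SimplicialObject (CosimplicialObject AddCommGrpCat.{v})}
    {Y : CosimplicialObject AddCommGrpCat.{v}} (ε : X ⟶ (SimplicialObject.const _).obj Y) :
    ((alternatingFaceMapComplex (CochainComplex AddCommGrpCat.{v} ℕ)).obj
      (((SimplicialObject.whiskering _ _).obj
        (alternatingCofaceMapComplex AddCommGrpCat.{v})).obj X)).d 1 0 ≫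
      (alternatingCofaceMapComplex AddCommGrpCat.{v}).map
        (ε.app (op (SimplexCategory.mk 0))) = 0 := by
  have key : ∀ k : Fin 2,
      (((SimplicialObject.whiskering _ _).obj (alternatingCofaceMapComplex AddCommGrpCat.{v})).obj
        X).δ k ≫ (alternatingCofaceMapComplex AddCommGrpCat.{v}).map
          (ε.app (op (SimplexCategory.mk 0))) =
      (alternatingCofaceMapComplex AddCommGrpCat.{v}).map
          (ε.app (op (SimplexCategory.mk 1))) := by
    intro k
    change (alternatingCofaceMapComplex AddCommGrpCat.{v}).map (X.δ k) ≫ _ = _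
    rw [← Functor.map_comp]
    congr 1
    exact (ε.naturality (SimplexCategory.δ k).op).trans (Category.comp_id _)
  have h := d_comp_aug _ _ ((key 0).trans (key 1).symm)
  rw [alternatingFaceMapComplex_obj_d]
  exact h

/-- The map `H^i(Tot X) → H^i(Y)` induced by an augmentation `ε : X → Y`. -/
def augH {X : SimplicialObject (CosimplicialObject AddCommGrpCat.{v})}
    {Y : CosimplicialObject AddCommGrpCat.{v}} (ε : X ⟶ (SimplicialObject.const _).obj Y) (i : ℕ) :
    (tot X).homology (i : ℤ) ⟶ H i Y :=
  HomologicalComplex.homologyMap (ComplexShape.embeddingUpNat.liftExtend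
      (augRestr _ (Y := cochains Y) ((alternatingCofaceMapComplex AddCommGrpCat.{v}).map
        (ε.app (op (SimplexCategory.mk 0)))) (aug_comp_d ε))
      (augRestr_hasLift _ _ _)) (i : ℤ) ≫
    ((cochains Y).extendHomologyIso ComplexShape.embeddingUpNat rfl).hom

end Totalization

/-! ## Reduction, Frobenius and Bockstein maps -/

section Maps

variable (p : ℕ) [Fact p.Prime]

/-- The cohomology `H^i(A)` of a cosimplicial commutative ring. -/
abbrev Coh (i : ℕ) (A : CosimplicialObject CommRingCat.{v}) : AddCommGrpCat.{v} := H i (addOf A)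

/-- The map on cohomology induced by a map of cosimplicial commutative rings. -/
def cohMap (i : ℕ) {A B : CosimplicialObject CommRingCat.{v}} (f : A ⟶ B) : Coh i A ⟶ Coh i B :=
  mapH i (((CosimplicialObject.whiskering _ _).obj addGrp).map f)

/-- A diagram of commutative rings is `p`-torsion free. -/
def TorsionFree {J : Type*} [Category* J] (A : J ⥤ CommRingCat.{v}) : Prop :=
  ∀ j, ∀ x : A.obj j, (p : A.obj j) * x = 0 → x = 0

/-- The termwise reduction `A/p` of a cosimplicial commutative ring. -/
def modPOf (A : CosimplicialObject CommRingCat.{v}) : CosimplicialObject CommRingCat.{v} :=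
  ((CosimplicialObject.whiskering _ _).obj (modP p)).obj A

/-- The reduction map `A → A/p`. -/
def redOf (A : CosimplicialObject CommRingCat.{v}) : A ⟶ modPOf p A :=
  ((CosimplicialObject.whiskering _ _).map (toModP p)).app A

/-- The Bockstein homomorphism `H^i(A/p) → H^{i+1}(A)` of a termwise `p`-torsion free cosimplicial
commutative ring, the connecting homomorphism of `A → A → A/p`. -/
def bockH (A : CosimplicialObject CommRingCat.{v}) (hA : TorsionFree p A) (i : ℕ) :
    Coh i (modPOf p A) ⟶ Coh (i + 1) A :=
  connecting (X := addOf A) (Y := addOf A) (Z := addOf (modPOf p A))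
    (((CosimplicialObject.whiskering _ _).map (mulP p)).app A)
    (((CosimplicialObject.whiskering _ _).obj addGrp).map (redOf p A))
    (fun n => modP_isSES p (A.obj n) (hA n)) i

/-- The cosimplicial commutative ring `W₂(A)`, obtained by applying `W₂` termwise. -/
def wittOf (A : CosimplicialObject CommRingCat.{v}) : CosimplicialObject CommRingCat.{v} :=
  ((CosimplicialObject.whiskering _ _).obj (wittTwo p)).obj A

/-- The connecting homomorphism `H^i(A) → H^{i+1}(A)` of the termwise exact sequence
`A → W₂(A) → A` given by Verschiebung and projection. -/
def wittBockH (A : CosimplicialObject CommRingCat.{v}) (i : ℕ) : Coh i A ⟶ Coh (i + 1) A :=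
  connecting (X := addOf A) (Y := addOf (wittOf p A)) (Z := addOf A)
    (((CosimplicialObject.whiskering _ _).map (wittVTrans p)).app A)
    (((CosimplicialObject.whiskering _ _).obj addGrp).map
      (((CosimplicialObject.whiskering _ _).map (wittProjTrans p)).app A))
    (fun n => witt_isSES p (A.obj n)) i

/-- The termwise Frobenius endomorphism of `A/p`. -/
def frobModP (A : CosimplicialObject CommRingCat.{v}) : modPOf p A ⟶ modPOf p A :=
  frobTrans p (modPOf p A) (fun n => modP_natCast p (A.obj n))

/-- The composite of reduction, Frobenius and Bockstein `H^i(A) → H^i(A/p) → H^i(A/p) → H^{i+1}(A)`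
for a termwise `p`-torsion free cosimplicial commutative ring. -/
def bockFrob (A : CosimplicialObject CommRingCat.{v}) (hA : TorsionFree p A) (i : ℕ) :
    Coh i A ⟶ Coh (i + 1) A :=
  cohMap i (redOf p A) ≫ cohMap i (frobModP p A) ≫ bockH p A hA i

/-! The same for simplicial objects in cosimplicial commutative rings, with cohomology taken after
totalization. -/

/-- The simplicial cosimplicial abelian group underlying a simplicial cosimplicial commutative
ring. -/
def addOf2 (P : SimplicialObject (CosimplicialObject CommRingCat.{v})) :
    SimplicialObject (CosimplicialObject AddCommGrpCat.{v}) :=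
  ((SimplicialObject.whiskering _ _).obj ((CosimplicialObject.whiskering _ _).obj addGrp)).obj P

/-- Functoriality of `addOf2`. -/
def addMap2 {P Q : SimplicialObject (CosimplicialObject CommRingCat.{v})} (f : P ⟶ Q) :
    addOf2 P ⟶ addOf2 Q :=
  ((SimplicialObject.whiskering _ _).obj ((CosimplicialObject.whiskering _ _).obj addGrp)).map f

/-- The cohomology `H^k(Tot P)`. -/
abbrev Coh2 (k : ℤ) (P : SimplicialObject (CosimplicialObject CommRingCat.{v})) :
    AddCommGrpCat.{v} :=
  (tot (addOf2 P)).homology k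

/-- The map on cohomology of totalizations induced by a map of simplicial cosimplicial commutative
rings. -/
def cohMap2 (k : ℤ) {P Q : SimplicialObject (CosimplicialObject CommRingCat.{v})} (f : P ⟶ Q) :
    Coh2 k P ⟶ Coh2 k Q :=
  HomologicalComplex.homologyMap (totHom (addMap2 f)) k

/-- The termwise reduction `P/p`. -/
def modPOf2 (P : SimplicialObject (CosimplicialObject CommRingCat.{v})) :
    SimplicialObject (CosimplicialObject CommRingCat.{v}) :=
  ((SimplicialObject.whiskering _ _).obj
    ((CosimplicialObject.whiskering _ _).obj (modP p))).obj P

/-- The reduction map `P → P/p`. -/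
def redOf2 (P : SimplicialObject (CosimplicialObject CommRingCat.{v})) : P ⟶ modPOf2 p P :=
  ((SimplicialObject.whiskering _ _).map ((CosimplicialObject.whiskering _ _).map (toModP p))).app P

/-- The termwise Frobenius endomorphism of `P/p`. -/
def frobModP2 (P : SimplicialObject (CosimplicialObject CommRingCat.{v})) :
    modPOf2 p P ⟶ modPOf2 p P where
  app m := frobModP p (P.obj m)
  naturality m m' f := by
    apply NatTrans.ext
    funext n
    apply CommRingCat.hom_ext
    refine RingHom.ext fun x => ?_
    exact (map_pow (((modPOf2 p P).map f).app n).hom x p).symm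

/-- The Bockstein homomorphism `H^k(Tot P/p) → H^{k+1}(Tot P)` of a termwise `p`-torsion free
simplicial cosimplicial commutative ring, the connecting homomorphism of `P → P → P/p`. -/
def bockH2 (P : SimplicialObject (CosimplicialObject CommRingCat.{v}))
    (hP : ∀ m, TorsionFree p (P.obj m)) (k : ℤ) : Coh2 k (modPOf2 p P) ⟶ Coh2 (k + 1) P :=
  totConnecting (X := addOf2 P) (Y := addOf2 P) (Z := addOf2 (modPOf2 p P))
    (((SimplicialObject.whiskering _ _).map ((CosimplicialObject.whiskering _ _).map (mulP p))).app
      P)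
    (addMap2 (redOf2 p P))
    (fun m n => modP_isSES p ((P.obj m).obj n) (hP m n)) k

/-- The composite of reduction, Frobenius and Bockstein
`H^k(Tot P) → H^k(Tot P/p) → H^k(Tot P/p) → H^{k+1}(Tot P)`. -/
def bockFrob2 (P : SimplicialObject (CosimplicialObject CommRingCat.{v}))
    (hP : ∀ m, TorsionFree p (P.obj m)) (k : ℤ) : Coh2 k P ⟶ Coh2 (k + 1) P :=
  cohMap2 k (redOf2 p P) ≫ cohMap2 k (frobModP2 p P) ≫ bockH2 p P hP k

/-- For an augmented simplicial cosimplicial commutative ring `ε : P → A`, the map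
`H^i(Tot P) → H^i(A)`. -/
def cohAug {P : SimplicialObject (CosimplicialObject CommRingCat.{v})}
    {A : CosimplicialObject CommRingCat.{v}} (ε : P ⟶ (SimplicialObject.const _).obj A) (i : ℕ) :
    Coh2 (i : ℤ) P ⟶ Coh i A :=
  augH (X := addOf2 P) (Y := addOf A)
    (((SimplicialObject.whiskering _ _).obj ((CosimplicialObject.whiskering _ _).obj addGrp)).map
      ε) i

end Maps

/-! ## Algebras over `ℤ_p` and `𝔽_p` -/

section Algebras

variable (p : ℕ) [Fact p.Prime]

theorem torsionFree_of_flat (A : CosimplicialObject (CommAlgCat.{v} ℤ_[p]))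
    (hA : ∀ n, Module.Flat ℤ_[p] (A.obj n)) : TorsionFree p (ringOf A) := by
  intro n (x : A.obj n) hx
  have h1 : (p : ℤ_[p]) • x = 0 := by
    rw [Algebra.smul_def, map_natCast]
    exact hx
  have h2 : IsSMulRegular (A.obj n) (p : ℤ_[p]) := by
    have := hA n
    have hp : (p : ℤ_[p]) ≠ 0 := Nat.cast_ne_zero.2 (Fact.out : p.Prime).ne_zero
    exact Module.Flat.isSMulRegular_of_nonZeroDivisors (mem_nonZeroDivisors_of_ne_zero hp)
  exact h2 (h1.trans (smul_zero _).symm)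

theorem natCast_eq_zero (A : CosimplicialObject (CommAlgCat.{v} (ZMod p))) (n : SimplexCategory) :
    (p : (ringOf A).obj n) = 0 := by
  have h : algebraMap (ZMod p) (A.obj n) (p : ZMod p) = 0 := by
    rw [ZMod.natCast_self, map_zero]
  rw [map_natCast] at h
  exact h

/-- The Frobenius endomorphism of `H^i(A)` for a cosimplicial commutative `𝔽_p`-algebra. -/
def frobH (A : CosimplicialObject (CommAlgCat.{v} (ZMod p))) (i : ℕ) :
    Coh i (ringOf A) ⟶ Coh i (ringOf A) :=
  cohMap i (frobTrans p (ringOf A) (natCast_eq_zero p A))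

/-- The simplicial cosimplicial commutative ring underlying a simplicial cosimplicial commutative
algebra. -/
def ringOf2 {R : Type} [CommRing R] (P : SimplicialObject (CosimplicialObject (CommAlgCat.{v} R))) :
    SimplicialObject (CosimplicialObject CommRingCat.{v}) :=
  ((SimplicialObject.whiskering _ _).obj ((CosimplicialObject.whiskering _ _).obj
    (forget₂ (CommAlgCat.{v} R) CommRingCat.{v}))).obj P

/-- The map of underlying rings of an augmentation. -/
def ringAug {R : Type} [CommRing R] {P : SimplicialObject (CosimplicialObject (CommAlgCat.{v} R))}
    {A : CosimplicialObject (CommAlgCat.{v} R)} (ε : P ⟶ (SimplicialObject.const _).obj A) :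
    ringOf2 P ⟶ (SimplicialObject.const _).obj (ringOf A) :=
  ((SimplicialObject.whiskering _ _).obj ((CosimplicialObject.whiskering _ _).obj
    (forget₂ (CommAlgCat.{v} R) CommRingCat.{v}))).map ε

/-- The alternating sum of the faces `P_{m+1}^n → P_m^n`. -/
def faceSum {R : Type} [CommRing R] (P : SimplicialObject (CosimplicialObject (CommAlgCat.{v} R)))
    (m : ℕ) (n : SimplexCategory) (x : (P.obj (op (SimplexCategory.mk (m + 1)))).obj n) :
    (P.obj (op (SimplexCategory.mk m))).obj n :=
  ∑ k : Fin (m + 2), (-1 : ℤ) ^ (k : ℕ) • ((P.δ k).app n).hom x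

/-- An augmented simplicial object `ε : P → A` in cosimplicial commutative algebras is a termwise
flat resolution of `A`: every `P_m^n` is flat and every `⋯ → P_1^n → P_0^n → A^n → 0` is exact. -/
structure IsFlatResolution {R : Type} [CommRing R]
    {P : SimplicialObject (CosimplicialObject (CommAlgCat.{v} R))}
    {A : CosimplicialObject (CommAlgCat.{v} R)} (ε : P ⟶ (SimplicialObject.const _).obj A) :
    Prop where
  flat : ∀ m n, Module.Flat R ((P.obj m).obj n)
  surj : ∀ n, Function.Surjective ((ε.app (op (SimplexCategory.mk 0))).app n).hom
  exact_zero : ∀ n, ∀ x : (P.obj (op (SimplexCategory.mk 0))).obj n,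
    ((ε.app (op (SimplexCategory.mk 0))).app n).hom x = 0 → ∃ y, faceSum P 0 n y = x
  exact_succ : ∀ m n, ∀ x : (P.obj (op (SimplexCategory.mk (m + 1)))).obj n,
    faceSum P m n x = 0 → ∃ y, faceSum P (m + 1) n y = x

end Algebras

/-! ## The operations -/

section Operations

variable (R : Type) [CommRing R] (p i : ℕ)

/-- The complex computing `S^p(R[-i])`. -/
abbrev symCochains : CochainComplex (ModuleCat.{0} R) ℕ :=
  (alternatingCofaceMapComplex _).obj
    (((CosimplicialObject.whiskering _ _).obj (symFunctor R p)).obj (dk R i))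

/-- The complex computing `Γ^p(R[-i])`. -/
abbrev divCochains : CochainComplex (ModuleCat.{0} R) ℕ :=
  (alternatingCofaceMapComplex _).obj
    (((CosimplicialObject.whiskering _ _).obj (divFunctor R p)).obj (dk R i))

/-- The norm map `N_p : S^p(R[-i]) → Γ^p(R[-i])`. -/
def normCochains : symCochains R p i ⟶ divCochains R p i :=
  (alternatingCofaceMapComplex _).map
    (((CosimplicialObject.whiskering _ _).map (normTrans R p)).app (dk R i))

/-- A cocycle `(g, s)` of degree `i` in the cone `T_p(R[-i])` of the norm map
`N_p : S^p(R[-i]) → Γ^p(R[-i])`, where `g` has degree `i` and `s` has degree `i + 1`, whose image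
in `coker N_p` is `ι^{⊗p}` for the generator `ι` of `R[-i]`. The map `γ : T_p(R[-i])[-1] →
S^p(R[-i])` takes it to `s`. -/
structure TateGen where
  g : (divCochains R p i).X i
  s : (symCochains R p i).X (i + 1)
  d_s : (symCochains R p i).d (i + 1) (i + 2) s = 0
  norm_s : (normCochains R p i).f (i + 1) s + (divCochains R p i).d i (i + 1) g = 0
  gen : ∃ h : (symCochains R p i).X i,
    g = (show (divCochains R p i).X i from
      (divPow p (dkOne R i) : Div R p ((dk R i).obj (SimplexCategory.mk i)))) +
        (normCochains R p i).f i h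

variable {R p i}

/-- A family of linear maps `u^n` from the cosimplicial module of `R[-i]` to a cosimplicial
commutative algebra `A` is a map of cosimplicial modules. -/
def IsCosMap {A : CosimplicialObject (CommAlgCat.{v} R)}
    (u : ∀ n : SimplexCategory, (dk R i).obj n →ₗ[R] A.obj n) : Prop :=
  ∀ (m n : SimplexCategory) (θ : m ⟶ n) (x : (dk R i).obj m),
    u n ((dk R i).map θ x) = (A.map θ).hom (u m x)

variable (p) in
/-- The cohomology operation attached to a cocycle `c` of `S^p(R[-i])` of degree `j`, as a
relation: `y` is a value at `x` if for some map `u : R[-i] → A` of cosimplicial modules representing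
`x`, the class `y` is the image of the class of `c` under `S^p(R[-i]) → S^p A → A`. -/
def OpRel {j : ℕ} (c : (symCochains R p i).X j) (A : CosimplicialObject (CommAlgCat.{v} R))
    (x : Coh i (ringOf A)) (y : Coh j (ringOf A)) : Prop :=
  ∃ u : ∀ n : SimplexCategory, (dk R i).obj n →ₗ[R] A.obj n, IsCosMap u ∧
    IsClass (cochains (addOf (ringOf A))) (k := i) (u (SimplexCategory.mk i) (dkOne R i)) x ∧
    IsClass (cochains (addOf (ringOf A))) (k := j) (symMul p (u (SimplexCategory.mk j)) c) y

variable (p) in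
/-- The graph of `P¹ : H^i(A) → H^{i+1}(A)`, the operation attached to the class
`γ(1) ∈ H^{i+1}(S^p(R[-i]))`. -/
def P1Rel (A : CosimplicialObject (CommAlgCat.{v} R)) (x : Coh i (ringOf A))
    (y : Coh (i + 1) (ringOf A)) : Prop :=
  ∃ t : TateGen R p i, OpRel p t.s A x y

variable (p) in
/-- The graph of `P⁰ : H^i(A) → H^i(A)`, the operation attached to the class
`Δ(ι) = ι^p ∈ H^i(S^p(R[-i]))`. -/
def P0Rel (A : CosimplicialObject (CommAlgCat.{v} R)) (x y : Coh i (ringOf A)) : Prop :=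
  OpRel p (j := i)
    (symPow p (dkOne R i) : Sym R p ((dk R i).obj (SimplexCategory.mk i))) A x y

end Operations

end CosimplicialSteenrod

end

noncomputable section

namespace CosimplicialSteenrod

/-! ## Classes of cocycles -/

section Classes

/-! Both operations `P¹` are compared with a single map, the connecting homomorphism of A → W₂(A) →
A, over any base R in which (p-1)! is invertible; ℤ_p and 𝔽_p are such rings.

Let e_0, …, e_i be the basis of R[-i] in degree i+1 indexed by the degeneracies, and put e_{-1} =
e_{i+1} = 0. The j-th coface sends ι to e_{j-1} + e_j. Since (p-1)! is invertible, ((x+y)^p - x^p -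
y^p)/p! makes sense in S^p, and its norm is (x+y)^{⊗p} - x^{⊗p} - y^{⊗p}. In the alternating sum
over j the pure powers cancel, so minus the alternating sum of these mixed terms is an element s
with N s = -d(ι^{⊗p}) (`normMap_tateCocycle`). An element of S^p of a finite free module is
determined by its norm and its coefficients at the pure powers (`sym_eq_zero_of_normMap_eq_zero`),
and a cocycle of degree i+1 has no pure powers (`diagCoeff_surjTriple_d`). Hence s is a cocycle and
represents γ(1), whatever representative of 1 was chosen.

If u : R[-i] → A sends ι to a, the image of s in A is -1/(p-1)! times m, the alternating sum of the
polynomials ((x+y)^p - x^p - y^p)/p. The addition law [x+y] = [x] + [y] + V(((x+y)^p - x^p - y^p)/p)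
in W₂ (`teich_add`) gives d[a] = V(m), so m represents the Witt connecting map at the class of a. By
Wilson, -1/(p-1)! is 1 modulo p, and p·m = d(a^p), so the scalar only adds a coboundary
(`isClass_symMul_tateCocycle`). Dold–Kan supplies a map u for every class (`exists_isCosMap`).

On a p-torsion free ring the ghost component (a_0, a_1) ↦ a_0^p + p·a_1 maps the extension by V to
the extension by p, with Frobenius after reduction on the quotients; this gives Bock ∘ φ
(`bockFrob_eq_wittBockH`). In general the same lift [a] is taken termwise in the total complex of a
flat resolution and pushed along the augmentation (`cohAug_bockFrob2`). For `P⁰`, the element ι^p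
maps to a^p. -/

instance : HasForget₂ AddCommGrpCat.{v} AddCommGrpCat.{v} where
  forget₂ := 𝟭 _
  forget_comp := rfl

instance : (forget₂ AddCommGrpCat.{v} AddCommGrpCat.{v}).Additive :=
  inferInstanceAs (𝟭 AddCommGrpCat.{v}).Additive

instance : (forget₂ AddCommGrpCat.{v} AddCommGrpCat.{v}).PreservesHomology :=
  inferInstanceAs (𝟭 AddCommGrpCat.{v}).PreservesHomology

variable {κ : Type} {c : ComplexShape κ}

theorem d_d_apply (C : HomologicalComplex AddCommGrpCat.{v} c) (i j k : κ) (a : C.X i) :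
    C.d j k (C.d i j a) = 0 := by
  rw [← ConcreteCategory.comp_apply, HomologicalComplex.d_comp_d]; rfl

theorem hom_d_apply {C D : HomologicalComplex AddCommGrpCat.{v} c} (f : C ⟶ D) (i j : κ)
    (a : C.X i) : D.d i j (f.f i a) = f.f j (C.d i j a) := by
  rw [← ConcreteCategory.comp_apply, ← ConcreteCategory.comp_apply, HomologicalComplex.Hom.comm]

theorem IsClass.d_eq_zero {C : HomologicalComplex AddCommGrpCat.{v} c} {k : κ} {a : C.X k}
    {x : C.homology k} (h : IsClass C a x) (l : κ) : C.d k l a = 0 := by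
  obtain ⟨z, rfl, -⟩ := h
  rw [← ConcreteCategory.comp_apply, HomologicalComplex.iCycles_d]; rfl

theorem exists_isClass {C : HomologicalComplex AddCommGrpCat.{v} c} {k l : κ}
    (hl : c.next k = l) {a : C.X k} (h : C.d k l a = 0) : ∃ x, IsClass C a x :=
  ⟨_, C.cyclesMk a l hl h, C.i_cyclesMk a l hl h, rfl⟩

theorem exists_cocycle {C : HomologicalComplex AddCommGrpCat.{v} c} {k : κ} (x : C.homology k) :
    ∃ a, IsClass C a x := by
  have h : Function.Surjective (C.homologyπ k) :=
    (AddCommGrpCat.epi_iff_surjective _).1 inferInstance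
  obtain ⟨z, rfl⟩ := h x
  exact ⟨_, z, rfl, rfl⟩

theorem iCycles_injective (C : HomologicalComplex AddCommGrpCat.{v} c) (k : κ) :
    Function.Injective (C.iCycles k) :=
  (AddCommGrpCat.mono_iff_injective _).1 inferInstance

theorem IsClass.unique {C : HomologicalComplex AddCommGrpCat.{v} c} {k : κ} {a : C.X k}
    {x y : C.homology k} (hx : IsClass C a x) (hy : IsClass C a y) : x = y := by
  obtain ⟨z, hz, rfl⟩ := hx
  obtain ⟨z', hz', rfl⟩ := hy
  rw [iCycles_injective C k (hz.trans hz'.symm)]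

theorem IsClass.add {C : HomologicalComplex AddCommGrpCat.{v} c} {k : κ} {a b : C.X k}
    {x y : C.homology k} (hx : IsClass C a x) (hy : IsClass C b y) : IsClass C (a + b) (x + y) := by
  obtain ⟨z, rfl, rfl⟩ := hx
  obtain ⟨z', rfl, rfl⟩ := hy
  exact ⟨z + z', map_add _ _ _, map_add _ _ _⟩

theorem IsClass.sub {C : HomologicalComplex AddCommGrpCat.{v} c} {k : κ} {a b : C.X k}
    {x y : C.homology k} (hx : IsClass C a x) (hy : IsClass C b y) : IsClass C (a - b) (x - y) := by
  obtain ⟨z, rfl, rfl⟩ := hx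
  obtain ⟨z', rfl, rfl⟩ := hy
  exact ⟨z - z', map_sub _ _ _, map_sub _ _ _⟩

theorem isClass_d {C : HomologicalComplex AddCommGrpCat.{v} c} {j k : κ} (b : C.X j) :
    IsClass C (C.d j k b) (0 : C.homology k) := by
  refine ⟨C.toCycles j k b, ?_, ?_⟩
  · rw [← ConcreteCategory.comp_apply, HomologicalComplex.toCycles_i]
  · rw [← ConcreteCategory.comp_apply, HomologicalComplex.toCycles_comp_homologyπ]; rfl

theorem isClass_zero_iff {C : HomologicalComplex AddCommGrpCat.{v} c} {j k : κ} (hj : c.prev k = j)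
    {a : C.X k} : IsClass C a (0 : C.homology k) ↔ ∃ b, C.d j k b = a := by
  constructor
  · rintro ⟨z, rfl, hz⟩
    have hex : (ShortComplex.mk _ _ (C.toCycles_comp_homologyπ j k)).Exact :=
      ShortComplex.exact_of_g_is_cokernel _ (C.homologyIsCokernel j k hj)
    obtain ⟨b, hb⟩ := (ShortComplex.ab_exact_iff _).1 hex z hz
    refine ⟨b, ?_⟩
    change C.toCycles j k b = z at hb
    rw [← hb, ← ConcreteCategory.comp_apply, HomologicalComplex.toCycles_i]
  · rintro ⟨b, rfl⟩
    exact isClass_d b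

theorem IsClass.add_d {C : HomologicalComplex AddCommGrpCat.{v} c} {j k : κ} {a : C.X k}
    {x : C.homology k} (h : IsClass C a x) (b : C.X j) : IsClass C (a + C.d j k b) x := by
  simpa using h.add (isClass_d (k := k) b)

theorem IsClass.eq_of_sub {C : HomologicalComplex AddCommGrpCat.{v} c} {j k : κ} {a a' : C.X k}
    {x x' : C.homology k} (h : IsClass C a x) (h' : IsClass C a' x') (b : C.X j)
    (hb : a' = a + C.d j k b) : x = x' :=
  (hb ▸ h.add_d b).unique h'

theorem IsClass.map {C D : HomologicalComplex AddCommGrpCat.{v} c} (f : C ⟶ D) {k : κ} {a : C.X k}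
    {x : C.homology k} (h : IsClass C a x) :
    IsClass D (f.f k a) (HomologicalComplex.homologyMap f k x) := by
  obtain ⟨z, rfl, rfl⟩ := h
  refine ⟨HomologicalComplex.cyclesMap f k z, ?_, ?_⟩
  · rw [← ConcreteCategory.comp_apply, ← ConcreteCategory.comp_apply,
      HomologicalComplex.cyclesMap_i]
  · rw [← ConcreteCategory.comp_apply, ← ConcreteCategory.comp_apply,
      HomologicalComplex.homologyπ_naturality]

/-- All connecting homomorphisms are computed through this. The lift y is an arbitrary element, so
the non-additive lifts a ↦ [a] and a ↦ a^p are allowed. -/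
theorem IsClass.delta {S : ShortComplex (HomologicalComplex AddCommGrpCat.{v} c)}
    (hS : S.ShortExact) {i j : κ} (hij : c.Rel i j) {z : S.X₃.X i} {x : S.X₃.homology i}
    (h : IsClass S.X₃ z x) (y : S.X₂.X i) (hy : S.g.f i y = z) (w : S.X₁.X j)
    (hw : S.f.f j w = S.X₂.d i j y) : IsClass S.X₁ w (hS.δ i j hij x) := by
  -- The element-level snake lemma asks for a homology-preserving forgetful functor to abelian
  -- groups; the instances above supply the identity.
  have h1 := hS.δ_apply i j hij z (h.d_eq_zero j) y hy w hw _ rfl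
  have h2 : S.X₃.homologyπ i (S.X₃.cyclesMk z j (c.next_eq' hij) (h.d_eq_zero j)) = x :=
    IsClass.unique (C := S.X₃) ⟨_, S.X₃.i_cyclesMk z j _ _, rfl⟩ h
  rw [← h2]
  exact ⟨_, S.X₁.i_cyclesMk w _ rfl _, h1.symm⟩

end Classes

theorem IsClass.connecting {X Y Z : CosimplicialObject AddCommGrpCat.{v}} (f : X ⟶ Y) (g : Y ⟶ Z)
    (h : ∀ n, IsSES (f.app n) (g.app n)) {i : ℕ} {z : (cochains Z).X i} {x : H i Z}
    (hx : IsClass (cochains Z) z x) (y : (cochains Y).X i)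
    (hy : g.app (SimplexCategory.mk i) y = z) (w : (cochains X).X (i + 1))
    (hw : f.app (SimplexCategory.mk (i + 1)) w = (cochains Y).d i (i + 1) y) :
    IsClass (cochains X) w (connecting f g h i x) :=
  IsClass.delta (shortExact_of_isSES (ShortComplex.mk
    ((alternatingCofaceMapComplex AddCommGrpCat.{v}).map f)
    ((alternatingCofaceMapComplex AddCommGrpCat.{v}).map g) _) (fun k => h (SimplexCategory.mk k)))
    (show (ComplexShape.up ℕ).Rel i (i + 1) from rfl) hx y hy w hw

theorem IsClass.totConnecting {X Y Z : SimplicialObject (CosimplicialObject AddCommGrpCat.{v})}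
    (f : X ⟶ Y) (g : Y ⟶ Z) (h : ∀ m n, IsSES ((f.app m).app n) ((g.app m).app n)) {k : ℤ}
    {z : (tot Z).X k} {x : (tot Z).homology k} (hx : IsClass (tot Z) z x) (y : (tot Y).X k)
    (hy : (totHom g).f k y = z) (w : (tot X).X (k + 1))
    (hw : (totHom f).f (k + 1) w = (tot Y).d k (k + 1) y) :
    IsClass (tot X) w (totConnecting f g h k x) :=
  IsClass.delta (shortExact_of_isSES (ShortComplex.mk (totHom f) (totHom g) _)
    (totHom_isSES f g h)) (show (ComplexShape.up ℤ).Rel k (k + 1) from rfl) hx y hy w hw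

theorem sum_zsmul_hom_apply {X Y : AddCommGrpCat.{v}} {J : Type*} (s : Finset J) (r : J → ℤ)
    (f : J → (X ⟶ Y)) (a : X) : (∑ j ∈ s, r j • f j) a = ∑ j ∈ s, r j • f j a := by
  have h : ∀ g : X ⟶ Y, g a = (AddMonoidHom.eval a).comp
      (AddCommGrpCat.homAddEquiv (M := X) (N := Y)).toAddMonoidHom g := fun _ => rfl
  rw [h, map_sum]
  simp only [map_zsmul]
  rfl

theorem cochains_d_apply (X : CosimplicialObject AddCommGrpCat.{v}) (n : ℕ)
    (a : (cochains X).X n) :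
    (cochains X).d n (n + 1) a =
      ∑ k : Fin (n + 2), (-1 : ℤ) ^ (k : ℕ) • (show X.obj (SimplexCategory.mk (n + 1)) from
        X.δ k (show X.obj (SimplexCategory.mk n) from a)) := by
  have h : (cochains X).d n (n + 1) = AlternatingCofaceMapComplex.objD X n :=
    CochainComplex.of_d (fun n => X.obj ⦋n⦌) (AlternatingCofaceMapComplex.objD X) n
  rw [h, AlternatingCofaceMapComplex.objD]
  exact sum_zsmul_hom_apply _ _ _ a

/-! ## Maps of cosimplicial objects from maps of cochain complexes -/

section DoldKanMaps

open AlgebraicTopology.DoldKan CategoryTheory.Idempotents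

/-- Dold–Kan for an additive category holds after idempotent completion, so a chain map lifts to a
simplicial map only after being cut down by `PInfty` on both sides. -/
theorem exists_simplicial_hom {C : Type*} [Category* C] [Preadditive C]
    [Limits.HasFiniteCoproducts C] {X Y : SimplicialObject C}
    (f : AlternatingFaceMapComplex.obj X ⟶ AlternatingFaceMapComplex.obj Y) :
    ∃ g : X ⟶ Y,
      (PInfty : AlternatingFaceMapComplex.obj X ⟶ AlternatingFaceMapComplex.obj X) ≫
        AlternatingFaceMapComplex.map g =
      (PInfty : AlternatingFaceMapComplex.obj X ⟶ AlternatingFaceMapComplex.obj X) ≫ f ≫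
        (PInfty : AlternatingFaceMapComplex.obj Y ⟶ AlternatingFaceMapComplex.obj Y) := by
  -- `N₂` is an equivalence and `N₁` is its restriction along the full embedding into the Karoubi
  -- envelope, so `N₁` is full.
  have : (N₂ : Karoubi (SimplicialObject C) ⥤ _).Full :=
    inferInstanceAs (CategoryTheory.Preadditive.DoldKan.equivalence (C := C)).functor.Full
  have : (N₁ : SimplicialObject C ⥤ _).Full := Functor.Full.of_iso toKaroubiCompN₂IsoN₁
  let F : N₁.obj X ⟶ N₁.obj Y :=
    { f := (PInfty : AlternatingFaceMapComplex.obj X ⟶ AlternatingFaceMapComplex.obj X) ≫ f ≫ PInfty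
      comm := by
        change PInfty ≫ (PInfty ≫ f ≫ PInfty) ≫ PInfty = _
        simp only [Category.assoc, PInfty_idem, PInfty_idem_assoc] }
  refine ⟨N₁.preimage F, ?_⟩
  exact congrArg Karoubi.Hom.f (N₁.map_preimage F)

/-- The simplicial object in the opposite category attached to a cosimplicial object. -/
abbrev opSimplicial {C : Type*} [Category* C] (A : CosimplicialObject C) : SimplicialObject Cᵒᵖ :=
  (cosimplicialSimplicialEquiv C).functor.obj (op A)

theorem alternatingFaceMap_opSimplicial_d {C : Type*} [Category* C] [Preadditive C]
    (A : CosimplicialObject C) (n : ℕ) :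
    (AlternatingFaceMapComplex.obj (opSimplicial A)).d (n + 1) n =
      (((alternatingCofaceMapComplex C).obj A).d n (n + 1)).op := by
  have h1 : ((alternatingCofaceMapComplex C).obj A).d n (n + 1) =
      AlternatingCofaceMapComplex.objD A n :=
    CochainComplex.of_d (fun n => A.obj ⦋n⦌) (AlternatingCofaceMapComplex.objD A) n
  rw [h1, AlternatingCofaceMapComplex.d_eq_unop_d, AlternatingFaceMapComplex.obj_d_eq]
  rfl

/-- The idempotent projecting the cochains of a cosimplicial object onto the normalized ones. -/
def normProj {C : Type*} [Category* C] [Preadditive C] (A : CosimplicialObject C) (n : ℕ) :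
    ((alternatingCofaceMapComplex C).obj A).X n ⟶ ((alternatingCofaceMapComplex C).obj A).X n :=
  ((PInfty : AlternatingFaceMapComplex.obj (opSimplicial A) ⟶ _).f n).unop

theorem normProj_naturality {C : Type*} [Category* C] [Preadditive C] {A B : CosimplicialObject C}
    (g : A ⟶ B) (n : ℕ) : normProj A n ≫ ((alternatingCofaceMapComplex C).map g).f n =
      ((alternatingCofaceMapComplex C).map g).f n ≫ normProj B n := by
  have := PInfty_f_naturality n ((cosimplicialSimplicialEquiv C).functor.map g.op)
  exact congrArg Quiver.Hom.unop this

/-- The homotopy from `PInfty` to the identity, read in the opposite category. It shows that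
`normProj` moves a cocycle only by a coboundary. -/
theorem exists_normProj_eq {C : Type*} [Category* C] [Preadditive C] (A : CosimplicialObject C)
    (n : ℕ) : ∃ (s : ((alternatingCofaceMapComplex C).obj A).X (n + 1) ⟶
        ((alternatingCofaceMapComplex C).obj A).X n)
      (t : ((alternatingCofaceMapComplex C).obj A).X n ⟶
        ((alternatingCofaceMapComplex C).obj A).X (n - 1)),
      normProj A n = ((alternatingCofaceMapComplex C).obj A).d n (n + 1) ≫ s +
        t ≫ ((alternatingCofaceMapComplex C).obj A).d (n - 1) n + 𝟙 _ := by
  have h := (homotopyPInftyToId (opSimplicial A)).comm n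
  rw [Homotopy.prevD_chainComplex] at h
  cases n with
  | zero =>
    rw [Homotopy.dNext_zero_chainComplex, zero_add, alternatingFaceMap_opSimplicial_d] at h
    refine ⟨((homotopyPInftyToId (opSimplicial A)).hom 0 1).unop, 0, ?_⟩
    rw [Limits.zero_comp, add_zero]
    exact congrArg Quiver.Hom.unop h
  | succ n =>
    rw [Homotopy.dNext_succ_chainComplex, alternatingFaceMap_opSimplicial_d,
      alternatingFaceMap_opSimplicial_d] at h
    refine ⟨((homotopyPInftyToId (opSimplicial A)).hom (n + 1) (n + 2)).unop,
      ((homotopyPInftyToId (opSimplicial A)).hom n (n + 1)).unop, ?_⟩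
    exact (congrArg Quiver.Hom.unop h).trans (congrArg (· + 𝟙 _) (add_comm _ _))

/-- A cosimplicial object of C is a simplicial object of Cᵒᵖ, and Cᵒᵖ is again additive, so
`exists_simplicial_hom` applies there to the reversed map. -/
theorem exists_cosimplicial_hom {C : Type*} [Category* C] [Preadditive C]
    [Limits.HasFiniteProducts C] {D A : CosimplicialObject C}
    (f : (alternatingCofaceMapComplex C).obj D ⟶ (alternatingCofaceMapComplex C).obj A) :
    ∃ g : D ⟶ A, ∀ n, ((alternatingCofaceMapComplex C).map g).f n ≫ normProj A n =
      normProj D n ≫ f.f n ≫ normProj A n := by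
  let F : AlternatingFaceMapComplex.obj (opSimplicial A) ⟶
      AlternatingFaceMapComplex.obj (opSimplicial D) :=
    { f := fun n => (f.f n).op
      comm' := by
        rintro _ n rfl
        refine Eq.trans (congrArg _ (alternatingFaceMap_opSimplicial_d D n)) (Eq.trans ?_
          (congrArg (· ≫ (f.f n).op) (alternatingFaceMap_opSimplicial_d A n)).symm)
        exact congrArg Quiver.Hom.op (f.comm n (n + 1)).symm }
  obtain ⟨g, hg⟩ := exists_simplicial_hom F
  refine ⟨((cosimplicialSimplicialEquiv C).functor.preimage g).unop, fun n => ?_⟩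
  have h1 := congrArg Quiver.Hom.unop (HomologicalComplex.congr_hom hg n)
  have h2 : ∀ k, (cosimplicialSimplicialEquiv C).functor.map k = g →
      ((alternatingCofaceMapComplex C).map k.unop).f n = (g.app (op ⦋n⦌)).unop := by
    rintro k rfl
    rfl
  have h3 := h2 _ ((cosimplicialSimplicialEquiv C).functor.map_preimage g)
  exact (congrArg (· ≫ normProj A n) h3).trans (h1.trans (Category.assoc _ _ _))

end DoldKanMaps

theorem module_d_apply {R : Type*} [Ring R] (X : CosimplicialObject (ModuleCat.{v} R)) (n : ℕ)
    (a : X.obj ⦋n⦌) :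
    (show X.obj ⦋n + 1⦌ from
      (((alternatingCofaceMapComplex (ModuleCat.{v} R)).obj X).d n (n + 1)).hom a) =
      ∑ k : Fin (n + 2), (-1 : ℤ) ^ (k : ℕ) • (X.δ k).hom a := by
  have h : ((alternatingCofaceMapComplex (ModuleCat.{v} R)).obj X).d n (n + 1) =
      AlternatingCofaceMapComplex.objD X n :=
    CochainComplex.of_d (fun n => X.obj ⦋n⦌) (AlternatingCofaceMapComplex.objD X) n
  rw [h, AlternatingCofaceMapComplex.objD]
  change (ModuleCat.Hom.hom
    (∑ i : Fin (n + 2), (-1 : ℤ) ^ (i : ℕ) • X.δ i : X.obj ⦋n⦌ ⟶ X.obj ⦋n + 1⦌)) a = _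
  rw [ModuleCat.hom_sum]
  simp only [ModuleCat.hom_zsmul, LinearMap.sum_apply, LinearMap.smul_apply]

/-! ### Surjections onto [i] from [i] and [i+1] -/

section Surjections

variable (i : ℕ)

/-- The elementary surjection `σ^a : [i + 1] → [i]`. -/
def surjσ (a : Fin (i + 1)) : Surj ⦋i + 1⦌ i :=
  ⟨SimplexCategory.σ a, SimplexCategory.epi_iff_surjective.1 inferInstance⟩

/-- The identity of `[i]` as a surjection. -/
def surjId : Surj ⦋i⦌ i := ⟨𝟙 _, SimplexCategory.epi_iff_surjective.1 inferInstance⟩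

theorem surj_eq_surjId (σ : Surj ⦋i⦌ i) : σ = surjId i := by
  have : Epi σ.1 := SimplexCategory.epi_iff_surjective.2 σ.2
  exact Subtype.ext (SimplexCategory.eq_id_of_epi σ.1)

theorem exists_eq_surjσ (σ : Surj ⦋i + 1⦌ i) : ∃ a, σ = surjσ i a := by
  have : Epi σ.1 := SimplexCategory.epi_iff_surjective.2 σ.2
  obtain ⟨a, ha⟩ := SimplexCategory.eq_σ_of_epi σ.1
  exact ⟨a, Subtype.ext ha⟩

/-- The map σ^a identifies only a and a+1. If the omitted point j is neither, both survive, and a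
non-injective self-map of a finite set is not surjective. -/
theorem surjective_δ_σ_iff (j : Fin (i + 2)) (a : Fin (i + 1)) :
    Function.Surjective (SimplexCategory.δ j ≫ (surjσ i a).1).toOrderHom ↔
      j = a.castSucc ∨ j = a.succ := by
  constructor
  · intro h
    by_contra! hne
    obtain ⟨x, hx⟩ := Fin.exists_succAbove_eq hne.1.symm
    obtain ⟨y, hy⟩ := Fin.exists_succAbove_eq hne.2.symm
    have hinj := Finite.injective_iff_surjective.2 h
    have hxy : x = y := hinj (by
      change a.predAbove (j.succAbove x) = a.predAbove (j.succAbove y)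
      rw [hx, hy, Fin.predAbove_castSucc_self, Fin.predAbove_succ_self])
    rw [hxy, hy] at hx
    exact absurd hx (Fin.castSucc_lt_succ).ne'
  · rintro (rfl | rfl)
    · change Function.Surjective (SimplexCategory.δ a.castSucc ≫ SimplexCategory.σ a).toOrderHom
      rw [SimplexCategory.δ_comp_σ_self]
      exact fun x => ⟨x, rfl⟩
    · change Function.Surjective (SimplexCategory.δ a.succ ≫ SimplexCategory.σ a).toOrderHom
      rw [SimplexCategory.δ_comp_σ_succ]
      exact fun x => ⟨x, rfl⟩

/-- The index a is recovered from the two cofaces j = a, a+1 whose composite with σ^a stays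
surjective. -/
theorem surjσ_injective : Function.Injective (surjσ i) := by
  intro a b h
  have h1 := (surjective_δ_σ_iff i a.castSucc b).1
    (h ▸ (surjective_δ_σ_iff i a.castSucc a).2 (Or.inl rfl))
  have h2 := (surjective_δ_σ_iff i a.succ b).1
    (h ▸ (surjective_δ_σ_iff i a.succ a).2 (Or.inr rfl))
  simp only [Fin.ext_iff, Fin.val_castSucc, Fin.val_succ] at h1 h2 ⊢
  omega

theorem isEmpty_surj {n : ℕ} (h : n < i) : IsEmpty (Surj ⦋n⦌ i) := by
  refine ⟨fun σ => ?_⟩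
  have : Epi σ.1 := SimplexCategory.epi_iff_surjective.2 σ.2
  have := SimplexCategory.len_le_of_epi σ.1
  simp at this
  omega

end Surjections


/-! ### Every cohomology class comes from a map out of R[-i] -/

section Existence

variable {R : Type} [CommRing R] {i : ℕ}

/-- The generator of `R[-i]` as a function on surjections. -/
abbrev dkGen (R : Type) [CommRing R] (i : ℕ) : Surj ⦋i⦌ i → R := dkOne R i

open Classical in
theorem dkMap_apply {n m : SimplexCategory} (θ : n ⟶ m) (f : Surj n i → R) (σ : Surj m i) :
    dkMap R i θ f σ =
      if h : Function.Surjective (θ ≫ σ.1).toOrderHom then f ⟨θ ≫ σ.1, h⟩ else 0 := rfl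

theorem dkMap_δ_dkGen (j : Fin (i + 2)) (a : Fin (i + 1)) :
    dkMap R i (SimplexCategory.δ j) (dkGen R i) (surjσ i a) =
      if j = a.castSucc ∨ j = a.succ then 1 else 0 := by
  rw [dkMap_apply]
  simp only [surjective_δ_σ_iff, dkOne, dite_eq_ite]

theorem dkMap_δ_dkGen' (j : Fin (i + 2)) (a : Fin (i + 1)) :
    dkMap R i (SimplexCategory.δ j) (dkGen R i) (surjσ i a) =
      (if j = a.castSucc then 1 else 0) + (if j = a.succ then 1 else 0) := by
  rw [dkMap_δ_dkGen]
  by_cases h1 : j = a.castSucc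
  · subst h1
    simp [(Fin.castSucc_lt_succ (i := a)).ne]
  · by_cases h2 : j = a.succ <;> simp [h1, h2, (Fin.castSucc_lt_succ (i := a)).ne']

/-- At σ^a exactly the cofaces j = a and j = a+1 contribute, with opposite signs. -/
theorem dk_d_dkOne :
    ∑ j : Fin (i + 2), (-1 : ℤ) ^ (j : ℕ) • dkMap R i (SimplexCategory.δ j) (dkGen R i) = 0 := by
  refine funext fun σ => ?_
  obtain ⟨a, rfl⟩ := exists_eq_surjσ i σ
  simp only [Finset.sum_apply, Pi.smul_apply, dkMap_δ_dkGen', smul_add, Finset.sum_add_distrib,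
    smul_ite, smul_zero, Finset.sum_ite_eq', Finset.mem_univ, if_true, Pi.zero_apply]
  simp [pow_succ]

/-- The cosimplicial module underlying a cosimplicial commutative algebra. -/
def moduleOf (A : CosimplicialObject (CommAlgCat.{v} R)) : CosimplicialObject (ModuleCat.{v} R) :=
  ((CosimplicialObject.whiskering _ _).obj
    (forget₂ (CommAlgCat.{v} R) (AlgCat.{v} R) ⋙ forget₂ (AlgCat.{v} R) (ModuleCat.{v} R))).obj A

/-- The cosimplicial module `R[-i]` in a higher universe. -/
def dkULift (R : Type) [CommRing R] (i : ℕ) : CosimplicialObject (ModuleCat.{v} R) :=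
  ((CosimplicialObject.whiskering _ _).obj (ModuleCat.uliftFunctor.{v} R)).obj (dk R i)

theorem cochains_d_moduleOf (A : CosimplicialObject (CommAlgCat.{v} R)) (n m : ℕ)
    (a : (ringOf A).obj ⦋n⦌) :
    (show (ringOf A).obj ⦋m⦌ from (cochains (addOf (ringOf A))).d n m a) =
      (((alternatingCofaceMapComplex (ModuleCat.{v} R)).obj (moduleOf A)).d n m).hom a := by
  by_cases h : n + 1 = m
  · subst h
    exact (cochains_d_apply (addOf (ringOf A)) n a).trans (module_d_apply (moduleOf A) n a).symm
  · rw [HomologicalComplex.shape _ _ _ h, HomologicalComplex.shape _ _ _ h]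
    rfl

/-- There is a map of cochain complexes from `R[-i]` which sends the generator to a given
cocycle. -/
theorem exists_cochain_map (A : CosimplicialObject (ModuleCat.{v} R))
    (z : ((alternatingCofaceMapComplex (ModuleCat.{v} R)).obj A).X i)
    (hz : (((alternatingCofaceMapComplex (ModuleCat.{v} R)).obj A).d i (i + 1)).hom z = 0) :
    ∃ f : (alternatingCofaceMapComplex (ModuleCat.{v} R)).obj (dkULift R i) ⟶
      (alternatingCofaceMapComplex (ModuleCat.{v} R)).obj A,
      (f.f i).hom (ULift.up (dkOne R i)) = z := by
  classical
  let K := (alternatingCofaceMapComplex (ModuleCat.{v} R)).obj A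
  obtain ⟨z', h1, h2⟩ : ∃ z' : ∀ n, K.X n, z' i = z ∧ ∀ n, n ≠ i → z' n = 0 :=
    ⟨fun n => if h : n = i then h ▸ z else 0, by simp, fun n h => dif_neg h⟩
  have hz' : ∀ n, (K.d n (n + 1)).hom (z' n) = 0 := by
    intro n
    by_cases h : n = i
    · subst h
      rw [h1]
      exact hz
    · rw [h2 n h, map_zero]
  have := fun n => Fintype.ofFinite (Surj ⦋n⦌ i)
  -- Since `z'` vanishes outside degree i, this is zero except in degree i, where the sum has the
  -- single term at the identity of [i].
  let φ : ∀ n, (ULift.{v} (Surj ⦋n⦌ i → R)) →ₗ[R] K.X n := fun n =>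
    ((∑ σ : Surj ⦋n⦌ i, LinearMap.proj σ : (Surj ⦋n⦌ i → R) →ₗ[R] R).smulRight (z' n)) ∘ₗ
      ULift.moduleEquiv.toLinearMap
  have hφ : ∀ n x, φ n x = (∑ σ : Surj ⦋n⦌ i, x.down σ) • z' n := by
    intro n x
    simp [φ]
  refine ⟨{ f := fun n => ModuleCat.ofHom (φ n), comm' := ?_ }, ?_⟩
  · rintro n _ rfl
    apply ModuleCat.hom_ext
    refine LinearMap.ext fun (x : ULift.{v} (Surj ⦋n⦌ i → R)) => ?_
    change (K.d n (n + 1)).hom (φ n x) = φ (n + 1) _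
    refine Eq.trans ?_ (hφ (n + 1) _).symm
    rw [hφ, map_smul, hz', smul_zero]
    -- The only square that could fail has target degree i, and its source vanishes because [i-1]
    -- has no surjection onto [i].
    by_cases h : n + 1 = i
    · have := isEmpty_surj i (n := n) (by omega)
      have hx : x = 0 := ULift.ext _ _ (Subsingleton.elim _ _)
      have hw : ∀ w : ULift.{v} (Surj ⦋n + 1⦌ i → R), w = 0 →
          0 = (∑ σ : Surj ⦋n + 1⦌ i, w.down σ) • z' (n + 1) := by
        rintro _ rfl
        simp
      exact hw _ ((congrArg (((alternatingCofaceMapComplex _).obj (dkULift.{v} R i)).d n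
        (n + 1)).hom hx).trans (map_zero _))
    · rw [h2 _ h, smul_zero]
  · change φ i (ULift.up (dkOne R i)) = z
    have : Unique (Surj ⦋i⦌ i) := ⟨⟨surjId i⟩, surj_eq_surjId i⟩
    rw [hφ, Fintype.sum_unique, h1]
    exact one_smul R z

/-- The map given by Dold–Kan agrees with the chosen cochain map only after normalization. This is
harmless: normalization fixes ι and replaces the cocycle z by a cohomologous one. -/
theorem exists_isCosMap (A : CosimplicialObject (CommAlgCat.{v} R)) (x : Coh i (ringOf A)) :
    ∃ u : ∀ n : SimplexCategory, (dk R i).obj n →ₗ[R] A.obj n, IsCosMap u ∧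
      IsClass (cochains (addOf (ringOf A))) (k := i) (u (SimplexCategory.mk i) (dkOne R i)) x := by
  obtain ⟨z, hzx⟩ := exists_cocycle x
  set K := (alternatingCofaceMapComplex (ModuleCat.{v} R)).obj (moduleOf A) with hK
  set D := (alternatingCofaceMapComplex (ModuleCat.{v} R)).obj (dkULift.{v} R i) with hD
  have hz : (K.d i (i + 1)).hom z = 0 :=
    (cochains_d_moduleOf A i (i + 1) z).symm.trans (hzx.d_eq_zero _)
  obtain ⟨f, hf⟩ := exists_cochain_map (moduleOf A) z hz
  obtain ⟨g, hg⟩ := exists_cosimplicial_hom f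
  let ι : D.X i := ULift.up (dkOne R i)
  -- Both homotopy terms vanish: ι is closed, and R[-i] is zero in degree i-1.
  have hι : (normProj (dkULift R i) i).hom ι = ι := by
    obtain ⟨s, t, hst⟩ := exists_normProj_eq (dkULift.{v} R i) i
    rw [hst]
    change s.hom ((D.d i (i + 1)).hom ι) + (D.d (i - 1) i).hom (t.hom ι) + ι = ι
    have h1 : (D.d i (i + 1)).hom ι = 0 := by
      refine (module_d_apply (dkULift.{v} R i) i ι).trans ?_
      refine ULift.ext _ _ ?_
      refine Eq.trans ?_ (dk_d_dkOne (R := R) (i := i))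
      exact map_sum (ULift.moduleEquiv (R := R)) _ _
    have h2 : (D.d (i - 1) i).hom (t.hom ι) = 0 := by
      cases i with
      | zero => rw [HomologicalComplex.shape _ _ _ (by simp)]; rfl
      | succ i =>
        have := isEmpty_surj (i + 1) (n := i) (by omega)
        have hx : t.hom ι = 0 := ULift.ext _ _ (Subsingleton.elim (α := Surj ⦋i⦌ (i + 1) → R) _ _)
        rw [hx, map_zero]
    rw [h1, h2, map_zero, zero_add, zero_add]
  -- Naturality of the projection together with ι being normalized shows that g(ι) is itself
  -- normalized, hence equal to the projection of z.
  have hgι : ((g.app ⦋i⦌).hom ι : A.obj ⦋i⦌) = (normProj (moduleOf A) i).hom z := by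
    have h1 := congrArg (fun k => k.hom ι) (hg i)
    have h2 := congrArg (fun k => k.hom ι) (normProj_naturality g i)
    have h3 : (normProj (moduleOf A) i).hom ((g.app ⦋i⦌).hom ι) =
      (normProj (moduleOf A) i).hom ((f.f i).hom ((normProj (dkULift R i) i).hom ι)) := h1
    have h4 : (g.app ⦋i⦌).hom ((normProj (dkULift R i) i).hom ι) =
      (normProj (moduleOf A) i).hom ((g.app ⦋i⦌).hom ι) := h2
    rw [hι] at h3 h4
    rw [h4, h3, hf]
  refine ⟨fun n => (g.app n).hom ∘ₗ ULift.moduleEquiv.symm.toLinearMap, ?_, ?_⟩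
  · intro m n θ x
    exact congrArg (fun k => k.hom (ULift.up x)) (g.naturality θ)
  · obtain ⟨s, t, hst⟩ := exists_normProj_eq (moduleOf A) i
    have h1 : (normProj (moduleOf A) i).hom z =
        (show K.X i from z) + (K.d (i - 1) i).hom (t.hom z) := by
      rw [hst]
      change s.hom ((K.d i (i + 1)).hom z) + (K.d (i - 1) i).hom (t.hom z) +
        (show K.X i from z) = _
      rw [hz, map_zero, zero_add, add_comm]
    have h2 := hzx.add_d (j := i - 1) (t.hom z)
    have h3 := cochains_d_moduleOf A (i - 1) i (t.hom z)
    replace hgι := hgι.trans h1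
    have h4 : (show (cochains (addOf (ringOf A))).X i from (g.app ⦋i⦌).hom ι) =
        z + (cochains (addOf (ringOf A))).d (i - 1) i (t.hom z) :=
      hgι.trans (congrArg (fun y : A.obj ⦋i⦌ => (show A.obj ⦋i⦌ from z) + y) h3.symm)
    change IsClass (cochains (addOf (ringOf A)))
      (show (cochains (addOf (ringOf A))).X i from (g.app ⦋i⦌).hom ι) x
    rw [h4]
    exact h2

end Existence

/-! ## The kernel of the norm map on a free module -/

section NormKernel

set_option linter.unusedSectionVars false

variable {R : Type} [CommRing R] {p : ℕ} {J : Type} [Fintype J] [DecidableEq J]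

theorem normMap_tprod {M : Type v} [AddCommGroup M] [Module R M] (x : Fin p → M) :
    (normMap R p M (SymmetricPower.tprod R x)).1 =
      ∑ e : Equiv.Perm (Fin p), PiTensorProduct.tprod R (fun k => x (e k)) := by
  change (∑ e : Equiv.Perm (Fin p), perm p e) (PiTensorProduct.tprod R x) = _
  simp only [LinearMap.sum_apply, perm_tprod]
  exact Fintype.sum_equiv (Equiv.inv _) _ _ fun e => rfl

theorem symMul_tprod {M : Type v} [AddCommGroup M] [Module R M] {B : Type w} [CommRing B]
    [Algebra R B] (f : M →ₗ[R] B) (x : Fin p → M) :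
    symMul p f (SymmetricPower.tprod R x) = ∏ k, f (x k) := by
  change PiTensorProduct.lift _ (PiTensorProduct.tprod R x) = _
  simp

/-- The monomial in the standard basis attached to a word. -/
def wordMon (R : Type) [CommRing R] (w : Fin p → J) : Sym R p (J → R) :=
  SymmetricPower.tprod R fun k => Pi.single (w k) (1 : R)

theorem wordMon_perm (w : Fin p → J) (e : Equiv.Perm (Fin p)) :
    wordMon R (w ∘ e) = wordMon R w :=
  SymmetricPower.tprod_equiv e fun k => (Pi.single (w k) (1 : R) : J → R)

theorem exists_sum_wordMon (s : Sym R p (J → R)) :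
    ∃ c : (Fin p → J) → R, s = ∑ w, c w • wordMon R w := by
  have h : s ∈ Submodule.span R (Set.range (wordMon R : (Fin p → J) → Sym R p (J → R))) := by
    have hs : s ∈ Submodule.span R (Set.range (SymmetricPower.tprod R (ι := Fin p) (M := J → R))) :=
      by rw [SymmetricPower.span_tprod_eq_top]; trivial
    refine Submodule.span_le.2 ?_ hs
    rintro _ ⟨x, rfl⟩
    have hx : x = fun k => ∑ j, x k j • (Pi.single j (1 : R) : J → R) := by
      funext k
      exact (pi_eq_sum_univ' (x k))
    rw [hx, MultilinearMap.map_sum]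
    refine Submodule.sum_mem _ fun w _ => ?_
    rw [MultilinearMap.map_smul_univ]
    exact Submodule.smul_mem _ _ (Submodule.subset_span ⟨w, rfl⟩)
  obtain ⟨c, hc⟩ := (Submodule.mem_span_range_iff_exists_fun R).1 h
  exact ⟨c, hc.symm⟩

/-- The coefficient of a word in an element of the tensor power of a free module. -/
def wordCoeff (R : Type) [CommRing R] (w : Fin p → J) : Ten R p (J → R) →ₗ[R] R :=
  PiTensorProduct.lift ((MultilinearMap.mkPiAlgebra R (Fin p) R).compLinearMap
    fun k => LinearMap.proj (w k))

theorem wordCoeff_tprod (w : Fin p → J) (x : Fin p → J → R) :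
    wordCoeff R w (PiTensorProduct.tprod R x) = ∏ k, x k (w k) := by
  simp [wordCoeff]

theorem prod_single (w w' : Fin p → J) :
    ∏ k, (Pi.single (w' k) (1 : R) : J → R) (w k) = if w' = w then 1 else 0 := by
  split_ifs with h
  · subst h
    simp
  · obtain ⟨k, hk⟩ := Function.ne_iff.1 h
    exact Finset.prod_eq_zero (Finset.mem_univ k) (Pi.single_eq_of_ne hk.symm _)

theorem wordCoeff_normMap (w : Fin p → J) (c : (Fin p → J) → R) :
    wordCoeff R w (normMap R p (J → R) (∑ w', c w' • wordMon R w')).1 =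
      ∑ e : Equiv.Perm (Fin p), c (w ∘ e) := by
  simp only [map_sum, map_smul, Submodule.coe_sum, Submodule.coe_smul, wordMon, normMap_tprod,
    wordCoeff_tprod]
  simp only [prod_single (R := R) w, smul_eq_mul, Finset.mul_sum]
  rw [Finset.sum_comm]
  refine Fintype.sum_equiv (Equiv.inv _) _ _ fun e => ?_
  rw [Finset.sum_eq_single (w ∘ (e⁻¹ : Equiv.Perm (Fin p)))]
  · rw [if_pos (funext fun k => by simp), mul_one]
    rfl
  · intro w' _ hw'
    rw [if_neg, mul_zero]
    rintro rfl
    exact hw' (funext fun k => by simp)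
  · intro h
    exact absurd (Finset.mem_univ _) h

theorem isUnit_factorial (hR : IsUnit ((p - 1).factorial : R)) {m : ℕ}
    (hm : m < p) : IsUnit (m.factorial : R) :=
  isUnit_of_dvd_unit (Nat.cast_dvd_cast (Nat.factorial_dvd_factorial (by omega))) hR

/-- The stabilizer order is the product of the factorials of the letter multiplicities, and in a
non-constant word every multiplicity is less than p. -/
theorem isUnit_card_stabilizer (hR : IsUnit ((p - 1).factorial : R))
    (w : Fin p → J) (hw : ∀ j, w ≠ fun _ => j) :
    IsUnit (Fintype.card {e : Equiv.Perm (Fin p) // w ∘ e = w} : R) := by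
  rw [DomMulAct.stabilizer_card, Nat.cast_prod]
  refine IsUnit.prod_univ_iff.2 fun j => isUnit_factorial hR ?_
  obtain ⟨k, hk⟩ := Function.ne_iff.1 (hw j)
  simpa using Fintype.card_subtype_lt (p := fun a => w a = j) hk

/-- Work orbit by orbit on words. The coefficient of N s at a non-constant word is the stabilizer
order, a unit, times the sum of c over its orbit. The orbit of a constant word is a point, whose
coefficient is read off by the diagonal functional; it needs separate treatment because the
stabilizer order there is p!. -/
theorem sym_eq_zero_of_normMap_eq_zero (hR : IsUnit ((p - 1).factorial : R))
    (s : Sym R p (J → R)) (hs : normMap R p (J → R) s = 0)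
    (hd : ∀ j, symMul p (LinearMap.proj j : (J → R) →ₗ[R] R) s = 0) : s = 0 := by
  obtain ⟨c, rfl⟩ := exists_sum_wordMon s
  have hc : ∀ w, ∑ e : Equiv.Perm (Fin p), c (w ∘ e) = 0 := fun w => by
    rw [← wordCoeff_normMap, hs]
    exact map_zero _
  have hconst : ∀ j, c (fun _ => j) = 0 := fun j => by
    have := hd j
    simp only [map_sum, map_smul, wordMon, symMul_tprod, LinearMap.proj_apply,
      prod_single (fun _ => j)] at this
    simpa using this
  let r : Setoid (Fin p → J) :=
    { r := fun w w' => ∃ e : Equiv.Perm (Fin p), w' = w ∘ e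
      iseqv :=
        { refl := fun w => ⟨1, rfl⟩
          symm := by
            rintro w _ ⟨e, rfl⟩
            exact ⟨e⁻¹, by funext k; simp⟩
          trans := by
            rintro w _ _ ⟨e, rfl⟩ ⟨e', rfl⟩
            exact ⟨e * e', rfl⟩ } }
  let F : Quotient r → Sym R p (J → R) := Quotient.lift (wordMon R) (by
    rintro w _ ⟨e, rfl⟩
    exact (wordMon_perm w e).symm)
  classical
  have h1 : ∀ q : Quotient r, ∑ w with Quotient.mk r w = q, c w = 0 := by
    intro q
    induction q using Quotient.inductionOn with
    | h w₀ =>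
      by_cases hw : ∃ j, w₀ = fun _ => j
      · obtain ⟨j, rfl⟩ := hw
        refine Finset.sum_eq_zero fun w hw => ?_
        obtain ⟨e, he⟩ := Quotient.exact (Finset.mem_filter.1 hw).2.symm
        rw [he]
        exact hconst j
      · push Not at hw
        have hu := isUnit_card_stabilizer (R := R) hR w₀ hw
        refine (hu.mul_right_eq_zero).1 ?_
        -- The permutations are grouped by the word w₀ ∘ e; each fibre is a coset of the stabilizer
        -- of w₀.
        rw [Finset.mul_sum, ← hc w₀, ← Finset.sum_fiberwise_of_maps_to
          (s := Finset.univ) (t := Finset.univ.filter fun w => Quotient.mk r w = Quotient.mk r w₀)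
          (g := fun e : Equiv.Perm (Fin p) => w₀ ∘ e)]
        · refine Finset.sum_congr rfl fun w hw => ?_
          obtain ⟨e₀, rfl⟩ := Quotient.exact (Finset.mem_filter.1 hw).2.symm
          rw [Finset.sum_congr rfl (g := fun _ => c (w₀ ∘ e₀))
            (fun e he => by rw [(Finset.mem_filter.1 he).2]), Finset.sum_const, nsmul_eq_mul]
          congr 2
          rw [Fintype.card_subtype]
          refine Finset.card_equiv (Equiv.mulRight e₀) fun e => ?_
          simp only [Finset.mem_filter, Finset.mem_univ, true_and, Equiv.coe_mulRight,
            Equiv.Perm.coe_mul, ← Function.comp_assoc]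
          exact ⟨fun h => by rw [h], fun h => e₀.surjective.injective_comp_right h⟩
        · intro e _
          exact Finset.mem_filter.2 ⟨Finset.mem_univ _, Quotient.sound ⟨e⁻¹, by funext k; simp⟩⟩
  -- The monomial depends only on the orbit, so s is a combination of orbit monomials whose
  -- coefficients are the orbit sums just shown to vanish.
  have h2 : ∑ w, c w • wordMon R w = ∑ q : Quotient r, (∑ w with Quotient.mk r w = q, c w) • F q := by
    rw [← Finset.sum_fiberwise Finset.univ (Quotient.mk r)]
    refine Finset.sum_congr rfl fun q _ => ?_
    rw [Finset.sum_smul]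
    refine Finset.sum_congr rfl fun w hw => ?_
    rw [← (Finset.mem_filter.1 hw).2]
    rfl
  rw [h2]
  simp only [h1, zero_smul, Finset.sum_const_zero]

end NormKernel

/-! ## The generator of the Tate construction -/

section MixedPower

theorem isUnit_natCast {R : Type*} [CommRing R] {p : ℕ}
    (hR : IsUnit ((p - 1).factorial : R)) {m : ℕ} (h0 : m ≠ 0)
    (hm : m < p) : IsUnit (m : R) :=
  isUnit_of_dvd_unit (Nat.cast_dvd_cast
    ((Nat.dvd_factorial (Nat.pos_of_ne_zero h0) le_rfl).trans
      (Nat.factorial_dvd_factorial (by omega)))) hR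

variable {R : Type} [CommRing R] {p : ℕ} [NeZero p] {M : Type v} [AddCommGroup M] [Module R M]

theorem ne_univ_iff_exists_notMem {α : Type*} [Fintype α] (S : Finset α) :
    S ≠ Finset.univ ↔ ∃ k, k ∉ S := by
  rw [ne_eq, Finset.eq_univ_iff_forall, not_forall]

/-- A permutation is given by its value at 0 together with a permutation of the remaining p-1
points. -/
theorem card_perm_apply_mem (T : Finset (Fin p)) :
    (Finset.univ.filter fun e : Equiv.Perm (Fin p) => e 0 ∈ T).card =
      T.card * (p - 1).factorial := by
  obtain ⟨n, rfl⟩ : ∃ n, p = n + 1 := ⟨p - 1, by have := NeZero.pos p; omega⟩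
  have h : (n + 1 - 1).factorial = (Finset.univ : Finset (Equiv.Perm (Fin n))).card := by
    rw [Finset.card_univ, Fintype.card_perm, Fintype.card_fin, Nat.add_sub_cancel]
  rw [h, ← Finset.card_product]
  refine Finset.card_equiv Equiv.Perm.decomposeFin fun e => ?_
  obtain ⟨⟨a, e⟩, rfl⟩ := Equiv.Perm.decomposeFin.symm.surjective e
  simp

/-- The proper subsets of `Fin p` containing `0`. -/
def properSets (p : ℕ) [NeZero p] : Finset (Finset (Fin p)) :=
  Finset.univ.filter fun S => 0 ∈ S ∧ S ≠ Finset.univ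

/-- The element `((x + y)^p - x^p - y^p) / p!` of the symmetric power. -/
def mixedPower (R : Type) [CommRing R] (p : ℕ) [NeZero p] {M : Type v} [AddCommGroup M]
    [Module R M] (x y : M) : Sym R p M :=
  Ring.inverse ((p - 1).factorial : R) • ∑ S ∈ properSets p, Ring.inverse (S.card : R) •
    SymmetricPower.tprod R (S.piecewise (fun _ => x) fun _ => y)

/-- Restricting `mixedPower` to subsets S containing 0, with weight 1/|S|, avoids division by p:
after symmetrization a subset T is hit |T|·(p-1)! times with weight 1/|T|, so dividing by (p-1)!
leaves every nonempty proper T exactly once. These are the mixed terms of (x+y)^{⊗p}. -/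
theorem normMap_mixedPower (hR : IsUnit ((p - 1).factorial : R)) (x y : M) :
    normMap R p M (mixedPower R p x y) = divPow p (x + y) - divPow p x - divPow p y := by
  apply Subtype.ext
  let t : Finset (Fin p) → Ten R p M := fun S =>
    PiTensorProduct.tprod R (S.piecewise (fun _ => x) fun _ => y)
  have h1 : (normMap R p M (mixedPower R p x y)).1 = Ring.inverse ((p - 1).factorial : R) •
      ∑ S ∈ properSets p, Ring.inverse (S.card : R) •
        ∑ e : Equiv.Perm (Fin p), t (Finset.univ.filter fun k => e k ∈ S) := by
    simp only [mixedPower, map_smul, map_sum, Submodule.coe_smul, Submodule.coe_sum, normMap_tprod]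
    congr 1
    refine Finset.sum_congr rfl fun S _ => ?_
    congr 1
    refine Finset.sum_congr rfl fun e _ => ?_
    congr 1
    funext k
    simp [Finset.piecewise]
  have h2 : ∑ S ∈ properSets p, Ring.inverse (S.card : R) •
        ∑ e : Equiv.Perm (Fin p), t (Finset.univ.filter fun k => e k ∈ S) =
      ∑ e : Equiv.Perm (Fin p), ∑ T with e 0 ∈ T ∧ T ≠ Finset.univ,
        Ring.inverse (T.card : R) • t T := by
    simp only [Finset.smul_sum]
    rw [Finset.sum_comm]
    -- With T the preimage of S under e, the condition 0 ∈ S becomes e⁻¹ 0 ∈ T, and |T| = |S|.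
    refine Fintype.sum_equiv (Equiv.inv _) _ _ fun e => ?_
    refine Finset.sum_nbij' (fun S => Finset.univ.filter fun k => e k ∈ S)
      (fun T => Finset.univ.filter fun k => e⁻¹ k ∈ T) ?_ ?_ ?_ ?_ ?_
    · intro S hS
      simp only [properSets, Finset.mem_filter, Finset.mem_univ, true_and,
        ne_univ_iff_exists_notMem] at hS ⊢
      refine ⟨by simpa using hS.1, ?_⟩
      obtain ⟨k, hk⟩ := hS.2
      exact ⟨e⁻¹ k, by simpa using hk⟩
    · intro T hT
      simp only [properSets, Finset.mem_filter, Finset.mem_univ, true_and,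
        ne_univ_iff_exists_notMem] at hT ⊢
      refine ⟨by simpa using hT.1, ?_⟩
      obtain ⟨k, hk⟩ := hT.2
      exact ⟨e k, by simpa using hk⟩
    · intro S _
      ext k
      simp
    · intro T _
      ext k
      simp
    · intro S _
      congr 3
      exact Finset.card_bijective e.symm e.symm.bijective (by simp)
  have h3 : ∑ e : Equiv.Perm (Fin p), ∑ T with e 0 ∈ T ∧ T ≠ Finset.univ,
        Ring.inverse (T.card : R) • t T =
      ((p - 1).factorial : R) • ∑ T with T ≠ ∅ ∧ T ≠ Finset.univ, t T := by
    simp only [Finset.sum_filter, Finset.smul_sum]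
    rw [Finset.sum_comm]
    refine Finset.sum_congr rfl fun T _ => ?_
    by_cases hT : T = Finset.univ
    · simp [hT]
    · simp only [hT, ne_eq, not_false_eq_true, and_true]
      rw [← Finset.sum_filter, Finset.sum_const, card_perm_apply_mem]
      by_cases hT0 : T = ∅
      · simp [hT0]
      · have hlt : T.card < p := by
          obtain ⟨k, hk⟩ := (ne_univ_iff_exists_notMem T).1 hT
          simpa using Finset.card_lt_univ_of_notMem hk
        have hu := isUnit_natCast hR
          (Finset.card_ne_zero.2 (Finset.nonempty_iff_ne_empty.2 hT0)) hlt
        rw [if_pos hT0, ← Nat.cast_smul_eq_nsmul R, smul_smul, Nat.cast_mul, mul_right_comm,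
          Ring.mul_inverse_cancel _ hu, one_mul]
  have h4 : PiTensorProduct.tprod R (fun _ : Fin p => x + y) =
      PiTensorProduct.tprod R (fun _ : Fin p => x) + PiTensorProduct.tprod R (fun _ : Fin p => y) +
        ∑ T with T ≠ ∅ ∧ T ≠ Finset.univ, t T := by
    have h5 := (PiTensorProduct.tprod R).map_add_univ (fun _ : Fin p => x) fun _ => y
    refine h5.trans ?_
    have hne : (∅ : Finset (Fin p)) ≠ Finset.univ := Finset.univ_nonempty.ne_empty.symm
    rw [← Finset.sum_filter_add_sum_filter_not Finset.univ
      (fun T : Finset (Fin p) => T ≠ ∅ ∧ T ≠ Finset.univ), add_comm]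
    congr 1
    have h6 : (Finset.univ.filter fun T : Finset (Fin p) => ¬(T ≠ ∅ ∧ T ≠ Finset.univ)) =
        {Finset.univ, ∅} := by
      ext T
      simp only [Finset.mem_filter, Finset.mem_univ, true_and, Finset.mem_insert,
        Finset.mem_singleton]
      tauto
    rw [h6, Finset.sum_pair hne.symm, Finset.piecewise_univ, Finset.piecewise_empty]
  rw [h1, h2, h3, smul_smul, Ring.inverse_mul_cancel _ hR, one_smul]
  change _ = PiTensorProduct.tprod R (fun _ : Fin p => x + y) -
    PiTensorProduct.tprod R (fun _ : Fin p => x) - PiTensorProduct.tprod R (fun _ : Fin p => y)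
  rw [h4]
  abel

theorem symMul_mixedPower {B : Type w} [CommRing B] [Algebra R B] (f : M →ₗ[R] B) (x y : M) :
    symMul p f (mixedPower R p x y) = Ring.inverse ((p - 1).factorial : R) •
      ∑ S ∈ properSets p, Ring.inverse (S.card : R) • (f x ^ S.card * f y ^ (p - S.card)) := by
  simp only [mixedPower, map_smul, map_sum, symMul_tprod]
  congr 1
  refine Finset.sum_congr rfl fun S _ => ?_
  congr 1
  have h : ∀ k, f (S.piecewise (fun _ => x) (fun _ => y) k) = if k ∈ S then f x else f y := by
    intro k
    by_cases hk : k ∈ S <;> simp [hk]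
  simp only [h, Finset.prod_ite, Finset.prod_const]
  congr 2
  · simp
  · rw [Finset.filter_not]
    simp [Finset.card_sdiff]

theorem properSets_card_pos {S : Finset (Fin p)} (hS : S ∈ properSets p) : S.card ≠ 0 :=
  Finset.card_ne_zero.2 ⟨0, (Finset.mem_filter.1 hS).2.1⟩

theorem properSets_card_lt {S : Finset (Fin p)} (hS : S ∈ properSets p) : S.card < p := by
  obtain ⟨k, hk⟩ := (ne_univ_iff_exists_notMem S).1 (Finset.mem_filter.1 hS).2.2
  simpa using Finset.card_lt_univ_of_notMem hk

theorem symMul_mixedPower_eq_zero {B : Type w} [CommRing B] [Algebra R B] (f : M →ₗ[R] B)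
    (x y : M) (h : f x = 0 ∨ f y = 0) : symMul p f (mixedPower R p x y) = 0 := by
  rw [symMul_mixedPower, Finset.sum_eq_zero, smul_zero]
  intro S hS
  rcases h with h | h
  · rw [h, zero_pow (properSets_card_pos hS), zero_mul, smul_zero]
  · rw [h, zero_pow (Nat.sub_ne_zero_of_lt (properSets_card_lt hS)), mul_zero, smul_zero]

end MixedPower

/-! ### The cocycle representing γ(1) and its uniqueness -/

section Tate

variable {R : Type} [CommRing R] {p i : ℕ}

theorem module_d_d_apply {κ : Type} {c : ComplexShape κ} (C : HomologicalComplex (ModuleCat.{v} R) c)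
    (i j k : κ) (a : C.X i) : C.d j k (C.d i j a) = 0 := by
  rw [← ConcreteCategory.comp_apply, HomologicalComplex.d_comp_d]; rfl

theorem module_hom_d_apply {κ : Type} {c : ComplexShape κ}
    {C D : HomologicalComplex (ModuleCat.{v} R) c} (f : C ⟶ D) (i j : κ) (a : C.X i) :
    D.d i j (f.f i a) = f.f j (C.d i j a) := by
  rw [← ConcreteCategory.comp_apply, ← ConcreteCategory.comp_apply, HomologicalComplex.Hom.comm]

theorem σ_comp_σ_surjective (a : Fin (i + 1)) :
    Function.Surjective (SimplexCategory.σ a.castSucc ≫ SimplexCategory.σ a).toOrderHom :=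
  SimplexCategory.epi_iff_surjective.1 inferInstance

/-- The surjection `[i + 2] → [i]` which identifies `a`, `a + 1` and `a + 2`. -/
def surjTriple (a : Fin (i + 1)) : Surj ⦋i + 2⦌ i :=
  ⟨SimplexCategory.σ a.castSucc ≫ SimplexCategory.σ a, σ_comp_σ_surjective a⟩

theorem val_predAbove {n : ℕ} (a : Fin n) (m : Fin (n + 1)) :
    (a.predAbove m : ℕ) = if (m : ℕ) ≤ a then (m : ℕ) else m - 1 := by
  rcases le_or_gt m a.castSucc with h | h
  · rw [Fin.predAbove_of_le_castSucc _ _ h, if_pos (by exact_mod_cast h)]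
    rfl
  · rw [Fin.predAbove_of_castSucc_lt _ _ h, if_neg (by
      have h' : (a : ℕ) < m := h
      omega)]
    rfl

theorem surjTriple_apply (a : Fin (i + 1)) (m : Fin (i + 3)) :
    (((surjTriple a).1.toOrderHom m : Fin (i + 1)) : ℕ) =
      if (m : ℕ) ≤ a then (m : ℕ) else if (m : ℕ) ≤ a + 2 then a else m - 2 := by
  change (a.predAbove (a.castSucc.predAbove m) : ℕ) = _
  rw [val_predAbove, val_predAbove, Fin.val_castSucc]
  split_ifs <;> omega

/-- If the composite stays surjective, the omitted point l shares its fibre with another point, and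
{a, a+1, a+2} is the only fibre with more than one element. -/
theorem mem_of_surjective_δ_surjTriple (a : Fin (i + 1)) (l : Fin (i + 3))
    (h : Function.Surjective (SimplexCategory.δ l ≫ (surjTriple a).1).toOrderHom) :
    l = a.castSucc.castSucc ∨ l = a.castSucc.succ ∨ l = a.succ.succ := by
  obtain ⟨x, hx⟩ := h ((surjTriple a).1.toOrderHom l)
  have h1 : (((surjTriple a).1.toOrderHom (l.succAbove x) : Fin (i + 1)) : ℕ) =
    ((surjTriple a).1.toOrderHom l : Fin (i + 1)) := congrArg Fin.val hx
  have h2 : ((l.succAbove x : Fin (i + 3)) : ℕ) ≠ l := fun h => Fin.succAbove_ne l x (Fin.ext h)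
  rw [surjTriple_apply, surjTriple_apply] at h1
  simp only [Fin.ext_iff, Fin.val_castSucc, Fin.val_succ]
  split_ifs at h1 <;> omega

theorem δ_surjTriple (a : Fin (i + 1)) (l : Fin (i + 3))
    (h : l = a.castSucc.castSucc ∨ l = a.castSucc.succ ∨ l = a.succ.succ) :
    SimplexCategory.δ l ≫ (surjTriple a).1 = SimplexCategory.σ a := by
  rcases h with rfl | rfl | rfl
  · exact SimplexCategory.δ_comp_σ_self_assoc _
  · exact SimplexCategory.δ_comp_σ_succ_assoc _
  · change SimplexCategory.δ a.succ.succ ≫ SimplexCategory.σ a.castSucc ≫ SimplexCategory.σ a = _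
    rw [SimplexCategory.σ_comp_σ le_rfl]
    exact SimplexCategory.δ_comp_σ_succ_assoc _

theorem symMul_symMap {M N : Type} [AddCommGroup M] [Module R M] [AddCommGroup N] [Module R N]
    {B : Type w} [CommRing B] [Algebra R B] (f : M →ₗ[R] N) (g : N →ₗ[R] B) (s : Sym R p M) :
    symMul p g (symMap p f s) = symMul p (g ∘ₗ f) s := by
  have h : symMul p g ∘ₗ symMap p f = symMul p (g ∘ₗ f) := by
    apply sym_ext
    intro x
    simp [symMap_tprod, symMul_tprod]
  exact LinearMap.congr_fun h s

/-- The value of the functional `x₁ ⋯ x_p ↦ x₁(σ) ⋯ x_p(σ)` on a symmetric power. -/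
abbrev diagCoeff (R : Type) [CommRing R] (p : ℕ) {J : Type} (σ : J) : Sym R p (J → R) →ₗ[R] R :=
  symMul p (LinearMap.proj σ : (J → R) →ₗ[R] R)

theorem symCochains_d_apply (n : ℕ) (s : Sym R p (Surj ⦋n⦌ i → R)) :
    (show Sym R p (Surj ⦋n + 1⦌ i → R) from (symCochains R p i).d n (n + 1) s) =
      ∑ l : Fin (n + 2), (-1 : ℤ) ^ (l : ℕ) • symMap p (dkMap R i (SimplexCategory.δ l)) s :=
  module_d_apply (((CosimplicialObject.whiskering _ _).obj (symFunctor R p)).obj (dk R i)) n s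

theorem divCochains_d_apply (n : ℕ) (s : Div R p (Surj ⦋n⦌ i → R)) :
    (show Div R p (Surj ⦋n + 1⦌ i → R) from (divCochains R p i).d n (n + 1) s) =
      ∑ l : Fin (n + 2), (-1 : ℤ) ^ (l : ℕ) • divMap p (dkMap R i (SimplexCategory.δ l)) s :=
  module_d_apply (((CosimplicialObject.whiskering _ _).obj (divFunctor R p)).obj (dk R i)) n s

theorem divMap_divPow {M N : Type} [AddCommGroup M] [Module R M] [AddCommGroup N] [Module R N]
    (f : M →ₗ[R] N) (m : M) : divMap p f (divPow p m) = divPow p (f m) := by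
  apply Subtype.ext
  exact PiTensorProduct.map_tprod _ _

theorem proj_comp_dkMap_of_surjective {n m : SimplexCategory} (θ : n ⟶ m) (τ : Surj m i)
    (σ : Surj n i) (h : θ ≫ τ.1 = σ.1) :
    (LinearMap.proj τ : (Surj m i → R) →ₗ[R] R) ∘ₗ dkMap R i θ = LinearMap.proj σ := by
  refine LinearMap.ext fun f => ?_
  have hs : Function.Surjective (θ ≫ τ.1).toOrderHom := by
    rw [h]
    exact σ.2
  refine (dkMap_apply θ f τ).trans ((dif_pos hs).trans ?_)
  exact congrArg f (Subtype.ext h)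

theorem proj_comp_dkMap_of_not_surjective {n m : SimplexCategory} (θ : n ⟶ m) (τ : Surj m i)
    (h : ¬ Function.Surjective (θ ≫ τ.1).toOrderHom) :
    (LinearMap.proj τ : (Surj m i → R) →ₗ[R] R) ∘ₗ dkMap R i θ = 0 :=
  LinearMap.ext fun f => (dkMap_apply θ f τ).trans (dif_neg h)

theorem symMul_zero [NeZero p] {M : Type} [AddCommGroup M] [Module R M] {B : Type w} [CommRing B]
    [Algebra R B] (s : Sym R p M) : symMul p (0 : M →ₗ[R] B) s = 0 := by
  have h : symMul p (0 : M →ₗ[R] B) = 0 := by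
    apply sym_ext
    intro x
    rw [symMul_tprod]
    simp [NeZero.ne p]
  rw [h]
  rfl

/-- Only the faces l = a, a+1, a+2 contribute, each giving the coefficient at σ^a; the three signs
add up to (-1)^a. Thus the pure-power coefficients of s are recovered from ds, and a cocycle has
none. -/
theorem diagCoeff_surjTriple_d [NeZero p] (a : Fin (i + 1)) (s : Sym R p (Surj ⦋i + 1⦌ i → R)) :
    diagCoeff R p (surjTriple a)
      (show Sym R p (Surj ⦋i + 2⦌ i → R) from (symCochains R p i).d (i + 1) (i + 2) s) =
      (-1 : ℤ) ^ (a : ℕ) • diagCoeff R p (surjσ i a) s := by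
  classical
  rw [symCochains_d_apply, map_sum]
  simp only [map_zsmul, symMul_symMap]
  have h1 : ∀ l : Fin (i + 3), symMul p ((LinearMap.proj (surjTriple a)) ∘ₗ
      dkMap R i (SimplexCategory.δ l)) s =
      if l ∈ ({a.castSucc.castSucc, a.castSucc.succ, a.succ.succ} : Finset (Fin (i + 3))) then
        diagCoeff R p (surjσ i a) s else 0 := by
    intro l
    simp only [Finset.mem_insert, Finset.mem_singleton]
    split_ifs with h
    · rw [proj_comp_dkMap_of_surjective _ _ (surjσ i a) (δ_surjTriple a l h)]
    · rw [proj_comp_dkMap_of_not_surjective _ _ fun h' => h (mem_of_surjective_δ_surjTriple a l h'),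
        symMul_zero]
  simp only [h1, smul_ite, smul_zero]
  rw [Finset.sum_ite_mem, Finset.univ_inter, Finset.sum_insert, Finset.sum_insert,
    Finset.sum_singleton]
  · simp only [Fin.val_castSucc, Fin.val_succ, pow_succ]
    simp
  · simp [Fin.ext_iff]
  · simp only [Finset.mem_insert, Finset.mem_singleton, Fin.ext_iff, Fin.val_castSucc,
      Fin.val_succ]
    omega

theorem sym_eq_zero_of_cocycle [NeZero p] (hR : IsUnit ((p - 1).factorial : R))
    (k : (symCochains R p i).X (i + 1)) (hN : (normCochains R p i).f (i + 1) k = 0)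
    (hd : (symCochains R p i).d (i + 1) (i + 2) k = 0) : k = 0 := by
  classical
  have := Fintype.ofFinite (Surj ⦋i + 1⦌ i)
  refine sym_eq_zero_of_normMap_eq_zero hR (k : Sym R p (Surj ⦋i + 1⦌ i → R)) hN fun σ => ?_
  obtain ⟨a, rfl⟩ := exists_eq_surjσ i σ
  have h := diagCoeff_surjTriple_d (R := R) (p := p) a k
  rw [hd] at h
  have h2 : (-1 : ℤ) ^ (a : ℕ) • diagCoeff R p (surjσ i a) k = 0 := h.symm.trans (map_zero _)
  rcases neg_one_pow_eq_or ℤ (a : ℕ) with h' | h' <;> rw [h'] at h2 <;> simpa using h2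

/-- For a family `e₀, …, e_i`, the `j`-th member of `0, e₀, …, e_i`. -/
def padLeft {N : Type*} [Zero N] (e : Fin (i + 1) → N) (j : Fin (i + 2)) : N :=
  Fin.cases 0 e j

/-- For a family `e₀, …, e_i`, the `j`-th member of `e₀, …, e_i, 0`. -/
def padRight {N : Type*} [Zero N] (e : Fin (i + 1) → N) (j : Fin (i + 2)) : N :=
  Fin.lastCases 0 e j

theorem map_padLeft {N N' : Type*} [Zero N] [Zero N'] (F : N → N') (hF : F 0 = 0)
    (e : Fin (i + 1) → N) (j : Fin (i + 2)) : F (padLeft e j) = padLeft (F ∘ e) j := by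
  cases j using Fin.cases with
  | zero => exact hF
  | succ j => rfl

theorem map_padRight {N N' : Type*} [Zero N] [Zero N'] (F : N → N') (hF : F 0 = 0)
    (e : Fin (i + 1) → N) (j : Fin (i + 2)) : F (padRight e j) = padRight (F ∘ e) j := by
  cases j using Fin.lastCases with
  | last => simpa [padRight] using hF
  | cast j => simp [padRight]

theorem sum_padLeft_add_padRight {N : Type*} [AddCommGroup N] (e : Fin (i + 1) → N) :
    ∑ j : Fin (i + 2), (-1 : ℤ) ^ (j : ℕ) • (padLeft e j + padRight e j) = 0 := by
  simp only [smul_add, Finset.sum_add_distrib]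
  rw [Fin.sum_univ_succ, Fin.sum_univ_castSucc (n := i + 1) (fun j => _ • padRight e j)]
  simp only [padLeft, padRight, Fin.cases_zero, Fin.cases_succ, Fin.lastCases_last,
    Fin.lastCases_castSucc, smul_zero, zero_add, add_zero, ← Finset.sum_add_distrib]
  refine Finset.sum_eq_zero fun a _ => ?_
  simp [pow_succ]

/-- The basis of `R[-i]^{i+1}` consisting of the functions supported at one surjection. -/
def dkBasis (R : Type) [CommRing R] (i : ℕ) (a : Fin (i + 1)) : Surj ⦋i + 1⦌ i → R :=
  fun σ => open Classical in if σ = surjσ i a then 1 else 0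

theorem dkBasis_surjσ (a b : Fin (i + 1)) : dkBasis R i a (surjσ i b) = if b = a then 1 else 0 := by
  simp only [dkBasis, (surjσ_injective i).eq_iff]

theorem padLeft_dkBasis_apply (j : Fin (i + 2)) (a : Fin (i + 1)) :
    padLeft (dkBasis R i) j (surjσ i a) = if j = a.succ then 1 else 0 := by
  cases j using Fin.cases with
  | zero => simp [padLeft, (Fin.succ_ne_zero a).symm]
  | succ j => simp [padLeft, dkBasis_surjσ, eq_comm]

theorem padRight_dkBasis_apply (j : Fin (i + 2)) (a : Fin (i + 1)) :
    padRight (dkBasis R i) j (surjσ i a) = if j = a.castSucc then 1 else 0 := by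
  cases j using Fin.lastCases with
  | last => simp [padRight, (Fin.castSucc_lt_last a).ne']
  | cast j => simp [padRight, dkBasis_surjσ, eq_comm]

theorem dkMap_δ_dkGen_eq (j : Fin (i + 2)) :
    dkMap R i (SimplexCategory.δ j) (dkGen R i) =
      padLeft (dkBasis R i) j + padRight (dkBasis R i) j := by
  funext σ
  obtain ⟨a, rfl⟩ := exists_eq_surjσ i σ
  rw [dkMap_δ_dkGen', Pi.add_apply, padLeft_dkBasis_apply, padRight_dkBasis_apply, add_comm]

/-- The explicit cocycle representing `γ(1)`. -/
def tateCocycle (R : Type) [CommRing R] (p i : ℕ) [NeZero p] : Sym R p (Surj ⦋i + 1⦌ i → R) :=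
  -∑ j : Fin (i + 2), (-1 : ℤ) ^ (j : ℕ) •
    mixedPower R p (padLeft (dkBasis R i) j) (padRight (dkBasis R i) j)

theorem divPow_zero [NeZero p] {M : Type v} [AddCommGroup M] [Module R M] :
    (divPow p (0 : M) : Div R p M) = 0 :=
  Subtype.ext ((PiTensorProduct.tprod R).map_coord_zero (0 : Fin p) rfl)

/-- Bookkeeping for `normMap_tateCocycle`: here x_j, y_j, z_j stand for the p-th tensor powers of
e_{j-1} + e_j, e_{j-1} and e_j. -/
theorem neg_sum_sub_add_sum {N J : Type*} [AddCommGroup N] [Fintype J] (r : J → ℤ)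
    (x y z : J → N) (h : ∑ j, r j • (y j + z j) = 0) :
    -∑ j, r j • (x j - y j - z j) + ∑ j, r j • x j = 0 := by
  have h3 : ∀ j, r j • (x j - y j - z j) = r j • x j - r j • (y j + z j) := fun j => by
    rw [← smul_sub, sub_sub]
  rw [Finset.sum_congr rfl fun j _ => h3 j, Finset.sum_sub_distrib, h, sub_zero, neg_add_cancel]

theorem normMap_tateCocycle [NeZero p] (hR : IsUnit ((p - 1).factorial : R)) :
    (normCochains R p i).f (i + 1) (tateCocycle R p i) +
      (divCochains R p i).d i (i + 1) (divPow p (dkGen R i) : Div R p (Surj ⦋i⦌ i → R)) = 0 := by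
  have h1 : normMap R p (Surj ⦋i + 1⦌ i → R) (tateCocycle R p i) +
      ∑ l : Fin (i + 2), (-1 : ℤ) ^ (l : ℕ) •
        divMap p (dkMap R i (SimplexCategory.δ l)) (divPow p (dkGen R i)) = 0 := by
    simp only [tateCocycle, map_neg, map_sum, map_zsmul, normMap_mixedPower hR, divMap_divPow,
      dkMap_δ_dkGen_eq]
    have h2 := sum_padLeft_add_padRight
      ((divPow p : _ → Div R p (Surj ⦋i + 1⦌ i → R)) ∘ dkBasis R i)
    simp only [map_padLeft _ divPow_zero, map_padRight _ divPow_zero]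
    exact neg_sum_sub_add_sum _ _ _ _ h2
  exact (congrArg _ (divCochains_d_apply i _)).trans h1

/-- The norm of ds is d(N s) = -d d(ι^{⊗p}) = 0. The pure-power coefficients of ds vanish too: no
σ^a lies in the support of both arguments of a mixed power, so each mixed monomial evaluates to 0
there. -/
theorem d_tateCocycle [NeZero p] (hR : IsUnit ((p - 1).factorial : R)) :
    (symCochains R p i).d (i + 1) (i + 2) (tateCocycle R p i) = 0 := by
  classical
  have := Fintype.ofFinite (Surj ⦋i + 2⦌ i)
  refine sym_eq_zero_of_normMap_eq_zero hR
    (show Sym R p (Surj ⦋i + 2⦌ i → R) from (symCochains R p i).d (i + 1) (i + 2)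
      (tateCocycle R p i)) ?_ fun τ => ?_
  · refine (module_hom_d_apply (normCochains R p i) (i + 1) (i + 2) _).symm.trans ?_
    refine (congrArg _ (eq_neg_of_add_eq_zero_left (normMap_tateCocycle hR))).trans ?_
    exact (map_neg _ _).trans (neg_eq_zero.2 (module_d_d_apply (divCochains R p i) _ _ _ _))
  · refine (congrArg _ (symCochains_d_apply _ _)).trans ?_
    rw [map_sum]
    refine Finset.sum_eq_zero fun l _ => ?_
    rw [map_zsmul, symMul_symMap, tateCocycle, map_neg, map_sum]
    rw [Finset.sum_eq_zero, neg_zero, smul_zero]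
    intro j _
    rw [map_zsmul, symMul_mixedPower_eq_zero, smul_zero]
    -- Evaluation at τ after the l-th coface is either evaluation at some σ^a or zero.
    by_cases h : Function.Surjective (SimplexCategory.δ l ≫ τ.1).toOrderHom
    · obtain ⟨a, ha⟩ := exists_eq_surjσ i ⟨_, h⟩
      rw [proj_comp_dkMap_of_surjective _ _ (surjσ i a) (congrArg Subtype.val ha),
        LinearMap.proj_apply, LinearMap.proj_apply, padLeft_dkBasis_apply, padRight_dkBasis_apply]
      by_cases hj : j = a.succ
      · right
        rw [if_neg]
        rintro rfl
        exact Fin.castSucc_lt_succ.ne hj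
      · left
        rw [if_neg hj]
    · left
      rw [proj_comp_dkMap_of_not_surjective _ _ h]
      rfl

/-- The explicit degree `i` cocycle of the Tate construction lifting `ι^{⊗p}`. -/
def tateGen [NeZero p] (hR : IsUnit ((p - 1).factorial : R)) : TateGen R p i where
  g := (divPow p (dkOne R i) : Div R p ((dk R i).obj (SimplexCategory.mk i)))
  s := tateCocycle R p i
  d_s := d_tateCocycle hR
  norm_s := normMap_tateCocycle hR
  gen := ⟨0, by rw [map_zero, add_zero]⟩

theorem sym_cocycle_ext [NeZero p] (hR : IsUnit ((p - 1).factorial : R))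
    {s s' : (symCochains R p i).X (i + 1)} (hs : (symCochains R p i).d (i + 1) (i + 2) s = 0)
    (hs' : (symCochains R p i).d (i + 1) (i + 2) s' = 0)
    (hN : (normCochains R p i).f (i + 1) s = (normCochains R p i).f (i + 1) s') : s = s' := by
  rw [← sub_eq_zero]
  refine sym_eq_zero_of_cocycle hR _ ?_ ?_
  · rw [map_sub, hN, sub_self]
  · rw [map_sub, hs, hs', sub_zero]

/-- Writing g = ι^{⊗p} + N h, the cocycles s + dh and `tateCocycle` both have norm -d(ι^{⊗p}), and
the norm is injective on cocycles of degree i+1. So the class of s does not depend on the choice of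
generator. -/
theorem TateGen.exists_eq_tateCocycle [NeZero p] (hR : IsUnit ((p - 1).factorial : R))
    (t : TateGen R p i) : ∃ h : (symCochains R p i).X i,
      t.s + (symCochains R p i).d i (i + 1) h = tateCocycle R p i := by
  obtain ⟨h, hg⟩ := t.gen
  refine ⟨h, sym_cocycle_ext hR ?_ (d_tateCocycle hR) ?_⟩
  · rw [map_add, t.d_s, module_d_d_apply, zero_add]
  · have h1 := t.norm_s
    rw [hg, map_add, module_hom_d_apply] at h1
    rw [map_add, eq_neg_of_add_eq_zero_left h1]
    refine Eq.trans ?_ (eq_neg_of_add_eq_zero_left (normMap_tateCocycle hR)).symm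
    rw [neg_add, neg_add_cancel_right]
    rfl

end Tate

/-! ## Teichmüller representatives in Witt vectors of length two -/

section WittSums

set_option linter.unusedSectionVars false

variable (p : ℕ) [hp : Fact p.Prime]

/-- The polynomial `((x + y)^p - x^p - y^p) / p`. -/
def mixedPoly {S : Type*} [CommRing S] (x y : S) : S :=
  ∑ k ∈ Finset.Ico 1 p, ((p.choose k / p : ℕ) : S) * (x ^ k * y ^ (p - k))

variable {p}

theorem natCast_choose_div {S : Type*} [CommRing S] {k : ℕ} (hk : k ∈ Finset.Ico 1 p) :
    (p : S) * ((p.choose k / p : ℕ) : S) = (p.choose k : S) := by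
  rw [Finset.mem_Ico] at hk
  rw [← Nat.cast_mul, Nat.mul_div_cancel' (hp.out.dvd_choose_self (by omega) hk.2)]

theorem mul_mixedPoly {S : Type*} [CommRing S] (x y : S) :
    (p : S) * mixedPoly p x y = (x + y) ^ p - x ^ p - y ^ p := by
  have h0 := hp.out.pos
  rw [add_pow, Finset.sum_range_succ, Finset.range_eq_Ico, Finset.sum_eq_sum_Ico_succ_bot h0,
    mixedPoly, Finset.mul_sum]
  simp only [pow_zero, Nat.sub_zero, Nat.choose_zero_right, Nat.cast_one, Nat.sub_self,
    Nat.choose_self, one_mul, mul_one, zero_add]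
  rw [Finset.sum_congr rfl fun k hk => by
    rw [← mul_assoc, natCast_choose_div hk, mul_comm (p.choose k : S)]]
  ring

theorem map_mixedPoly {S T : Type*} [CommRing S] [CommRing T] (f : S →+* T) (x y : S) :
    f (mixedPoly p x y) = mixedPoly p (f x) (f y) := by
  simp [mixedPoly, map_sum]

theorem card_properSets_filter {k : ℕ} (hk : k ∈ Finset.Ico 1 p) :
    ((properSets p).filter fun S => S.card = k).card = (p - 1).choose (k - 1) := by
  rw [Finset.mem_Ico] at hk
  have h : (Finset.univ.erase (0 : Fin p)).card = p - 1 := by simp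
  rw [← h, ← Finset.card_powersetCard]
  refine Finset.card_nbij' (fun S => S.erase 0) (fun S => insert 0 S) ?_ ?_ ?_ ?_
  · intro S hS
    simp only [properSets, Finset.coe_filter, Finset.mem_filter, Finset.mem_univ, true_and,
      Set.mem_ofPred_eq] at hS
    simp only [Finset.mem_coe, Finset.mem_powersetCard]
    exact ⟨Finset.erase_subset_erase 0 (Finset.subset_univ S),
      by rw [Finset.card_erase_of_mem hS.1.1, hS.2]⟩
  · intro S hS
    simp only [Finset.mem_coe, Finset.mem_powersetCard] at hS
    have h0 : (0 : Fin p) ∉ S := fun h => by simpa using hS.1 h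
    simp only [properSets, Finset.coe_filter, Finset.mem_filter, Finset.mem_univ, true_and,
      Set.mem_ofPred_eq, Finset.mem_insert_self, Finset.card_insert_of_notMem h0]
    refine ⟨fun h => ?_, by omega⟩
    have h' := congrArg Finset.card h
    rw [Finset.card_insert_of_notMem h0, Finset.card_univ, Fintype.card_fin] at h'
    omega
  · intro S hS
    simp only [properSets, Finset.coe_filter, Finset.mem_filter, Finset.mem_univ, true_and,
      Set.mem_ofPred_eq] at hS
    exact Finset.insert_erase hS.1.1
  · intro S hS
    simp only [Finset.mem_coe, Finset.mem_powersetCard] at hS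
    exact Finset.erase_insert fun h => by simpa using hS.1 h

/-- There are C(p-1, k-1) = k·C(p, k)/p subsets of size k containing 0, and the factor k cancels the
weight 1/k. -/
theorem sum_properSets {R : Type} [CommRing R] (hR : IsUnit ((p - 1).factorial : R)) {B : Type w}
    [CommRing B] [Algebra R B] (x y : B) :
    ∑ S ∈ properSets p, Ring.inverse (S.card : R) • (x ^ S.card * y ^ (p - S.card)) =
      mixedPoly p x y := by
  rw [mixedPoly, ← Finset.sum_fiberwise_of_maps_to (t := Finset.Ico 1 p)
    (g := fun S : Finset (Fin p) => S.card)]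
  · refine Finset.sum_congr rfl fun k hk => ?_
    rw [Finset.sum_congr rfl (g := fun _ => Ring.inverse (k : R) • (x ^ k * y ^ (p - k)))
      (fun S hS => by rw [(Finset.mem_filter.1 hS).2]), Finset.sum_const,
      card_properSets_filter hk]
    have hk' := Finset.mem_Ico.1 hk
    have hu := isUnit_natCast hR (by omega : k ≠ 0) hk'.2
    have h1 : (p - 1).choose (k - 1) = k * (p.choose k / p) := by
      refine Nat.eq_of_mul_eq_mul_left hp.out.pos ?_
      have h2 := Nat.add_one_mul_choose_eq (p - 1) (k - 1)
      rw [Nat.sub_add_cancel hp.out.pos,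
        Nat.sub_add_cancel hk'.1] at h2
      rw [h2, mul_left_comm, Nat.mul_div_cancel' (hp.out.dvd_choose_self (by omega) hk'.2),
        mul_comm]
    rw [h1, ← Nat.cast_smul_eq_nsmul R, smul_smul, Nat.cast_mul, mul_right_comm,
      Ring.mul_inverse_cancel _ hu, one_mul, Nat.cast_smul_eq_nsmul, nsmul_eq_mul]
  · intro S hS
    have := properSets_card_pos hS
    have := properSets_card_lt hS
    rw [Finset.mem_Ico]
    omega

variable (p)

/-- The Teichmüller representative in `W₂(S)`. -/
def teich {S : Type v} [CommRing S] (a : S) : TruncatedWittVector p 2 S :=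
  TruncatedWittVector.mk p ![a, 0]

theorem teich_eq_truncate {S : Type v} [CommRing S] (a : S) :
    teich p a = WittVector.truncate 2 (WittVector.teichmuller p a) := by
  ext k
  fin_cases k
  · simp [teich]
  · simp [teich, WittVector.teichmuller_coeff_pos]

theorem wittFun_teich {S T : Type v} [CommRing S] [CommRing T] (f : S →+* T) (a : S) :
    wittFun p f (teich p a) = teich p (f a) := by
  ext k
  fin_cases k <;> simp [teich, wittFun]

theorem wittFun_wittV {S T : Type v} [CommRing S] [CommRing T] (f : S →+* T) (a : S) :
    wittFun p f (wittV p S a) = wittV p T (f a) := by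
  change wittFun p f (TruncatedWittVector.mk p ![0, a]) = TruncatedWittVector.mk p ![0, f a]
  ext k
  fin_cases k <;> simp [wittFun]

theorem teich_zero {S : Type v} [CommRing S] : teich p (0 : S) = 0 := by
  rw [teich_eq_truncate, WittVector.teichmuller_zero, map_zero]

/-- The ghost component `(a₀, a₁) ↦ a₀^p + p a₁` on `W₂(S)`. -/
def wittGhost (S : Type v) [CommRing S] : TruncatedWittVector p 2 S →+* S :=
  have key (x : WittVector p S) : (WittVector.truncate 2 x).coeff 0 ^ p +
      p * (WittVector.truncate 2 x).coeff 1 = WittVector.ghostComponent 1 x := by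
    rw [WittVector.coeff_truncate, WittVector.coeff_truncate, WittVector.ghostComponent_apply,
      wittPolynomial_one]
    simp [add_comm]
  { toFun := fun x => x.coeff 0 ^ p + p * x.coeff 1
    map_one' := by
      rw [← map_one (WittVector.truncate (p := p) (R := S) 2), key, map_one]
    map_zero' := by
      rw [← map_zero (WittVector.truncate (p := p) (R := S) 2), key, map_zero]
    map_add' := fun x y => by
      obtain ⟨x, rfl⟩ := WittVector.truncate_surjective p 2 S x
      obtain ⟨y, rfl⟩ := WittVector.truncate_surjective p 2 S y
      rw [← map_add, key, key, key, map_add]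
    map_mul' := fun x y => by
      obtain ⟨x, rfl⟩ := WittVector.truncate_surjective p 2 S x
      obtain ⟨y, rfl⟩ := WittVector.truncate_surjective p 2 S y
      rw [← map_mul, key, key, key, map_mul] }

theorem wittGhost_apply {S : Type v} [CommRing S] (x : TruncatedWittVector p 2 S) :
    wittGhost p S x = x.coeff 0 ^ p + p * x.coeff 1 := rfl

theorem wittGhost_teich {S : Type v} [CommRing S] (a : S) : wittGhost p S (teich p a) = a ^ p := by
  simp [wittGhost_apply, teich]

theorem wittGhost_wittV {S : Type v} [CommRing S] (a : S) :
    wittGhost p S (wittV p S a) = p * a := by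
  change (TruncatedWittVector.mk p ![0, a]).coeff 0 ^ p +
    p * (TruncatedWittVector.mk p ![0, a]).coeff 1 = p * a
  simp [hp.out.ne_zero]

theorem wittProj_teich {S : Type v} [CommRing S] (a : S) : wittProj p S (teich p a) = a := by
  change (TruncatedWittVector.mk p ![a, 0]).coeff 0 = a
  simp

theorem wittProj_wittV {S : Type v} [CommRing S] (a : S) : wittProj p S (wittV p S a) = 0 := by
  change (TruncatedWittVector.mk p ![0, a]).coeff 0 = 0
  simp

/-- Without p-torsion, the zeroth coordinate and the ghost component determine a_1, since they
determine p·a_1. -/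
theorem witt_ext {S : Type v} [CommRing S] (hS : ∀ a : S, (p : S) * a = 0 → a = 0)
    {x y : TruncatedWittVector p 2 S} (h0 : wittProj p S x = wittProj p S y)
    (h1 : wittGhost p S x = wittGhost p S y) : x = y := by
  have h0' : x.coeff 0 = y.coeff 0 := h0
  rw [wittGhost_apply, wittGhost_apply, h0', add_right_inj, ← sub_eq_zero, ← mul_sub] at h1
  ext k
  fin_cases k
  · exact h0'
  · exact sub_eq_zero.1 (hS _ h1)

/-- By functoriality it suffices to treat the universal case ℤ[X, Y]. That ring is p-torsion free,
so the identity can be checked on the zeroth coordinate and the ghost component. -/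
theorem teich_add {S : Type v} [CommRing S] (x y : S) :
    teich p (x + y) = teich p x + teich p y + wittV p S (mixedPoly p x y) := by
  let P := ULift.{v} (MvPolynomial (Fin 2) ℤ)
  have hP : ∀ a : P, (p : P) * a = 0 → a = 0 := by
    intro a ha
    have h1 : (p : MvPolynomial (Fin 2) ℤ) * a.down = 0 := congrArg ULift.down ha
    have h2 : (p : MvPolynomial (Fin 2) ℤ) ≠ 0 := Nat.cast_ne_zero.2 hp.out.ne_zero
    exact ULift.ext _ _ ((mul_eq_zero.1 h1).resolve_left h2)
  let X : P := ULift.up (MvPolynomial.X 0)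
  let Y : P := ULift.up (MvPolynomial.X 1)
  have hXY : teich p (X + Y) = teich p X + teich p Y + wittV p P (mixedPoly p X Y) := by
    apply witt_ext p hP
    · simp only [map_add, wittProj_teich, wittProj_wittV, add_zero]
    · simp only [map_add, wittGhost_teich, wittGhost_wittV, mul_mixedPoly]
      ring
  let f : P →+* S := (MvPolynomial.aeval (R := ℤ) ![x, y]).toRingHom.comp
    (ULift.ringEquiv (R := MvPolynomial (Fin 2) ℤ)).toRingHom
  have hX : f X = x := by
    change MvPolynomial.aeval ![x, y] (MvPolynomial.X (R := ℤ) 0) = x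
    simp
  have hY : f Y = y := by
    change MvPolynomial.aeval ![x, y] (MvPolynomial.X (R := ℤ) 1) = y
    simp
  have h := congrArg (wittMap p f) hXY
  rw [map_add, map_add] at h
  change wittFun p f _ = wittFun p f _ + wittFun p f _ + wittFun p f _ at h
  rw [wittFun_teich, wittFun_teich, wittFun_teich, wittFun_wittV, map_mixedPoly, map_add, hX,
    hY] at h
  exact h

end WittSums

/-! ## The operations `P⁰` and `P¹` -/

section Main

variable {R : Type} [CommRing R] {p i : ℕ}

theorem symMul_comp {M : Type v} [AddCommGroup M] [Module R M] {B C : Type w} [CommRing B]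
    [Algebra R B] [CommRing C] [Algebra R C] (f : M →ₗ[R] B) (g : B →ₐ[R] C) (s : Sym R p M) :
    symMul p (g.toLinearMap ∘ₗ f) s = g (symMul p f s) := by
  have h : symMul p (g.toLinearMap ∘ₗ f) = g.toLinearMap ∘ₗ symMul p f := by
    apply sym_ext
    intro x
    simp [symMul_tprod]
  exact LinearMap.congr_fun h s

theorem algebra_d_apply (A : CosimplicialObject (CommAlgCat.{v} R)) (n : ℕ) (a : A.obj ⦋n⦌) :
    (show A.obj ⦋n + 1⦌ from (cochains (addOf (ringOf A))).d n (n + 1) a) =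
      ∑ k : Fin (n + 2), (-1 : ℤ) ^ (k : ℕ) • (A.δ k).hom a :=
  cochains_d_apply (addOf (ringOf A)) n a

theorem ring_d_apply (A : CosimplicialObject CommRingCat.{v}) (n : ℕ) (a : A.obj ⦋n⦌) :
    (show A.obj ⦋n + 1⦌ from (cochains (addOf A)).d n (n + 1) a) =
      ∑ k : Fin (n + 2), (-1 : ℤ) ^ (k : ℕ) • (A.δ k).hom a :=
  cochains_d_apply (addOf A) n a

/-- The cofaces of A are algebra homomorphisms, so multiplication S^p A → A commutes with them; u
does so by `IsCosMap`. -/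
theorem d_symMul {A : CosimplicialObject (CommAlgCat.{v} R)}
    {u : ∀ n : SimplexCategory, (dk R i).obj n →ₗ[R] A.obj n} (hu : IsCosMap u) (n : ℕ)
    (s : (symCochains R p i).X n) :
    (cochains (addOf (ringOf A))).d n (n + 1) (symMul p (u ⦋n⦌) s) =
      symMul p (u ⦋n + 1⦌) ((symCochains R p i).d n (n + 1) s) := by
  refine (algebra_d_apply A n _).trans ?_
  refine Eq.trans ?_ (congrArg (symMul p (u ⦋n + 1⦌)) (symCochains_d_apply n s)).symm
  refine Eq.trans ?_ (map_sum (symMul p (u ⦋n + 1⦌)) _ _).symm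
  refine Finset.sum_congr rfl fun k _ => ?_
  refine Eq.trans ?_ (map_zsmul (symMul p (u ⦋n + 1⦌)) _ _).symm
  congr 1
  refine (symMul_comp _ _ _).symm.trans (Eq.trans ?_ (symMul_symMap _ _ _).symm)
  exact congrArg (fun f => symMul p f s)
    (LinearMap.ext fun x => (hu _ _ (SimplexCategory.δ k) x).symm)

/-- The cochain `∑ (-1)^j ((x_{j-1} + x_j)^p - x_{j-1}^p - x_j^p) / p`. -/
def mixedSum (p : ℕ) {i : ℕ} {B : Type*} [CommRing B] (x : Fin (i + 1) → B) : B :=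
  ∑ j : Fin (i + 2), (-1 : ℤ) ^ (j : ℕ) • mixedPoly p (padLeft x j) (padRight x j)

variable [hp : Fact p.Prime]

theorem symMul_tateCocycle (hR : IsUnit ((p - 1).factorial : R)) {B : Type w} [CommRing B]
    [Algebra R B] (f : (Surj ⦋i + 1⦌ i → R) →ₗ[R] B) :
    symMul p f (tateCocycle R p i) =
      -(Ring.inverse ((p - 1).factorial : R) • mixedSum p (f ∘ dkBasis R i)) := by
  simp only [tateCocycle, map_neg, map_sum, map_zsmul, symMul_mixedPower, sum_properSets hR,
    mixedSum, Finset.smul_sum, map_padLeft f (map_zero f), map_padRight f (map_zero f)]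
  congr 1
  exact Finset.sum_congr rfl fun j _ => smul_comm _ _ _

/-- Expand by `teich_add`: the terms [x_{j-1}] + [x_j] cancel in the alternating sum, leaving only
the Verschiebung terms. -/
theorem sum_teich {B : Type v} [CommRing B] (x : Fin (i + 1) → B) :
    ∑ j : Fin (i + 2), (-1 : ℤ) ^ (j : ℕ) • teich p (padLeft x j + padRight x j) =
      wittV p B (mixedSum p x) := by
  simp only [teich_add, mixedSum, map_sum, map_zsmul]
  have h := sum_padLeft_add_padRight (teich p ∘ x)
  simp only [← map_padLeft (teich p) (teich_zero p), ← map_padRight (teich p) (teich_zero p)] at h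
  rw [← sub_eq_zero, ← h, ← Finset.sum_sub_distrib]
  refine Finset.sum_congr rfl fun j _ => ?_
  rw [← smul_sub, add_sub_cancel_right]

/-- This is the ghost component of `sum_teich`. -/
theorem mul_mixedSum {B : Type v} [CommRing B] (x : Fin (i + 1) → B) :
    (p : B) * mixedSum p x =
      ∑ j : Fin (i + 2), (-1 : ℤ) ^ (j : ℕ) • (padLeft x j + padRight x j) ^ p := by
  have h := congrArg (wittGhost p B) (sum_teich (p := p) x)
  rw [wittGhost_wittV, map_sum] at h
  simp only [map_zsmul, wittGhost_teich] at h
  exact h.symm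

/-- The Teichmüller representative [a] lifts a, and the sum in `hc` is its coboundary in W₂(A). -/
theorem isClass_wittBockH (A : CosimplicialObject CommRingCat.{v}) {a : A.obj ⦋i⦌} {x : Coh i A}
    (h : IsClass (cochains (addOf A)) (k := i) a x) (c : A.obj ⦋i + 1⦌)
    (hc : ∑ j : Fin (i + 2), (-1 : ℤ) ^ (j : ℕ) • teich p ((A.δ j).hom a) = wittV p _ c) :
    IsClass (cochains (addOf A)) (k := i + 1) c (wittBockH p A i x) := by
  refine IsClass.connecting (X := addOf A) (Y := addOf (wittOf p A)) (Z := addOf A) _ _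
    (fun n => witt_isSES p (A.obj n)) h (teich p a) (wittProj_teich p a) c ?_
  refine hc.symm.trans (Eq.trans ?_ (ring_d_apply (wittOf p A) i (teich p a)).symm)
  refine Finset.sum_congr rfl fun j _ => ?_
  congr 1
  exact (wittFun_teich p _ a).symm

/-- Wilson's theorem: p divides (p-1)! + 1; now divide by (p-1)!. -/
theorem exists_coe_eq_neg_inverse_add (hR : IsUnit ((p - 1).factorial : R)) :
    ∃ r : R, 1 + Ring.inverse ((p - 1).factorial : R) = p * r := by
  have h : p ∣ (p - 1).factorial + 1 := by
    rw [← CharP.cast_eq_zero_iff (ZMod p) p]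
    push_cast
    rw [ZMod.wilsons_lemma, neg_add_cancel]
  obtain ⟨k, hk⟩ := h
  refine ⟨k * Ring.inverse ((p - 1).factorial : R), ?_⟩
  rw [← mul_assoc, ← Nat.cast_mul, ← hk]
  push_cast
  rw [add_mul, Ring.mul_inverse_cancel _ hR, one_mul]

/-- Let m = `mixedSum p y`, which represents the Witt connecting map. The image of the cocycle is
-m/(p-1)!, and with 1 + 1/(p-1)! = p·r this equals m - r·p·m = m - d(r·a^p). -/
theorem isClass_symMul_tateCocycle (hR : IsUnit ((p - 1).factorial : R))
    {A : CosimplicialObject (CommAlgCat.{v} R)}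
    {u : ∀ n : SimplexCategory, (dk R i).obj n →ₗ[R] A.obj n} (hu : IsCosMap u)
    {x : Coh i (ringOf A)}
    (h : IsClass (cochains (addOf (ringOf A))) (k := i) (u ⦋i⦌ (dkOne R i)) x) :
    IsClass (cochains (addOf (ringOf A))) (k := i + 1)
      (symMul p (u ⦋i + 1⦌) (tateCocycle R p i)) (wittBockH p (ringOf A) i x) := by
  set a : A.obj ⦋i⦌ := u ⦋i⦌ (dkOne R i) with ha
  let y : Fin (i + 1) → A.obj ⦋i + 1⦌ := fun b => u ⦋i + 1⦌ (dkBasis R i b)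
  have hδ : ∀ j : Fin (i + 2), (A.δ j).hom a = padLeft y j + padRight y j := by
    intro j
    have h1 := hu _ _ (SimplexCategory.δ j) (dkOne R i)
    have h2 : u ⦋i + 1⦌ ((dk R i).map (SimplexCategory.δ j) (dkOne R i)) =
        u ⦋i + 1⦌ (padLeft (dkBasis R i) j + padRight (dkBasis R i) j :) :=
      congrArg _ (dkMap_δ_dkGen_eq j)
    have h3 := map_padLeft (u ⦋i + 1⦌) (map_zero _) (dkBasis R i) j
    have h4 := map_padRight (u ⦋i + 1⦌) (map_zero _) (dkBasis R i) j
    refine h1.symm.trans (h2.trans ((map_add (u ⦋i + 1⦌) _ _).trans ?_))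
    exact congrArg₂ (· + ·) h3 h4
  let c : A.obj ⦋i + 1⦌ := mixedSum p y
  have hc : IsClass (cochains (addOf (ringOf A))) (k := i + 1) c
      (wittBockH p (ringOf A) i x) := by
    refine isClass_wittBockH (ringOf A) h _ ?_
    refine Eq.trans ?_ (sum_teich y)
    refine Finset.sum_congr rfl fun j _ => ?_
    congr 2
    exact hδ j
  obtain ⟨r, hr⟩ := exists_coe_eq_neg_inverse_add (p := p) hR
  have hd : (show A.obj ⦋i + 1⦌ from (cochains (addOf (ringOf A))).d i (i + 1) (r • a ^ p)) =
      r • ((p : A.obj ⦋i + 1⦌) * mixedSum p y) := by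
    refine (algebra_d_apply A i _).trans ?_
    rw [mul_mixedSum, Finset.smul_sum]
    refine Finset.sum_congr rfl fun j _ => ?_
    rw [map_smul, map_pow, hδ, smul_comm]
  have h5 := hc.sub
    (isClass_d (k := i + 1) (show (cochains (addOf (ringOf A))).X i from r • a ^ p))
  rw [sub_zero] at h5
  have h6 : symMul p (u ⦋i + 1⦌) (tateCocycle R p i) = mixedSum p y -
      (show A.obj ⦋i + 1⦌ from (cochains (addOf (ringOf A))).d i (i + 1) (r • a ^ p)) := by
    refine (symMul_tateCocycle hR (u ⦋i + 1⦌)).trans ?_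
    have h7 : r • ((p : A.obj ⦋i + 1⦌) * mixedSum p y) = ((p : R) * r) • mixedSum p y := by
      rw [mul_smul, smul_comm, Nat.cast_smul_eq_nsmul, nsmul_eq_mul, ← smul_eq_mul, smul_eq_mul]
    rw [hd, h7, ← hr, add_smul, one_smul, sub_add_cancel_left]
    rfl
  exact h6 ▸ h5

/-- The cochain depends on u and on the Tate generator, but its class is always the Witt connecting
map at x, so the relation is the graph of a function. -/
theorem P1Rel_iff (hR : IsUnit ((p - 1).factorial : R)) (A : CosimplicialObject (CommAlgCat.{v} R))
    (x : Coh i (ringOf A)) (y : Coh (i + 1) (ringOf A)) :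
    P1Rel p A x y ↔ wittBockH p (ringOf A) i x = y := by
  constructor
  · rintro ⟨t, u, hu, hx, hy⟩
    obtain ⟨h, hh⟩ := t.exists_eq_tateCocycle hR
    have h1 := isClass_symMul_tateCocycle hR hu hx
    refine (IsClass.eq_of_sub hy h1 (symMul p (u ⦋i⦌) h) ?_).symm
    rw [d_symMul hu, ← hh]
    exact map_add _ _ _
  · rintro rfl
    obtain ⟨u, hu, hx⟩ := exists_isCosMap A x
    exact ⟨tateGen hR, u, hu, hx, isClass_symMul_tateCocycle hR hu hx⟩

theorem P0Rel_iff (A : CosimplicialObject (CommAlgCat.{v} (ZMod p))) (x y : Coh i (ringOf A)) :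
    P0Rel p A x y ↔ frobH p A i x = y := by
  have key : ∀ u : ∀ n : SimplexCategory, (dk (ZMod p) i).obj n →ₗ[ZMod p] A.obj n,
      IsClass (cochains (addOf (ringOf A))) (k := i) (u ⦋i⦌ (dkOne _ i)) x →
      IsClass (cochains (addOf (ringOf A))) (k := i)
        (symMul p (u ⦋i⦌) (symPow p (dkOne (ZMod p) i) :
          Sym (ZMod p) p ((dk (ZMod p) i).obj (SimplexCategory.mk i)))) (frobH p A i x) := by
    intro u hx
    have h1 : symMul p (u ⦋i⦌) (symPow p (dkOne (ZMod p) i) :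
        Sym (ZMod p) p ((dk (ZMod p) i).obj ⦋i⦌)) = (u ⦋i⦌ (dkOne _ i)) ^ p := by
      rw [symPow, symMul_tprod]
      simp
    rw [h1]
    exact hx.map ((alternatingCofaceMapComplex AddCommGrpCat.{v}).map
      (((CosimplicialObject.whiskering _ _).obj addGrp).map
        (frobTrans p (ringOf A) (natCast_eq_zero p A))))
  constructor
  · rintro ⟨u, _, hx, hy⟩
    exact (key u hx).unique hy
  · rintro rfl
    obtain ⟨u, hu, hx⟩ := exists_isCosMap A x
    exact ⟨u, hu, hx, key u hx⟩

end Main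

/-! ## Comparison of the Bockstein homomorphisms -/

section Comparison

variable (p : ℕ) [hp : Fact p.Prime]

theorem exists_wittV_eq {S : Type v} [CommRing S] {x : TruncatedWittVector p 2 S}
    (h : wittProj p S x = 0) : ∃ c : S, wittV p S c = x :=
  ((witt_isSES p (CommRingCat.of S)).exact x).1 h

theorem exists_sum_teich_eq {A : CosimplicialObject CommRingCat.{v}} {i : ℕ} {a : A.obj ⦋i⦌}
    (ha : (cochains (addOf A)).d i (i + 1) a = 0) :
    ∃ c : A.obj ⦋i + 1⦌,
      ∑ j : Fin (i + 2), (-1 : ℤ) ^ (j : ℕ) • teich p ((A.δ j).hom a) = wittV p _ c := by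
  have h : wittProj p _ (∑ j : Fin (i + 2), (-1 : ℤ) ^ (j : ℕ) • teich p ((A.δ j).hom a)) = 0 := by
    refine Eq.trans ?_ ((ring_d_apply A i a).symm.trans ha)
    refine (map_sum (wittProj p _) _ _).trans (Finset.sum_congr rfl fun j _ => ?_)
    exact (map_zsmul (wittProj p _) _ _).trans (congrArg _ (wittProj_teich p _))
  obtain ⟨c, hc⟩ := exists_wittV_eq p h
  exact ⟨c, hc.symm⟩

/-- One cochain c represents both sides. It satisfies d[a] = V(c); the ghost component turns this
into d(a^p) = p·c, and a^p lifts the Frobenius of the reduction of a. -/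
theorem bockFrob_eq_wittBockH (A : CosimplicialObject CommRingCat.{v}) (hA : TorsionFree p A)
    (i : ℕ) (x : Coh i A) : bockFrob p A hA i x = wittBockH p A i x := by
  obtain ⟨a, ha⟩ := exists_cocycle x
  obtain ⟨c, hc⟩ := exists_sum_teich_eq p (a := a) (ha.d_eq_zero _)
  refine IsClass.unique ?_ (isClass_wittBockH A ha c hc)
  have h1 := (ha.map ((alternatingCofaceMapComplex AddCommGrpCat.{v}).map
    (((CosimplicialObject.whiskering _ _).obj addGrp).map (redOf p A)))).map
    ((alternatingCofaceMapComplex AddCommGrpCat.{v}).map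
      (((CosimplicialObject.whiskering _ _).obj addGrp).map (frobModP p A)))
  let b : A.obj ⦋i⦌ := (show A.obj ⦋i⦌ from a) ^ p
  refine IsClass.connecting (X := addOf A) (Y := addOf A) (Z := addOf (modPOf p A)) _ _
    (fun n => modP_isSES p (A.obj n) (hA n)) h1 b ?_ c ?_
  · exact map_pow (Ideal.Quotient.mk (Ideal.span {(p : A.obj ⦋i⦌)})) (show A.obj ⦋i⦌ from a) p
  · refine Eq.trans ?_ (ring_d_apply A i b).symm
    have h2 := congrArg (wittGhost p _) hc
    change (p : A.obj ⦋i + 1⦌) * c = _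
    refine (wittGhost_wittV p _).symm.trans (h2.symm.trans ?_)
    refine (map_sum (wittGhost p _) _ _).trans (Finset.sum_congr rfl fun j _ => ?_)
    refine (map_zsmul (wittGhost p _) _ _).trans (congrArg _ ((wittGhost_teich p _).trans ?_))
    exact (map_pow (A.δ j).hom _ p).symm

end Comparison

/-! ## Augmented total complexes -/

section Augmentation

variable {K : ChainComplex (CochainComplex AddCommGrpCat.{v} ℕ) ℕ}
  {Y : CochainComplex AddCommGrpCat.{v} ℕ}

theorem totD_apply (a : Fam K) (m n : ℕ) : totD K a m n =
    (K.X m).d (n - 1) n (a m (n - 1)) + (-1 : ℤ) ^ n • (K.d (m + 1) m).f n (a (m + 1) n) := rfl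

theorem IsClass.extend {j : ℕ} {j' : ℤ} (hj : ComplexShape.embeddingUpNat.f j = j')
    {a : (Y.extend ComplexShape.embeddingUpNat).X j'}
    {x : (Y.extend ComplexShape.embeddingUpNat).homology j'} (h : IsClass _ a x) :
    IsClass Y ((Y.extendXIso _ hj).hom a) ((Y.extendHomologyIso _ hj).hom x) := by
  obtain ⟨z, rfl, rfl⟩ := h
  refine ⟨(Y.extendCyclesIso _ hj).hom z, ?_, ?_⟩
  · rw [← ConcreteCategory.comp_apply, HomologicalComplex.extendCyclesIso_hom_iCycles,
      ConcreteCategory.comp_apply]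
  · rw [← ConcreteCategory.comp_apply, ← ConcreteCategory.comp_apply,
      HomologicalComplex.homologyπ_extendHomologyIso_hom]

theorem liftExtend_f_extendXIso (e : K.X 0 ⟶ Y) (he : K.d 1 0 ≫ e = 0) {i : ℕ} {j : ℤ}
    (hj : ComplexShape.embeddingUpNat.f i = j) :
    (ComplexShape.embeddingUpNat.liftExtend (augRestr K e he) (augRestr_hasLift K e he)).f j ≫
      (Y.extendXIso ComplexShape.embeddingUpNat hj).hom =
    ((totObj K).restrictionXIso ComplexShape.embeddingUpNat hj).inv ≫ (augRestr K e he).f i := by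
  rw [ComplexShape.Embedding.liftExtend_f _ _ _ hj]
  simp only [Category.assoc, Iso.inv_hom_id, Category.comp_id]

theorem IsClass.aug (e : K.X 0 ⟶ Y) (he : K.d 1 0 ≫ e = 0) {i : ℕ} {a : totX K (i : ℤ)}
    {x : (totObj K).homology (i : ℤ)} (h : IsClass (totObj K) (k := (i : ℤ)) a x) :
    IsClass Y (e.f i (a.1 0 i)) ((HomologicalComplex.homologyMap
      (ComplexShape.embeddingUpNat.liftExtend (augRestr K e he) (augRestr_hasLift K e he))
        (i : ℤ) ≫ (Y.extendHomologyIso ComplexShape.embeddingUpNat rfl).hom) x) := by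
  have h1 := (h.map (ComplexShape.embeddingUpNat.liftExtend (augRestr K e he)
    (augRestr_hasLift K e he))).extend rfl
  have h2 : _ = e.f i (a.1 0 i) :=
    congrArg (fun f => f a) (liftExtend_f_extendXIso e he (i := i) rfl)
  exact h2 ▸ h1

theorem exists_isClass_tot {k : ℤ} {a : totX K k} (h : totD K a.1 = 0) :
    ∃ x, IsClass (totObj K) (k := k) a x :=
  exists_isClass (C := totObj K) (l := k + 1) (by simp)
    (Subtype.ext ((totObj_d_apply K rfl a).trans h))

/-- The entries of b are built by induction on m from exactness in the resolution direction.
Infinitely many may be nonzero, which the product totalization permits. -/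
theorem exists_totD_eq (e : K.X 0 ⟶ Y)
    (h0 : ∀ n x, e.f n x = 0 → ∃ y, (K.d 1 0).f n y = x)
    (h1 : ∀ m n x, (K.d (m + 1) m).f n x = 0 → ∃ y, (K.d (m + 1 + 1) (m + 1)).f n y = x) {i : ℕ}
    (c : Fam K) (hc : c ∈ totX K i) (hD : totD K c = 0) (hec : e.f i (c 0 i) = 0) :
    ∃ b ∈ totX K ((i : ℤ) - 1), (∀ n, b 0 n = 0) ∧ totD K b = c := by
  have hpm : ∀ (n : ℕ) {G : Type v} [AddCommGroup G] (g : G),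
      (-1 : ℤ) ^ n • (-1 : ℤ) ^ n • g = g := fun n G _ g => by
    rw [smul_smul, ← pow_add, Even.neg_one_pow ⟨n, rfl⟩, one_smul]
  -- Here β is the entry b_{m+1}^{i+m}. The condition `P` is what makes the remaining error in
  -- column m+1 closed for the simplicial differential.
  let P : ∀ m, (K.X (m + 1)).X (i + m) → Prop := fun m β =>
    (K.X m).d (i + m) (i + m + 1) ((-1 : ℤ) ^ (i + m) • (K.d (m + 1) m).f (i + m) β) =
      (K.X m).d (i + m) (i + m + 1) (c m (i + m))
  have start : ∃ y : (K.X 1).X i, (-1 : ℤ) ^ i • (K.d 1 0).f i y = c 0 i := by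
    obtain ⟨y, hy⟩ := h0 i _ hec
    exact ⟨(-1 : ℤ) ^ i • y, by rw [map_zsmul, hpm, hy]⟩
  have step : ∀ m (x : {β // P m β}), ∃ y : (K.X (m + 1 + 1)).X (i + m + 1),
      (-1 : ℤ) ^ (i + m + 1) • (K.d (m + 1 + 1) (m + 1)).f (i + m + 1) y =
        c (m + 1) (i + m + 1) - (K.X (m + 1)).d (i + m) (i + m + 1) x.1 := by
    rintro m ⟨x, hx⟩
    have h2 : (K.d (m + 1) m).f (i + m + 1) (c (m + 1) (i + m + 1) -
        (K.X (m + 1)).d (i + m) (i + m + 1) x) = 0 := by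
      have h3 := congrFun (congrFun hD m) (i + m + 1)
      rw [totD_apply] at h3
      change (K.X m).d (i + m) (i + m + 1) (c m (i + m)) + _ = 0 at h3
      have h4 : (K.d (m + 1) m).f (i + m + 1) ((K.X (m + 1)).d (i + m) (i + m + 1) x) =
          (-1 : ℤ) ^ (i + m) • (K.X m).d (i + m) (i + m + 1) (c m (i + m)) := by
        rw [← hx, map_zsmul, hpm, hom_d_apply]
      rw [map_sub, h4, eq_neg_of_add_eq_zero_left h3, pow_succ, mul_neg_one, neg_smul, neg_neg,
        hpm, sub_self]
    obtain ⟨y, hy⟩ := h1 _ _ _ h2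
    exact ⟨(-1 : ℤ) ^ (i + m + 1) • y, by rw [map_zsmul, hpm, hy]⟩
  let β : ∀ m, {β // P m β} := fun m => Nat.rec
    ⟨start.choose, congrArg ((K.X 0).d i (i + 1)) start.choose_spec⟩
    (fun m x => ⟨(step m x).choose, by
      change (K.X (m + 1)).d (i + m + 1) (i + m + 1 + 1) ((-1 : ℤ) ^ (i + m + 1) •
        (K.d (m + 1 + 1) (m + 1)).f (i + m + 1) _) = _
      rw [(step m x).choose_spec, map_sub, d_d_apply, sub_zero]
      rfl⟩) m
  have hβ0 : (-1 : ℤ) ^ i • (K.d 1 0).f i (β 0).1 = c 0 i := start.choose_spec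
  have hβ : ∀ m, (-1 : ℤ) ^ (i + m + 1) • (K.d (m + 1 + 1) (m + 1)).f (i + m + 1) (β (m + 1)).1 =
      c (m + 1) (i + m + 1) - (K.X (m + 1)).d (i + m) (i + m + 1) (β m).1 :=
    fun m => (step m (β m)).choose_spec
  let b : Fam K := fun m => match m with
    | 0 => 0
    | m + 1 => Pi.single (i + m) (β m).1
  have hb : ∀ m, b (m + 1) (i + m) = (β m).1 := fun m => Pi.single_eq_same _ _
  have hmem : b ∈ totX K ((i : ℤ) - 1) := by
    intro m n hmn
    cases m with
    | zero => rfl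
    | succ m => exact Pi.single_eq_of_ne (by push_cast at hmn; omega) _
  refine ⟨b, hmem, fun _ => rfl, ?_⟩
  funext m n
  by_cases hmn : (n : ℤ) - m = i
  · obtain rfl : n = i + m := by omega
    cases m with
    | zero =>
      rw [totD_apply, hb]
      change (K.X 0).d _ _ 0 + _ = _
      rw [map_zero, zero_add]
      exact hβ0
    | succ m =>
      rw [totD_apply, hb]
      change (K.X (m + 1)).d (i + m) (i + m + 1) (b (m + 1) (i + m)) +
        (-1 : ℤ) ^ (i + m + 1) • (K.d (m + 1 + 1) (m + 1)).f (i + m + 1) (β (m + 1)).1 = _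
      rw [hb, hβ, add_sub_cancel]
      rfl
  · rw [hc m n hmn, totD_mem K _ b hmem m n (by simpa using hmn)]

/-- The family with the single entry `z` in bidegree `(0, n)`. -/
def famSingle (K : ChainComplex (CochainComplex AddCommGrpCat.{v} ℕ) ℕ) {n : ℕ}
    (z : (K.X 0).X n) : Fam K :=
  Pi.single 0 (Pi.single n z)

theorem famSingle_apply {n : ℕ} (z : (K.X 0).X n) : famSingle K z 0 n = z := by
  rw [famSingle, Pi.single_eq_same, Pi.single_eq_same]

theorem famSingle_mem {n : ℕ} (z : (K.X 0).X n) : famSingle K z ∈ totX K n := by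
  intro m n' h
  rw [famSingle]
  rcases eq_or_ne m 0 with rfl | hm
  · rw [Pi.single_eq_same, Pi.single_eq_of_ne (by rintro rfl; simp at h)]
  · rw [Pi.single_eq_of_ne hm]
    rfl

/-- For injectivity, a bounding cochain of e(a_0) is lifted to column 0 and its total coboundary
subtracted; what remains augments to zero and bounds by `exists_totD_eq`. For surjectivity, a lift z
of the cocycle has D z augmenting to zero, so D z = D b with b zero in column 0, and z - b is a
cocycle with the same augmentation. -/
theorem aug_bijective (e : K.X 0 ⟶ Y) (he : K.d 1 0 ≫ e = 0)
    (hs : ∀ n, Function.Surjective (e.f n))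
    (h0 : ∀ n x, e.f n x = 0 → ∃ y, (K.d 1 0).f n y = x)
    (h1 : ∀ m n x, (K.d (m + 1) m).f n x = 0 → ∃ y, (K.d (m + 1 + 1) (m + 1)).f n y = x) (i : ℕ) :
    Function.Bijective (HomologicalComplex.homologyMap
      (ComplexShape.embeddingUpNat.liftExtend (augRestr K e he) (augRestr_hasLift K e he))
        (i : ℤ) ≫ (Y.extendHomologyIso ComplexShape.embeddingUpNat rfl).hom) := by
  constructor
  · refine (injective_iff_map_eq_zero _).2 fun ξ hξ => ?_
    obtain ⟨a : totX K i, ha⟩ := exists_cocycle ξ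
    have h2 := ha.aug e he
    rw [hξ] at h2
    have hDa : totD K a.1 = 0 :=
      (totObj_d_apply K rfl a).symm.trans (congrArg Subtype.val (ha.d_eq_zero (i + 1)))
    have h3 : ∃ ζ ∈ totX K ((i : ℤ) - 1), e.f i (totD K ζ 0 i) = e.f i (a.1 0 i) := by
      obtain ⟨y, hy⟩ := (isClass_zero_iff (j := i - 1) (by cases i <;> simp)).1 h2
      cases i with
      | zero =>
        refine ⟨0, zero_mem _, ?_⟩
        rw [← hy, aug_totD K e he]
        have h4 : Y.d (0 - 1) 0 = 0 := HomologicalComplex.shape _ _ _ (by simp)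
        rw [h4]
        rfl
      | succ i =>
        obtain ⟨z, rfl⟩ := hs _ y
        refine ⟨famSingle K z, ?_, ?_⟩
        · have h4 := famSingle_mem z
          simpa using h4
        · rw [← hy, aug_totD K e he]
          change Y.d i (i + 1) (e.f i (famSingle K z 0 i)) = _
          exact congrArg (fun t => Y.d i (i + 1) (e.f i t)) (famSingle_apply (n := i) z)
    obtain ⟨ζ, hζ, hζa⟩ := h3
    obtain ⟨b, hb, -, hDb⟩ := exists_totD_eq e h0 h1 (a.1 - totD K ζ)
      (sub_mem a.2 (by simpa using totD_mem K _ ζ hζ))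
      (by rw [map_sub, hDa, totD_totD, sub_zero])
      (by rw [Pi.sub_apply, Pi.sub_apply, map_sub, hζa, sub_self])
    refine ha.unique ((isClass_zero_iff (j := (i : ℤ) - 1) (by simp)).2
      ⟨(⟨b + ζ, add_mem hb hζ⟩ : totX K ((i : ℤ) - 1)), ?_⟩)
    refine Subtype.ext ((totObj_d_apply K (by ring) _).trans ?_)
    change totD K (b + ζ) = _
    rw [map_add, hDb, sub_add_cancel]
  · intro y
    obtain ⟨x, hx⟩ := exists_cocycle y
    obtain ⟨z, hz⟩ := hs i x
    have hm := totD_mem K _ _ (famSingle_mem z)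
    obtain ⟨b, hb, hb0, hDb⟩ := exists_totD_eq (i := i + 1) e h0 h1 (totD K (famSingle K z))
      (by simpa using hm) (totD_totD K _) (by
        rw [aug_totD K e he]
        change Y.d i (i + 1) (e.f i (famSingle K z 0 i)) = 0
        rw [famSingle_apply, hz]
        exact hx.d_eq_zero _)
    obtain ⟨ξ, hξ⟩ := exists_isClass_tot (K := K) (k := i)
      (a := ⟨famSingle K z - b, sub_mem (famSingle_mem z) (by simpa using hb)⟩)
      (by rw [map_sub, hDb, sub_self])
    refine ⟨ξ, (hξ.aug e he).unique ?_⟩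
    have h4 : e.f i ((famSingle K z - b) 0 i) = x := by
      rw [Pi.sub_apply, Pi.sub_apply, hb0, sub_zero, famSingle_apply, hz]
    exact h4 ▸ hx

end Augmentation

/-! ## Flat resolutions -/

section Resolutions

/-- The double complex of a simplicial object in cosimplicial abelian groups. -/
abbrev dblCpx (X : SimplicialObject (CosimplicialObject AddCommGrpCat.{v})) :
    ChainComplex (CochainComplex AddCommGrpCat.{v} ℕ) ℕ :=
  (alternatingFaceMapComplex (CochainComplex AddCommGrpCat.{v} ℕ)).obj
    (((SimplicialObject.whiskering _ _).obj (alternatingCofaceMapComplex AddCommGrpCat.{v})).obj X)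

theorem dblCpx_d_apply (X : SimplicialObject (CosimplicialObject AddCommGrpCat.{v})) (m n : ℕ)
    (x : (X.obj (op ⦋m + 1⦌)).obj ⦋n⦌) :
    (show (X.obj (op ⦋m⦌)).obj ⦋n⦌ from ((dblCpx X).d (m + 1) m).f n x) =
      ∑ k : Fin (m + 2), (-1 : ℤ) ^ (k : ℕ) • (X.δ k).app ⦋n⦌ x := by
  have h : ((dblCpx X).d (m + 1) m).f n =
      ∑ k : Fin (m + 2), (-1 : ℤ) ^ (k : ℕ) • (X.δ k).app ⦋n⦌ := by
    rw [alternatingFaceMapComplex_obj_d, AlternatingFaceMapComplex.objD]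
    let F := HomologicalComplex.Hom.fAddMonoidHom (C₁ := (dblCpx X).X (m + 1))
      (C₂ := (dblCpx X).X m) n
    exact (map_sum F _ _).trans (Finset.sum_congr rfl fun k _ => map_zsmul F _ _)
  exact (congrArg (fun f => f x) h).trans (sum_zsmul_hom_apply _ _ _ x)

theorem faceSum_eq {R : Type} [CommRing R]
    (P : SimplicialObject (CosimplicialObject (CommAlgCat.{v} R))) (m n : ℕ)
    (x : (P.obj (op ⦋m + 1⦌)).obj ⦋n⦌) :
    ((dblCpx (addOf2 (ringOf2 P))).d (m + 1) m).f n x = faceSum P m ⦋n⦌ x :=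
  dblCpx_d_apply (addOf2 (ringOf2 P)) m n x

theorem cohAug_bijective {R : Type} [CommRing R]
    {P : SimplicialObject (CosimplicialObject (CommAlgCat.{v} R))}
    {A : CosimplicialObject (CommAlgCat.{v} R)} {ε : P ⟶ (SimplicialObject.const _).obj A}
    (hP : IsFlatResolution ε) (i : ℕ) : Function.Bijective (cohAug (ringAug ε) i) := by
  refine aug_bijective (K := dblCpx (addOf2 (ringOf2 P))) _ _ (fun n => hP.surj ⦋n⦌) ?_ ?_ i
  · intro n x hx
    obtain ⟨y, hy⟩ := hP.exact_zero ⦋n⦌ x hx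
    exact ⟨y, (faceSum_eq P 0 n y).trans hy⟩
  · intro m n x hx
    obtain ⟨y, hy⟩ := hP.exact_succ m ⦋n⦌ x ((faceSum_eq P m n x).symm.trans hx)
    exact ⟨y, (faceSum_eq P (m + 1) n y).trans hy⟩

theorem IsClass.cohAug {P : SimplicialObject (CosimplicialObject CommRingCat.{v})}
    {A : CosimplicialObject CommRingCat.{v}} (ε : P ⟶ (SimplicialObject.const _).obj A) {i : ℕ}
    {a : totX (dblCpx (addOf2 P)) (i : ℤ)} {ξ : Coh2 (i : ℤ) P}
    (h : IsClass (tot (addOf2 P)) (k := (i : ℤ)) a ξ) :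
    IsClass (cochains (addOf A)) (k := i)
      (((ε.app (op ⦋0⦌)).app ⦋i⦌).hom (a.1 0 i)) (cohAug ε i ξ) :=
  IsClass.aug (K := dblCpx (addOf2 P)) (Y := cochains (addOf A))
    ((alternatingCofaceMapComplex AddCommGrpCat.{v}).map
      (((((SimplicialObject.whiskering _ _).obj ((CosimplicialObject.whiskering _ _).obj
        addGrp)).map ε).app (op ⦋0⦌)) : _ ⟶ addOf A))
    (aug_comp_d (X := addOf2 P) (Y := addOf A) _) h

variable (p : ℕ) [hp : Fact p.Prime]

/-- The ghost component as a natural transformation. -/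
def wittGhostTrans : wittTwo p ⟶ 𝟭 CommRingCat.{v} where
  app S := CommRingCat.ofHom (wittGhost p S)
  naturality S T f := by
    apply CommRingCat.hom_ext
    refine RingHom.ext fun (x : TruncatedWittVector p 2 S) => ?_
    change (wittFun p f.hom x).coeff 0 ^ p + p * (wittFun p f.hom x).coeff 1 =
      f.hom (x.coeff 0 ^ p + p * x.coeff 1)
    simp [wittFun]

/-- `W₂` applied termwise to a simplicial cosimplicial commutative ring. -/
def wittOf2 (P : SimplicialObject (CosimplicialObject CommRingCat.{v})) :
    SimplicialObject (CosimplicialObject CommRingCat.{v}) :=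
  ((SimplicialObject.whiskering _ _).obj
    ((CosimplicialObject.whiskering _ _).obj (wittTwo p))).obj P

/-- Verschiebung, termwise. -/
def wittV2 (P : SimplicialObject (CosimplicialObject CommRingCat.{v})) :
    addOf2 P ⟶ addOf2 (wittOf2 p P) :=
  ((SimplicialObject.whiskering _ _).map
    ((CosimplicialObject.whiskering _ _).map (wittVTrans p))).app P

/-- The projection `W₂(P) → P`, termwise. -/
def wittProj2 (P : SimplicialObject (CosimplicialObject CommRingCat.{v})) : wittOf2 p P ⟶ P :=
  ((SimplicialObject.whiskering _ _).map
    ((CosimplicialObject.whiskering _ _).map (wittProjTrans p))).app P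

/-- The ghost component `W₂(P) → P`, termwise. -/
def wittGhost2 (P : SimplicialObject (CosimplicialObject CommRingCat.{v})) : wittOf2 p P ⟶ P :=
  ((SimplicialObject.whiskering _ _).map
    ((CosimplicialObject.whiskering _ _).map (wittGhostTrans p))).app P

/-- `W₂` applied to an augmentation. -/
def wittAug {P : SimplicialObject (CosimplicialObject CommRingCat.{v})}
    {A : CosimplicialObject CommRingCat.{v}} (ε : P ⟶ (SimplicialObject.const _).obj A) :
    wittOf2 p P ⟶ (SimplicialObject.const _).obj (wittOf p A) :=
  ((SimplicialObject.whiskering _ _).obj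
    ((CosimplicialObject.whiskering _ _).obj (wittTwo p))).map ε

theorem wittProj2_isSES (P : SimplicialObject (CosimplicialObject CommRingCat.{v})) (m n) :
    IsSES (((wittV2 p P).app m).app n) (((addMap2 (wittProj2 p P)).app m).app n) :=
  witt_isSES p ((P.obj m).obj n)

/-- The termwise Teichmüller representative of a family. -/
def teich2 (P : SimplicialObject (CosimplicialObject CommRingCat.{v})) {k : ℤ}
    (a : totX (dblCpx (addOf2 P)) k) : totX (dblCpx (addOf2 (wittOf2 p P))) k :=
  ⟨fun m n => teich p (show (P.obj (op ⦋m⦌)).obj ⦋n⦌ from a.1 m n), fun m n h => by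
    exact (congrArg (teich p (S := (P.obj (op ⦋m⦌)).obj ⦋n⦌)) (a.2 m n h)).trans (teich_zero p)⟩

/-- In the total complex of W₂(P), D[a] = V(c) with [a] taken entrywise. The ghost component gives
D(a^p) = p·c, so c represents Bock ∘ φ; the augmentation gives d[ε a_0] = V(ε c_0), so ε(c_0)
represents the Witt connecting map of A. No exactness of W₂(P) → W₂(A) enters. -/
theorem cohAug_bockFrob2 {P : SimplicialObject (CosimplicialObject CommRingCat.{v})}
    (hP : ∀ m, TorsionFree p (P.obj m)) {A : CosimplicialObject CommRingCat.{v}}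
    (ε : P ⟶ (SimplicialObject.const _).obj A) (i : ℕ) (ξ : Coh2 (i : ℤ) P) :
    wittBockH p A i (cohAug ε i ξ) = cohAug ε (i + 1) (bockFrob2 p P hP (i : ℤ) ξ) := by
  obtain ⟨a : totX (dblCpx (addOf2 P)) (i : ℤ), ha⟩ := exists_cocycle ξ
  let t : (tot (addOf2 (wittOf2 p P))).X (i : ℤ) := teich2 p P a
  have ht : (totHom (addMap2 (wittProj2 p P))).f i t = a :=
    Subtype.ext (funext fun m => funext fun n =>
      wittProj_teich (S := (P.obj (op ⦋m⦌)).obj ⦋n⦌) p (a.1 m n))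
  -- D[a] projects to D a = 0, so it lies in the image of V.
  obtain ⟨c, hc⟩ := ((totHom_isSES _ _ (wittProj2_isSES p P) ((i : ℤ) + 1)).exact
    ((tot (addOf2 (wittOf2 p P))).d i (i + 1) t)).1 (by
      rw [← hom_d_apply, ht]
      exact ha.d_eq_zero _)
  have h1 : IsClass (tot (addOf2 P)) (k := (i : ℤ) + 1) c (bockFrob2 p P hP (i : ℤ) ξ) := by
    refine IsClass.totConnecting (X := addOf2 P) (Y := addOf2 P) (Z := addOf2 (modPOf2 p P)) _ _
      (fun m n => modP_isSES p ((P.obj m).obj n) (hP m n))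
      ((ha.map (totHom (addMap2 (redOf2 p P)))).map (totHom (addMap2 (frobModP2 p P))))
      ((totHom (addMap2 (wittGhost2 p P))).f i t) ?_ c ?_
    · refine Subtype.ext (funext fun m => funext fun n => ?_)
      let b : (P.obj (op ⦋m⦌)).obj ⦋n⦌ := a.1 m n
      let q := Ideal.Quotient.mk (Ideal.span {(p : (P.obj (op ⦋m⦌)).obj ⦋n⦌)})
      exact (congrArg q (wittGhost_teich p b)).trans (map_pow q b p)
    · rw [hom_d_apply, ← hc]
      exact Subtype.ext (funext fun m => funext fun n =>
        (wittGhost_wittV (S := (P.obj (op ⦋m⦌)).obj ⦋n⦌) p (c.1 m n)).symm)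
  refine IsClass.unique ?_ (IsClass.cohAug ε (i := i + 1) h1)
  have h2 := congrFun (congrFun ((congrArg Subtype.val hc).trans
    (totObj_d_apply _ rfl (teich2 p P a))) 0) (i + 1)
  -- The augmentation kills the simplicial part of D[a], so only the cosimplicial coboundary of the
  -- entry [a_0] survives.
  have h3 := aug_totD (dblCpx (addOf2 (wittOf2 p P)))
    ((alternatingCofaceMapComplex AddCommGrpCat.{v}).map
      (((((SimplicialObject.whiskering _ _).obj ((CosimplicialObject.whiskering _ _).obj
        addGrp)).map (wittAug p ε)).app (op ⦋0⦌)) : _ ⟶ addOf (wittOf p A)))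
    (aug_comp_d (X := addOf2 (wittOf2 p P)) (Y := addOf (wittOf p A)) _) (teich2 p P a).1 (i + 1)
  rw [← h2] at h3
  refine IsClass.connecting (X := addOf A) (Y := addOf (wittOf p A)) (Z := addOf A) _ _
    (fun n => witt_isSES p (A.obj n)) (ha.cohAug ε)
    (teich p (S := A.obj ⦋i⦌) (((ε.app (op ⦋0⦌)).app ⦋i⦌).hom (a.1 0 i)))
    (wittProj_teich (S := A.obj ⦋i⦌) p _) _ ?_
  refine (wittFun_wittV (T := A.obj ⦋i + 1⦌) p
    ((ε.app (op ⦋0⦌)).app ⦋i + 1⦌).hom (c.1 0 (i + 1))).symm.trans (h3.trans ?_)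
  exact congrArg ((cochains (addOf (wittOf p A))).d i (i + 1))
    (wittFun_teich (T := A.obj ⦋i⦌) p ((ε.app (op ⦋0⦌)).app ⦋i⦌).hom (a.1 0 i))

end Resolutions

/-! ### Invertibility of (p-1)! in ℤ_p and in 𝔽_p -/

section Units

variable (p : ℕ) [hp : Fact p.Prime]

theorem isUnit_factorial_padicInt : IsUnit ((p - 1).factorial : ℤ_[p]) := by
  rw [PadicInt.isUnit_iff, PadicInt.norm_natCast_eq_one_iff]
  exact hp.out.coprime_factorial_of_lt (Nat.sub_lt hp.out.pos one_pos)

theorem isUnit_factorial_zmod : IsUnit ((p - 1).factorial : ZMod p) := by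
  rw [ZMod.wilsons_lemma]
  exact isUnit_one.neg

end Units

end CosimplicialSteenrod

end

/-- All claims about `P¹` reduce through `P1Rel_iff` to the Witt connecting map, over both base
rings; over ℤ_p it is then matched with the Bockstein of Frobenius. -/
theorem mainTheorem5 (p : ℕ) [Fact p.Prime] (i : ℕ) :
    (∀ A : CosimplicialObject (CommAlgCat.{v} ℤ_[p]),
      (∀ x : CosimplicialSteenrod.Coh i (CosimplicialSteenrod.ringOf A),
        ∃! y, CosimplicialSteenrod.P1Rel p A x y) ∧
      (∀ (P : SimplicialObject (CosimplicialObject (CommAlgCat.{v} ℤ_[p])))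
        (ε : P ⟶ (SimplicialObject.const _).obj A)
        (hP : CosimplicialSteenrod.IsFlatResolution ε),
        Function.Bijective (CosimplicialSteenrod.cohAug (CosimplicialSteenrod.ringAug ε) i) ∧
        ∀ ξ : CosimplicialSteenrod.Coh2 (i : ℤ) (CosimplicialSteenrod.ringOf2 P),
          CosimplicialSteenrod.P1Rel p A
            (CosimplicialSteenrod.cohAug (CosimplicialSteenrod.ringAug ε) i ξ)
            (CosimplicialSteenrod.cohAug (CosimplicialSteenrod.ringAug ε) (i + 1)
              (CosimplicialSteenrod.bockFrob2 p (CosimplicialSteenrod.ringOf2 P)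
                (fun m => CosimplicialSteenrod.torsionFree_of_flat p (P.obj m) (hP.flat m))
                (i : ℤ) ξ))) ∧
      (∀ (hA : ∀ n, Module.Flat ℤ_[p] (A.obj n))
        (x : CosimplicialSteenrod.Coh i (CosimplicialSteenrod.ringOf A)),
        CosimplicialSteenrod.P1Rel p A x
          (CosimplicialSteenrod.bockFrob p (CosimplicialSteenrod.ringOf A)
            (CosimplicialSteenrod.torsionFree_of_flat p A hA) i x))) ∧
    (∀ A₀ : CosimplicialObject (CommAlgCat.{v} (ZMod p)),
      (∀ x y : CosimplicialSteenrod.Coh i (CosimplicialSteenrod.ringOf A₀),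
        CosimplicialSteenrod.P0Rel p A₀ x y ↔ CosimplicialSteenrod.frobH p A₀ i x = y) ∧
      (∀ (x : CosimplicialSteenrod.Coh i (CosimplicialSteenrod.ringOf A₀))
        (y : CosimplicialSteenrod.Coh (i + 1) (CosimplicialSteenrod.ringOf A₀)),
        CosimplicialSteenrod.P1Rel p A₀ x y ↔
          CosimplicialSteenrod.wittBockH p (CosimplicialSteenrod.ringOf A₀) i x = y)) := by
  refine ⟨fun A => ⟨fun x => ?_, fun P ε hP =>
      ⟨CosimplicialSteenrod.cohAug_bijective hP i, fun ξ => ?_⟩,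
    fun hA x => ?_⟩, fun A => ⟨fun x y => CosimplicialSteenrod.P0Rel_iff A x y, fun x y =>
      CosimplicialSteenrod.P1Rel_iff (CosimplicialSteenrod.isUnit_factorial_zmod p) A x y⟩⟩
  · simp only [CosimplicialSteenrod.P1Rel_iff (CosimplicialSteenrod.isUnit_factorial_padicInt p)]
    exact existsUnique_eq'
  · rw [CosimplicialSteenrod.P1Rel_iff (CosimplicialSteenrod.isUnit_factorial_padicInt p)]
    exact CosimplicialSteenrod.cohAug_bockFrob2 p _ (CosimplicialSteenrod.ringAug ε) i ξ
  · rw [CosimplicialSteenrod.P1Rel_iff (CosimplicialSteenrod.isUnit_factorial_padicInt p)]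
    exact (CosimplicialSteenrod.bockFrob_eq_wittBockH p (CosimplicialSteenrod.ringOf A) _ i x).symm
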